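/- Fix an integer $n>1$; all indices (colors) are taken modulo $n$, and $\mathbb F=\mathbb Q(q,t)$. For $\mathbf k,\mathbf l\in\mathbb Q^n$ put $\mathbf k\cdot\mathbf l=\sum_i k_il_i$ and $(\mathbf k,\mathbf l)=\sum_i(2k_il_i-k_il_{i+1}-k_il_{i-1})$. For integers $i<j$ the arc $[i;j)$, taken modulo simultaneous translation of $(i,j)$ by $(n,n)$, has degree vector $[i;j)=\varsigma^i+\dots+\varsigma^{j-1}\in\mathbb Z_{\ge0}^n$, where $\varsigma^a$ is the basis vector at $a$ mod $n$; arcs that differ modulo $(n,n)$ are regarded as different even if their degree vectors agree. For $\mathbf k\in\mathbb Z_{\ge 0}^n$ consider variables $z_{ia}$ of color $i$ ($1\le i\le n$, $1\le a\le k_i$), together with their formal square roots. Let $\mathcal S^+_{\mathbf k}$ be the $\mathbb F$-vector space of all $$F=\prod_{i,a}z_{ia}^{\frac{k_{i-1}+k_{i+1}}2}\cdot\frac{r(\dots,z_{ia},\dots)}{\prod_{i}\prod_{1\le a\ne b\le k_i}(qz_{ia}-q^{-1}z_{ib})},$$ where $r$ is a Laurent polynomial over $\mathbb F$ in the $z_{ia}$,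 symmetric in the variables of each color, which satisfies the wheel conditions: $r$ vanishes identically whenever three variables of colors $i,i\pm1,i$ are set equal to $q^{-1},t^{\pm1},q$ respectively. For $\mathbf m\in\mathbb Q^n$ and $d\in\mathbb Z$, let $\mathcal S^+_{\le\mathbf m|\mathbf k,d}\subset\mathcal S^+_{\mathbf k}$ be the subspace of those $F$ that are homogeneous of degree $d$ and for which $$\lim_{\xi\to\infty}\frac{F(z_{i1},\dots,z_{ia_i},\xi z_{i,a_i+1},\dots,\xi z_{i,a_i+b_i})}{\xi^{\mathbf m\cdot\mathbf b-\frac{(\mathbf a,\mathbf b)}2}}$$ exists for all $\mathbf a,\mathbf b\in\mathbb Z_{\ge0}^n$ with $\mathbf a+\mathbf b=\mathbf k$. Let $\mathcal B^+_{\mathbf m|\mathbf k}=\mathcal S^+_{\le\mathbf m|\mathbf k,d}$ with $d=\mathbf m\cdot\mathbf k$ if $\mathbf m\cdot\mathbf k\in\mathbb Z$, and $\mathcal B^+_{\mathbf m|\mathbf k}=0$ otherwise. A $\mathbb Z$-indexed partition $(\rho,\delta)\vdash(\mathbf k,d)$ is an unordered collection of pairs $([i_1;j_1),d_1),\dots,([i_t;j_t),d_t)$,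 each consisting of an arc and an integer, with $\sum_s[i_s;j_s)=\mathbf k$ and $\sum_sd_s=d$; it has slope $\le\mathbf m$ if $d_s\le\mathbf m\cdot[i_s;j_s)$ for all $s$. An $\mathbf m$-integral partition of $\mathbf k$ is an unordered collection of arcs whose degree vectors add up to $\mathbf k$ and each of which satisfies $\mathbf m\cdot[i;j)\in\mathbb Z$. Then for all $\mathbf m\in\mathbb Q^n$, $\mathbf k\in\mathbb Z_{\ge0}^n$ and $d\in\mathbb Z$, the following dimensions and numbers are finite and $$\dim_{\mathbb F}\mathcal S^+_{\le\mathbf m|\mathbf k,d}\ \le\ \#\{(\rho,\delta)\vdash(\mathbf k,d)\text{ of slope}\le\mathbf m\},\qquad \dim_{\mathbb F}\mathcal B^+_{\mathbf m|\mathbf k}\ \le\ \#\{\mathbf m\text{-integral partitions of }\mathbf k\}.$$ -/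

import Mathlib

noncomputable section

namespace CyclicShuffle

/-- The base field `ℚ(q, t)`. -/
abbrev BaseField : Type := FractionRing (MvPolynomial (Fin 2) ℚ)

/-- The parameter `q`. -/
def q : BaseField := algebraMap (MvPolynomial (Fin 2) ℚ) BaseField (MvPolynomial.X 0)

/-- The parameter `t`. -/
def t : BaseField := algebraMap (MvPolynomial (Fin 2) ℚ) BaseField (MvPolynomial.X 1)

/-! ### Degree vectors (indexed by the colors `ZMod n`) -/

/-- The scalar product `m · b = ∑ i, m_i b_i`. -/
def scalarProd {n : ℕ} [NeZero n] (m : ZMod n → ℚ) (b : ZMod n → ℕ) : ℚ :=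
  ∑ i, m i * (b i : ℚ)

/-- The Killing form of the cyclic quiver,
`(a, b) = ∑ i, (2 a_i b_i - a_i b_{i+1} - a_i b_{i-1})`. -/
def killingForm {n : ℕ} [NeZero n] (a b : ZMod n → ℕ) : ℚ :=
  ∑ i, (2 * (a i : ℚ) * (b i : ℚ) - (a i : ℚ) * (b (i + 1) : ℚ) - (a i : ℚ) * (b (i - 1) : ℚ))

/-! ### Rational functions in the square roots of the variables -/

/-- The index set of the variables `z_{ia}`: a color `i` and an index `a` among `k_i` ones. -/
abbrev Var {n : ℕ} (k : ZMod n → ℕ) : Type := Σ i : ZMod n, Fin (k i)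

/-- The field of rational functions over `ℚ(q, t)` in the formal square roots `z_{ia}^{1/2}`. -/
abbrev RatField {n : ℕ} (k : ZMod n → ℕ) : Type := FractionRing (MvPolynomial (Var k) BaseField)

/-- The formal square root `z_{ia}^{1/2}`. -/
def sqrtZ {n : ℕ} {k : ZMod n → ℕ} (x : Var k) : RatField k :=
  algebraMap (MvPolynomial (Var k) BaseField) (RatField k) (MvPolynomial.X x)

/-- The variable `z_{ia}`. -/
def z {n : ℕ} {k : ZMod n → ℕ} (x : Var k) : RatField k := sqrtZ x ^ 2

/-- Laurent polynomials in the variables `z_{ia}`: an exponent vector `e` is sent to the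
coefficient of `∏ x, z_x ^ e_x`. -/
abbrev Laurent {n : ℕ} (k : ZMod n → ℕ) : Type := (Var k → ℤ) →₀ BaseField

/-- The value `r(v)` of a Laurent polynomial at a family `v` of rational functions. -/
def evalAt {n : ℕ} [NeZero n] {k : ZMod n → ℕ} (v : Var k → RatField k) :
    Laurent k →ₗ[BaseField] RatField k :=
  Finsupp.linearCombination BaseField (fun e : Var k → ℤ => ∏ x, v x ^ e x)

/-- `r` is symmetric in the variables of each given color. -/
def IsColorSymmetric {n : ℕ} {k : ZMod n → ℕ} (r : Laurent k) : Prop :=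
  ∀ (σ : ∀ i : ZMod n, Equiv.Perm (Fin (k i))) (e : Var k → ℤ),
    r (fun x => e ⟨x.1, σ x.1 x.2⟩) = r e

/-- The point whose coordinates `x`, `y`, `w` are the constants `α`, `β`, `γ`, all the other
coordinates being the variables themselves. -/
def wheelPoint {n : ℕ} {k : ZMod n → ℕ} (x y w : Var k) (α β γ : BaseField) :
    Var k → RatField k :=
  Function.update (Function.update (Function.update z x (algebraMap BaseField (RatField k) α))
    y (algebraMap BaseField (RatField k) β)) w (algebraMap BaseField (RatField k) γ)

/-- The wheel conditions: `r` vanishes identically when any three variables of colors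
`i`, `i ± 1`, `i` are set equal to `q⁻¹`, `t^{±1}`, `q` respectively. -/
def SatisfiesWheel {n : ℕ} [NeZero n] {k : ZMod n → ℕ} (r : Laurent k) : Prop :=
  ∀ x y w : Var k, x ≠ w → w.1 = x.1 →
    (y.1 = x.1 + 1 → evalAt (wheelPoint x y w q⁻¹ t q) r = 0) ∧
    (y.1 = x.1 - 1 → evalAt (wheelPoint x y w q⁻¹ t⁻¹ q) r = 0)

/-- The denominator `∏_i ∏_{a ≠ b} (q z_{ia} - q⁻¹ z_{ib})`. -/
def denom {n : ℕ} [NeZero n] (k : ZMod n → ℕ) : RatField k :=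
  ∏ i : ZMod n, ∏ a : Fin (k i), ∏ b ∈ Finset.univ.erase a,
    (q • z (k := k) ⟨i, a⟩ - q⁻¹ • z (k := k) ⟨i, b⟩)

/-- The monomial `∏_{i,a} z_{ia}^{(k_{i-1} + k_{i+1})/2}`. It is the product, over all pairs of
variables of adjacent colors, of the square roots that occur in the numerators
`[x] = x^{1/2} - x^{-1/2}` of the function `ζ` defining the shuffle product. -/
def halfMonomial {n : ℕ} [NeZero n] (k : ZMod n → ℕ) : RatField k :=
  ∏ x : Var k, sqrtZ x ^ (k (x.1 - 1) + k (x.1 + 1))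

/-- The piece of degree `k` of the positive shuffle algebra. -/
def shuffle {n : ℕ} [NeZero n] (k : ZMod n → ℕ) : Submodule BaseField (RatField k) where
  carrier := {F | ∃ r : Laurent k, IsColorSymmetric r ∧ SatisfiesWheel r ∧
    F = halfMonomial k * (evalAt z r / denom k)}
  zero_mem' := ⟨0, fun _ _ => rfl, fun _ _ _ _ _ => ⟨fun _ => map_zero _, fun _ => map_zero _⟩,
    by simp⟩
  add_mem' := by
    rintro _ _ ⟨r, hr, hr', rfl⟩ ⟨s, hs, hs', rfl⟩
    refine ⟨r + s, fun σ e => ?_, fun x y w h h' => ⟨fun h₁ => ?_, fun h₁ => ?_⟩, ?_⟩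
    · rw [Finsupp.add_apply, Finsupp.add_apply, hr σ e, hs σ e]
    · rw [map_add, (hr' x y w h h').1 h₁, (hs' x y w h h').1 h₁, add_zero]
    · rw [map_add, (hr' x y w h h').2 h₁, (hs' x y w h h').2 h₁, add_zero]
    · rw [map_add, add_div, mul_add]
  smul_mem' := by
    rintro c _ ⟨r, hr, hr', rfl⟩
    refine ⟨c • r, fun σ e => ?_, fun x y w h h' => ⟨fun h₁ => ?_, fun h₁ => ?_⟩, ?_⟩
    · rw [Finsupp.smul_apply, Finsupp.smul_apply, hr σ e]
    · rw [map_smul, (hr' x y w h h').1 h₁, smul_zero]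
    · rw [map_smul, (hr' x y w h h').2 h₁, smul_zero]
    · rw [map_smul, smul_div_assoc, mul_smul_comm]

/-! ### Rescaling some of the variables; slope and homogeneous degree -/

open Classical in
/-- The substitution `z_x^{1/2} ↦ η z_x^{1/2}` for `x ∈ B` (and `z_x^{1/2} ↦ z_x^{1/2}` for
`x ∉ B`) on polynomials in the `z_x^{1/2}`, with values in polynomials in a new variable `η`. -/
def scalePoly {n : ℕ} {k : ZMod n → ℕ} (B : Set (Var k)) :
    MvPolynomial (Var k) BaseField →ₐ[BaseField] Polynomial (RatField k) :=
  MvPolynomial.aeval fun x =>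
    if x ∈ B then Polynomial.X * Polynomial.C (sqrtZ x) else Polynomial.C (sqrtZ x)

theorem scalePoly_eval_one {n : ℕ} {k : ZMod n → ℕ} (B : Set (Var k))
    (p : MvPolynomial (Var k) BaseField) :
    Polynomial.eval 1 (scalePoly B p) = algebraMap _ (RatField k) p := by
  induction p using MvPolynomial.induction_on with
  | C a =>
    rw [scalePoly, MvPolynomial.algHom_C, Polynomial.algebraMap_apply, Polynomial.eval_C,
      ← MvPolynomial.algebraMap_eq, ← IsScalarTower.algebraMap_apply]
  | add p p' hp hp' => rw [map_add, Polynomial.eval_add, hp, hp', map_add]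
  | mul_X p x hp =>
    rw [map_mul, Polynomial.eval_mul, hp, map_mul]
    congr 1
    rw [scalePoly, MvPolynomial.aeval_X]
    split_ifs <;> simp [sqrtZ]

/-- The same substitution with values in rational functions in `η`. -/
def scaleRat {n : ℕ} {k : ZMod n → ℕ} (B : Set (Var k)) :
    MvPolynomial (Var k) BaseField →+* RatFunc (RatField k) :=
  (algebraMap (Polynomial (RatField k)) (RatFunc (RatField k))).comp (scalePoly B).toRingHom

theorem scaleRat_injective {n : ℕ} {k : ZMod n → ℕ} (B : Set (Var k)) :
    Function.Injective (scaleRat B) := by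
  refine (IsFractionRing.injective (Polynomial (RatField k)) (RatFunc (RatField k))).comp ?_
  intro p p' h
  have h' : scalePoly B p = scalePoly B p' := h
  apply IsFractionRing.injective (MvPolynomial (Var k) BaseField) (RatField k)
  rw [← scalePoly_eval_one B, ← scalePoly_eval_one B, h']

/-- The substitution `F(z) ↦ F(…, z_x, …, ξ z_y, …)`, where the variables `z_y` with `y ∈ B` are
multiplied by `ξ = η²`; the result is a rational function in `η = ξ^{1/2}`. -/
def scale {n : ℕ} {k : ZMod n → ℕ} (B : Set (Var k)) :
    RatField k →+* RatFunc (RatField k) :=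
  IsFractionRing.lift (scaleRat_injective B)

theorem scale_smul {n : ℕ} {k : ZMod n → ℕ} (B : Set (Var k)) (c : BaseField) (F : RatField k) :
    scale B (c • F) = RatFunc.C (algebraMap BaseField (RatField k) c) * scale B F := by
  rw [Algebra.smul_def, map_mul]
  congr 1
  rw [scale, IsScalarTower.algebraMap_apply BaseField (MvPolynomial (Var k) BaseField) (RatField k),
    IsFractionRing.lift_algebraMap, scaleRat, RingHom.comp_apply,
    ← IsScalarTower.algebraMap_apply]
  have : (scalePoly B).toRingHom (algebraMap BaseField (MvPolynomial (Var k) BaseField) c) =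
      Polynomial.C (algebraMap BaseField (RatField k) c) := by
    rw [AlgHom.toRingHom_eq_coe, RingHom.coe_coe, AlgHom.commutes, Polynomial.algebraMap_apply]
  rw [this, RatFunc.algebraMap_C]

/-- `lim_{η → ∞} G(η) / η^N` exists, i.e. the rational function `G` is zero or its degree in `η`
is at most `N`. -/
def LimitExists {L : Type} [Field L] (G : RatFunc L) (N : ℚ) : Prop :=
  G = 0 ∨ (G.intDegree : ℚ) ≤ N

theorem LimitExists.add {L : Type} [Field L] {G H : RatFunc L} {N : ℚ}
    (hG : LimitExists G N) (hH : LimitExists H N) : LimitExists (G + H) N := by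
  rcases hG with rfl | hG
  · simpa using hH
  rcases hH with rfl | hH
  · exact Or.inr (by simpa using hG)
  by_cases h0 : H = 0
  · exact Or.inr (by simpa [h0] using hG)
  by_cases h : G + H = 0
  · exact Or.inl h
  · refine Or.inr (le_trans (Int.cast_le.mpr (RatFunc.intDegree_add_le h0 h)) ?_)
    rw [Int.cast_max]
    exact max_le hG hH

theorem LimitExists.C_mul {L : Type} [Field L] {G : RatFunc L} {N : ℚ} (c : L)
    (hG : LimitExists G N) : LimitExists (RatFunc.C c * G) N := by
  rcases hG with rfl | hG
  · exact Or.inl (mul_zero _)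
  by_cases hc : c = 0
  · exact Or.inl (by rw [hc, map_zero, zero_mul])
  by_cases h0 : G = 0
  · exact Or.inl (by rw [h0, mul_zero])
  · refine Or.inr ?_
    rw [RatFunc.intDegree_mul (by simpa using hc) h0, RatFunc.intDegree_C, zero_add]
    exact hG

/-- Rational functions of slope `≤ m`: for all `a + b = k`, the limit as `ξ → ∞` of
`F(z_{i1}, …, z_{ia_i}, ξ z_{i,a_i+1}, …, ξ z_{i,a_i+b_i}) / ξ^{m·b - (a,b)/2}` exists. In terms
of `η = ξ^{1/2}`, the exponent is `2 m·b - (a,b)`. -/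
def slopeLE {n : ℕ} [NeZero n] (m : ZMod n → ℚ) (k : ZMod n → ℕ) :
    Submodule BaseField (RatField k) where
  carrier := {F | ∀ a b : ZMod n → ℕ, a + b = k →
    LimitExists (scale {x : Var k | a x.1 ≤ (x.2 : ℕ)} F)
      (2 * (scalarProd m b - killingForm a b / 2))}
  zero_mem' := fun _ _ _ => Or.inl (map_zero _)
  add_mem' := fun hF hG a b h => by
    rw [map_add]
    exact (hF a b h).add (hG a b h)
  smul_mem' := fun c _ hF a b h => by
    rw [scale_smul]
    exact (hF a b h).C_mul _

/-- Rational functions of homogeneous degree `d`: `F(ξ z) = ξ^d F(z)`, with `ξ = η²`. -/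
def homogeneous {n : ℕ} (k : ZMod n → ℕ) (d : ℤ) : Submodule BaseField (RatField k) where
  carrier := {F | scale Set.univ F = RatFunc.X ^ (2 * d) * RatFunc.C F}
  zero_mem' := by simp
  add_mem' := fun {F G} hF hG => by
    simp only [Set.mem_ofPred_eq] at hF hG ⊢
    rw [map_add, hF, hG, map_add, mul_add]
  smul_mem' := fun c F hF => by
    simp only [Set.mem_ofPred_eq] at hF ⊢
    rw [scale_smul, hF, Algebra.smul_def, map_mul, mul_left_comm]

/-- The bigraded slope piece `S⁺_{≤ m | k, d}`. -/
def slopePiece {n : ℕ} [NeZero n] (m : ZMod n → ℚ) (k : ZMod n → ℕ) (d : ℤ) :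
    Submodule BaseField (RatField k) :=
  shuffle k ⊓ slopeLE m k ⊓ homogeneous k d

/-- The piece `B⁺_{m | k}` of the slope subalgebra: it is `S⁺_{≤ m | k, d}` for `d = m · k` if
`m · k` is an integer, and zero otherwise. -/
def slopeSubalgebraPiece {n : ℕ} [NeZero n] (m : ZMod n → ℚ) (k : ZMod n → ℕ) :
    Submodule BaseField (RatField k) :=
  ⨆ (d : ℤ) (_ : (d : ℚ) = scalarProd m k), slopePiece m k d

/-! ### Arcs and partitions into arcs -/

/-- An arc `[i; j)` in the cyclic quiver, `i < j` integers taken modulo simultaneous shifts by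
`(n, n)`: it amounts to the residue of `i` modulo `n` and the length `j - i ≥ 1`. -/
structure Arc (n : ℕ) where
  /-- the residue of `i` -/
  start : ZMod n
  /-- the length `j - i` -/
  length : ℕ+

/-- The degree vector `[i; j) = ς^i + ⋯ + ς^{j-1}` of an arc. -/
def Arc.degree {n : ℕ} (A : Arc n) : ZMod n → ℕ :=
  ∑ s ∈ Finset.range A.length, Pi.single (A.start + (s : ZMod n)) 1

/-- The `ℤ`-indexed partitions `(ρ, δ) ⊢ (k, d)` of slope `≤ m`: unordered collections of
pairs `([i_s; j_s), d_s)` adding up to `(k, d)` such that `d_s ≤ m · [i_s; j_s)` for all `s`. -/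
def indexedPartitions {n : ℕ} [NeZero n] (m : ZMod n → ℚ) (k : ZMod n → ℕ) (d : ℤ) :
    Set (Multiset (Arc n × ℤ)) :=
  {P | (P.map fun p => p.1.degree).sum = k ∧ (P.map fun p => p.2).sum = d ∧
    ∀ p ∈ P, (p.2 : ℚ) ≤ scalarProd m p.1.degree}

/-- The `m`-integral partitions of `k`: unordered collections of arcs adding up to `k`, each of
which satisfies `m · [i; j) ∈ ℤ`. -/
def integralPartitions {n : ℕ} [NeZero n] (m : ZMod n → ℚ) (k : ZMod n → ℕ) :
    Set (Multiset (Arc n)) :=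
  {P | (P.map fun A => A.degree).sum = k ∧
    ∀ A ∈ P, ∃ c : ℤ, (c : ℚ) = scalarProd m A.degree}

end CyclicShuffle

end

/-! Clearing denominators turns an element of the slope piece into a polynomial R in the z_x
(`polyPiece`): symmetric in each color, subject to the wheel conditions, with exponents controlled
by the slope m and the degree d. For a partition ρ of k into arcs, `specialize` puts the a-th point
of the arc s at τ^a y_s with τ = tq, so that two consecutive points of an arc are in the ratio of
two adjacent entries of a wheel. The partition into arcs of length one imposes no constraint, so R =
0 once all its specializations vanish. Partitions are ordered by the sum of the squares of the
lengths; by `finite_and_finrank_le_of_filtration` it suffices to bound, for each ρ, the image under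
specialization of those R that are killed by every partition of larger weight.

Such an image is divisible by a fixed polynomial, `divisor`. Let s, s' be two arcs, s at least as
long as s'. Each pair of points of adjacent colors, one on s and one on s', yields a linear factor.
If the point of s has a neighbor on s of the color of the point of s' on the relevant side, the
three points can be made into a wheel (`linForm_dvd_partialSpecialize`). Otherwise the point of s'
is placed just beyond an end of s; the points of both arcs then regroup into a longer arc and a
shorter (possibly empty) one, a partition of larger weight, where R vanishes
(`linForm_endPair_dvd_specialize`).

The degree of the divisor in y_s counts the adjacent pairs between s and the other arcs. Subtracted
from the slope bound, it leaves, after the translation `offset`, exactly d_s ≤ m·[i_s; j_s) for the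
exponents of the quotient, and homogeneity gives ∑ d_s = d (`exponentPartition_mem`). Symmetry under
permutations of equal arcs leaves at most one independent coefficient for each multiset of pairs
(arc, integer), so the image at ρ has dimension at most the number of indexed partitions lying over
ρ (`finrank_map_specialize_le`). Summing over ρ gives the first bound. When d = m·k the inequalities
must all be equalities, so the integers are determined by the arcs, which are m-integral
(`ncard_indexedPartitions_le`). -/

open Finset

namespace CyclicShuffle

/-! ### General facts -/

/-- Fibres over each value have the same cardinality, and bijections between them are glued. This
converts equalities of multisets of colored points into permutations of variables. -/
theorem exists_equiv_of_map_univ_eq {α α' β : Type*} [Fintype α] [Fintype α'] {f : α → β}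
    {g : α' → β} (h : (univ : Finset α).val.map f = (univ : Finset α').val.map g) :
    ∃ e : α ≃ α', ∀ x, g (e x) = f x := by
  classical
  have hc : ∀ b, Nonempty ({x // f x = b} ≃ {x // g x = b}) := fun b => by
    refine Fintype.card_eq.mp ?_
    have := congrArg (Multiset.count b) h
    rw [Multiset.count_map, Multiset.count_map] at this
    simp only [Fintype.card_subtype, Finset.card_def, Finset.filter_val]
    simpa only [eq_comm] using this
  have ψ : ∀ b, {x // f x = b} ≃ {x // g x = b} := fun b => (hc b).some
  refine ⟨(Equiv.sigmaFiberEquiv f).symm.trans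
    ((Equiv.sigmaCongrRight ψ).trans (Equiv.sigmaFiberEquiv g)), fun x => ?_⟩
  exact (ψ (f x) ⟨x, rfl⟩).2

theorem map_univ_comp_equiv {α α' β : Type*} [Fintype α] [Fintype α'] (e : α ≃ α')
    (g : α' → β) :
    (univ : Finset α).val.map (fun x => g (e x)) = (univ : Finset α').val.map g := by
  rw [show (fun x => g (e x)) = g ∘ e from rfl, ← Multiset.map_map]
  congr 1
  simp

/-! ### Dimension count along a filtration by kernels. -/

section Filtration

variable {K V : Type*} [Field K] [AddCommGroup V] [Module K V]

/-- Induction on the set S of indices whose maps may be nonzero on U. An index p of maximal weight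
in S can be split off: every index of larger weight lies outside S, so `hf` bounds the image of U
under `f p`, and the kernel is handled with p removed. -/
theorem finite_and_finrank_le_of_filtration {P : Type*} {W : P → Type*}
    [∀ p, AddCommGroup (W p)] [∀ p, Module K (W p)] (T : Finset P) (w : P → ℕ)
    (f : ∀ p, V →ₗ[K] W p) (c : P → ℕ)
    (hinj : ∀ v, (∀ p ∈ T, f p v = 0) → v = 0)
    (hf : ∀ p ∈ T, ∀ U : Submodule K V, (∀ v ∈ U, ∀ p' ∈ T, w p < w p' → f p' v = 0) →
      Module.Finite K (U.map (f p)) ∧ Module.finrank K (U.map (f p)) ≤ c p) :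
    Module.Finite K V ∧ Module.finrank K V ≤ ∑ p ∈ T, c p := by
  classical
  have key : ∀ S : Finset P, S ⊆ T → ∀ U : Submodule K V,
      (∀ v ∈ U, ∀ p ∈ T \ S, f p v = 0) →
      Module.Finite K U ∧ Module.finrank K U ≤ ∑ p ∈ S, c p := by
    intro S
    induction S using Finset.strongInduction with
    | H S ih =>
    intro hST U hU
    rcases S.eq_empty_or_nonempty with rfl | hne
    · have : U = ⊥ := by
        rw [eq_bot_iff]
        intro v hv
        exact hinj v fun p hp => hU v hv p (by simpa using hp)
      subst this
      exact ⟨inferInstance, by simp⟩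
    · obtain ⟨p, hp, hmax⟩ := S.exists_max_image w hne
      obtain ⟨h1, h2⟩ := hf p (hST hp) U fun v hv p' hp' hlt => hU v hv p' (by
        simp only [Finset.mem_sdiff]
        exact ⟨hp', fun h => absurd (hmax p' h) (not_le.mpr hlt)⟩)
      obtain ⟨h3, h4⟩ := ih (S.erase p) (Finset.erase_ssubset hp)
        ((Finset.erase_subset _ _).trans hST) (U ⊓ LinearMap.ker (f p)) (by
          intro v hv p' hp'
          by_cases h : p' = p
          · subst h
            exact hv.2
          · exact hU v hv.1 p' (by
              simp only [Finset.mem_sdiff, Finset.mem_erase] at hp' ⊢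
              exact ⟨hp'.1, fun h' => hp'.2 ⟨h, h'⟩⟩))
      set g : U →ₗ[K] W p := (f p).domRestrict U with hg
      have hr : LinearMap.range g = U.map (f p) := by
        rw [hg, LinearMap.range_domRestrict]
      have hk : (LinearMap.ker g).map U.subtype = U ⊓ LinearMap.ker (f p) := by
        ext v
        simp only [Submodule.mem_map, LinearMap.mem_ker, Submodule.mem_inf]
        constructor
        · rintro ⟨u, hu, rfl⟩
          exact ⟨u.2, hu⟩
        · rintro ⟨hv, hv'⟩
          exact ⟨⟨v, hv⟩, hv', rfl⟩
      have e := Submodule.equivMapOfInjective U.subtype U.subtype_injective (LinearMap.ker g)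
      rw [hk] at e
      have hkf : Module.Finite K (LinearMap.ker g) := Module.Finite.equiv e.symm
      rw [← hr] at h1 h2
      have hUf : Module.Finite K U := by
        have : IsNoetherian K (LinearMap.ker g) := inferInstance
        have : IsNoetherian K (LinearMap.range g) := inferInstance
        have := isNoetherian_of_range_eq_ker (LinearMap.ker g).subtype g.rangeRestrict
          (by rw [Submodule.range_subtype, LinearMap.ker_rangeRestrict])
        infer_instance
      refine ⟨hUf, ?_⟩
      rw [← LinearMap.finrank_range_add_finrank_ker g, e.finrank_eq,
        ← Finset.add_sum_erase S c hp]
      exact add_le_add h2 h4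
  obtain ⟨h1, h2⟩ := key T subset_rfl ⊤ (by simp)
  exact ⟨Module.Finite.equiv Submodule.topEquiv, by rwa [finrank_top] at h2⟩

end Filtration

/-! ### Linear forms in two variables: divisibility, coprimality, degrees. -/

section Polynomials

open MvPolynomial

variable {σ K : Type*} [Field K]

/-- The linear form `X_j - c X_i`. -/
noncomputable def linForm (i j : σ) (c : K) : MvPolynomial σ K := X j - C c * X i

theorem linForm_ne_zero {i j : σ} (h : i ≠ j) (c : K) : linForm i j c ≠ 0 := by
  classical
  intro h0
  have := congrArg (eval (fun x => if x = j then (1 : K) else 0)) h0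
  simp [linForm, h] at this

theorem linForm_isHomogeneous (i j : σ) (c : K) : (linForm i j c).IsHomogeneous 1 :=
  (isHomogeneous_X K j).sub (isHomogeneous_C_mul_X c i)

/-- Modulo the ideal generated by X_j - c X_i, the substitution X_j ↦ c X_i is the identity. -/
theorem linForm_dvd [DecidableEq σ] {i j : σ} (h : i ≠ j) {c : K} {f : MvPolynomial σ K}
    (hf : aeval (Function.update X j (C c * X i) : σ → MvPolynomial σ K) f = 0) :
    linForm i j c ∣ f := by
  rw [← Ideal.mem_span_singleton, ← Ideal.Quotient.eq_zero_iff_mem]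
  set I := Ideal.span {linForm i j c}
  have : (Ideal.Quotient.mkₐ K I).comp
      (aeval (Function.update X j (C c * X i) : σ → MvPolynomial σ K)) =
        Ideal.Quotient.mkₐ K I := by
    refine MvPolynomial.algHom_ext fun x => ?_
    rw [AlgHom.comp_apply, aeval_X]
    by_cases hx : x = j
    · subst hx
      rw [Function.update_self]
      symm
      exact Ideal.Quotient.eq.mpr (Ideal.mem_span_singleton_self _)
    · rw [Function.update_of_ne hx]
  have h2 := congrArg (fun g => g f) this
  simp only [AlgHom.comp_apply, hf, map_zero] at h2
  exact h2.symm

theorem linForm_irreducible {i j : σ} (h : i ≠ j) (c : K) : Irreducible (linForm i j c) := by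
  classical
  refine irreducible_of_totalDegree_eq_one
    ((linForm_isHomogeneous i j c).totalDegree (linForm_ne_zero h c)) fun x hx => ?_
  have := hx (Finsupp.single j 1)
  have h1 : coeff (Finsupp.single j 1) (linForm i j c) = 1 := by
    rw [linForm, coeff_sub, coeff_C_mul, coeff_X, coeff_X]
    have : Finsupp.single i 1 ≠ Finsupp.single j 1 := fun h' =>
      h (Finsupp.single_left_injective one_ne_zero h')
    simp [this]
  rw [h1] at this
  exact isUnit_of_dvd_one this

theorem linForm_isRelPrime_of_ne {i j : σ} (h : i ≠ j) {c c' : K} (hc : c ≠ c') :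
    IsRelPrime (linForm i j c) (linForm i j c') := by
  classical
  rw [(linForm_irreducible h c).isRelPrime_iff_not_dvd]
  rintro ⟨g, hg⟩
  have := congrArg (eval (fun x => if x = j then c else 1)) hg
  simp [linForm, h, sub_eq_zero] at this
  exact hc this

/-- Some index of the second pair lies outside the first; its indicator function is a zero of the
first form but not of the second. -/
theorem linForm_isRelPrime_of_pair_ne {i j i' j' : σ} (h : i ≠ j) (h' : i' ≠ j')
    (hp : ¬ (i' = i ∧ j' = j)) (hq : ¬ (i' = j ∧ j' = i)) (c : K) {c' : K} (hc' : c' ≠ 0) :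
    IsRelPrime (linForm i j c) (linForm i' j' c') := by
  classical
  rw [(linForm_irreducible h c).isRelPrime_iff_not_dvd]
  rintro ⟨g, hg⟩
  by_cases hj : j' = i ∨ j' = j
  · have hi : i' ≠ i ∧ i' ≠ j := by grind
    have := congrArg (eval (fun x => if x = i' then 1 else 0)) hg
    simp [linForm, h'.symm, hi.1.symm, hi.2.symm, hc'] at this
  · push Not at hj
    have := congrArg (eval (fun x => if x = j' then 1 else 0)) hg
    simp [linForm, h', hj.1.symm, hj.2.symm] at this

theorem associated_linForm_swap (i j : σ) {c : K} (hc : c ≠ 0) :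
    Associated (linForm i j c) (linForm j i c⁻¹) := by
  have : IsUnit (C (-c⁻¹) : MvPolynomial σ K) :=
    (isUnit_iff_ne_zero.mpr (neg_ne_zero.mpr (inv_ne_zero hc))).map C
  obtain ⟨u, hu⟩ := this
  refine ⟨u, ?_⟩
  rw [hu, linForm, linForm, sub_mul]
  have h1 : (C c : MvPolynomial σ K) * C c⁻¹ = 1 := by
    rw [← C_mul, mul_inv_cancel₀ hc, C_1]
  rw [C_neg]
  linear_combination (X i) * h1

theorem rename_linForm {τ : Type*} (g : σ → τ) (i j : σ) (c : K) :
    rename g (linForm i j c) = linForm (g i) (g j) c := by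
  simp [linForm]

theorem aeval_linForm {A : Type*} [CommRing A] [Algebra K A] (v : σ → A) (i j : σ) (c : K) :
    aeval v (linForm i j c) = v j - algebraMap K A c * v i := by
  simp [linForm]

theorem degreeOf_linForm [DecidableEq σ] {i j : σ} (h : i ≠ j) {c : K} (hc : c ≠ 0) (s : σ) :
    degreeOf s (linForm i j c) = if s = i ∨ s = j then 1 else 0 := by
  have hs : (linForm i j c).support = {Finsupp.single i 1, Finsupp.single j 1} := by
    have hne : Finsupp.single i 1 ≠ Finsupp.single j 1 := fun h' =>
      h (Finsupp.single_left_injective one_ne_zero h')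
    ext e
    rw [mem_support_iff, linForm, coeff_sub, coeff_C_mul, coeff_X, coeff_X]
    simp only [Finset.mem_insert, Finset.mem_singleton]
    by_cases h1 : e = Finsupp.single i 1
    · subst h1
      simp [hne, hne.symm, hc]
    · by_cases h2 : e = Finsupp.single j 1
      · subst h2
        simp [hne, hne.symm]
      · simp [h1, h2, Ne.symm h1, Ne.symm h2]
  rw [degreeOf_eq_sup, hs, Finset.sup_insert, Finset.sup_singleton, Finsupp.single_apply,
    Finsupp.single_apply]
  by_cases h1 : s = i <;> by_cases h2 : s = j <;>
    simp [h1, h2, h, h.symm, eq_comm]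
  all_goals grind

/-- If the degree were wrong, the component of r p in degree N + deg e would vanish; it equals r
times the component of p in degree deg e, which contains the monomial e, and there are no zero
divisors. -/
theorem IsHomogeneous.of_mul_left {p r : MvPolynomial σ K} {N D : ℕ} (hr : r.IsHomogeneous N)
    (hr0 : r ≠ 0) (h : (r * p).IsHomogeneous D) {e : σ →₀ ℕ} (he : e ∈ p.support) :
    e.degree + N = D := by
  by_contra hne
  have hsum : r * p = ∑ i ∈ range (p.totalDegree + 1), r * homogeneousComponent i p := by
    rw [← Finset.mul_sum, sum_homogeneousComponent]
  have h1 := congrArg (homogeneousComponent (N + e.degree)) hsum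
  rw [homogeneousComponent_of_mem h, if_neg (by omega), map_sum] at h1
  have h2 : ∀ i ∈ range (p.totalDegree + 1),
      homogeneousComponent (N + e.degree) (r * homogeneousComponent i p) =
        if i = e.degree then r * homogeneousComponent i p else 0 := fun i _ => by
    rw [homogeneousComponent_of_mem (hr.mul (homogeneousComponent_isHomogeneous i p))]
    simp [eq_comm]
  rw [Finset.sum_congr rfl h2, Finset.sum_ite_eq' (range (p.totalDegree + 1))] at h1
  have h3 : homogeneousComponent e.degree p = 0 := by
    split_ifs at h1 with h4
    · exact (mul_eq_zero.mp h1.symm).resolve_left hr0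
    · exact homogeneousComponent_eq_zero _ _ (by simpa [Nat.lt_succ_iff] using h4)
  have h4 := congrArg (coeff e) h3
  rw [coeff_homogeneousComponent, if_pos rfl, coeff_zero] at h4
  exact mem_support_iff.mp he h4

end Polynomials

/-! ### The parameters -/

theorem q_ne_zero : q ≠ 0 := by
  rw [q, Ne, FaithfulSMul.algebraMap_eq_zero_iff]
  exact MvPolynomial.X_ne_zero 0

theorem t_ne_zero : t ≠ 0 := by
  rw [t, Ne, FaithfulSMul.algebraMap_eq_zero_iff]
  exact MvPolynomial.X_ne_zero 1

theorem pow_mul_pow_injective {a b a' b' : ℕ} (h : q ^ a * t ^ b = q ^ a' * t ^ b') :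
    a = a' ∧ b = b' := by
  have h2 : (MvPolynomial.X 0 ^ a * MvPolynomial.X 1 ^ b : MvPolynomial (Fin 2) ℚ) =
      MvPolynomial.X 0 ^ a' * MvPolynomial.X 1 ^ b' := by
    apply IsFractionRing.injective (MvPolynomial (Fin 2) ℚ) BaseField
    simpa [q, t] using h
  rw [MvPolynomial.X_pow_eq_monomial, MvPolynomial.X_pow_eq_monomial,
    MvPolynomial.X_pow_eq_monomial, MvPolynomial.X_pow_eq_monomial, MvPolynomial.monomial_mul,
    MvPolynomial.monomial_mul, one_mul] at h2
  have h3 := MvPolynomial.monomial_left_injective (one_ne_zero) h2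
  have h4 := DFunLike.congr_fun h3 0
  have h5 := DFunLike.congr_fun h3 1
  simp at h4 h5
  exact ⟨h4, h5⟩

theorem zpow_mul_zpow_injective {a b a' b' : ℤ} (h : q ^ a * t ^ b = q ^ a' * t ^ b') :
    a = a' ∧ b = b' := by
  obtain ⟨N, hN⟩ : ∃ N : ℕ, (0 ≤ a + N ∧ 0 ≤ b + N) ∧ 0 ≤ a' + N ∧ 0 ≤ b' + N :=
    ⟨(|a| + |b| + |a'| + |b'|).toNat, by
      have := abs_nonneg a; have := abs_nonneg b; have := abs_nonneg a'; have := abs_nonneg b'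
      have := neg_abs_le a; have := neg_abs_le b; have := neg_abs_le a'; have := neg_abs_le b'
      omega⟩
  have h2 : q ^ (a + N) * t ^ (b + N) = q ^ (a' + N) * t ^ (b' + N) := by
    rw [zpow_add₀ q_ne_zero, zpow_add₀ q_ne_zero, zpow_add₀ t_ne_zero, zpow_add₀ t_ne_zero]
    linear_combination (q ^ (N : ℤ) * t ^ (N : ℤ)) * h
  lift a + N to ℕ using hN.1.1 with x hx
  lift b + N to ℕ using hN.1.2 with y hy
  lift a' + N to ℕ using hN.2.1 with x' hx'
  lift b' + N to ℕ using hN.2.2 with y' hy'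
  simp only [zpow_natCast] at h2
  obtain ⟨h3, h4⟩ := pow_mul_pow_injective h2
  omega

/-- The ratio of two consecutive points of an arc. -/
noncomputable def τ : BaseField := t * q

theorem τ_ne_zero : τ ≠ 0 := mul_ne_zero t_ne_zero q_ne_zero

/-- Multiplicative independence of q and τ, which keeps apart the zeros attached to different pairs
of points. -/
theorem q_zpow_mul_τ_zpow_injective {a b a' b' : ℤ} (h : q ^ a * τ ^ b = q ^ a' * τ ^ b') :
    a = a' ∧ b = b' := by
  have h2 : q ^ (a + b) * t ^ b = q ^ (a' + b') * t ^ b' := by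
    rw [zpow_add₀ q_ne_zero, zpow_add₀ q_ne_zero]
    rw [τ, mul_zpow, mul_zpow] at h
    linear_combination h
  obtain ⟨h3, h4⟩ := zpow_mul_zpow_injective h2
  omega

/-! ### Degrees of Laurent polynomials under scaling -/

section Scaling

variable {n : ℕ} {k : ZMod n → ℕ}

theorem sqrtZ_ne_zero (x : Var k) : sqrtZ x ≠ 0 := by
  rw [sqrtZ, Ne, FaithfulSMul.algebraMap_eq_zero_iff]
  exact MvPolynomial.X_ne_zero x

theorem z_ne_zero (x : Var k) : z x ≠ 0 := pow_ne_zero 2 (sqrtZ_ne_zero x)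

theorem scale_algebraMap (B : Set (Var k)) (p : MvPolynomial (Var k) BaseField) :
    scale B (algebraMap _ (RatField k) p) = algebraMap _ (RatFunc (RatField k)) (scalePoly B p) := by
  rw [scale, IsFractionRing.lift_algebraMap]
  rfl

open Classical in
theorem scale_sqrtZ (B : Set (Var k)) (x : Var k) :
    scale B (sqrtZ x) = if x ∈ B then RatFunc.X * RatFunc.C (sqrtZ x) else RatFunc.C (sqrtZ x) := by
  rw [sqrtZ, scale_algebraMap, scalePoly, MvPolynomial.aeval_X]
  split_ifs
  · rw [map_mul, RatFunc.algebraMap_X, RatFunc.algebraMap_C, sqrtZ]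
  · rw [RatFunc.algebraMap_C, sqrtZ]

open Classical in
theorem scale_z (B : Set (Var k)) (x : Var k) :
    scale B (z x) = if x ∈ B then RatFunc.X ^ 2 * RatFunc.C (z x) else RatFunc.C (z x) := by
  rw [z, map_pow, scale_sqrtZ]
  split_ifs
  · rw [mul_pow, map_pow]
  · rw [map_pow]

theorem scale_algebraMap_base (B : Set (Var k)) (c : BaseField) :
    scale B (algebraMap BaseField (RatField k) c) =
      RatFunc.C (algebraMap BaseField (RatField k) c) := by
  have := scale_smul B c 1
  rwa [Algebra.smul_def, mul_one, map_one, mul_one] at this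

theorem aeval_z (p : MvPolynomial (Var k) BaseField) :
    MvPolynomial.aeval z p = algebraMap _ (RatField k) (MvPolynomial.expand 2 p) := by
  induction p using MvPolynomial.induction_on with
  | C a => simp [IsScalarTower.algebraMap_apply BaseField (MvPolynomial (Var k) BaseField)
      (RatField k) a]
  | add p p' hp hp' => rw [map_add, map_add, map_add, hp, hp']
  | mul_X p x hp => simp [hp, z, sqrtZ]

theorem aeval_z_injective :
    Function.Injective (MvPolynomial.aeval z : MvPolynomial (Var k) BaseField →ₐ[BaseField] _) := by
  intro p p' h
  rw [aeval_z, aeval_z] at h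
  exact MvPolynomial.expand_injective two_pos (IsFractionRing.injective _ (RatField k) h)

/-- The substitution `z_x ↦ η² z_x` for `x ∈ B` on polynomials in the `z_x`. -/
noncomputable def scaleZPoly (B : Finset (Var k)) :
    MvPolynomial (Var k) BaseField →ₐ[BaseField] Polynomial (RatField k) :=
  MvPolynomial.aeval fun x =>
    if x ∈ B then Polynomial.X ^ 2 * Polynomial.C (z x) else Polynomial.C (z x)

theorem scale_aeval_z (B : Finset (Var k))
    (p : MvPolynomial (Var k) BaseField) :
    scale (B : Set (Var k)) (MvPolynomial.aeval z p) =
      algebraMap _ (RatFunc (RatField k)) (scaleZPoly B p) := by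
  induction p using MvPolynomial.induction_on with
  | C a =>
    rw [MvPolynomial.algHom_C, MvPolynomial.algHom_C, scale_algebraMap_base,
      Polynomial.algebraMap_apply, RatFunc.algebraMap_C]
  | add p p' hp hp' => simp only [map_add, hp, hp']
  | mul_X p x hp =>
    rw [map_mul, map_mul, map_mul, map_mul, hp, MvPolynomial.aeval_X, scale_z, scaleZPoly,
      MvPolynomial.aeval_X]
    congr 1
    simp only [Finset.mem_coe]
    split_ifs
    · rw [map_mul, map_pow, RatFunc.algebraMap_X, RatFunc.algebraMap_C]
    · rw [RatFunc.algebraMap_C]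

variable [NeZero n]

theorem scaleZPoly_monomial (B : Finset (Var k)) (e : Var k →₀ ℕ)
    (c : BaseField) :
    scaleZPoly B (MvPolynomial.monomial e c) =
      Polynomial.monomial (2 * ∑ x ∈ B, e x) (MvPolynomial.aeval z (MvPolynomial.monomial e c)) := by
  rw [scaleZPoly, MvPolynomial.aeval_monomial, MvPolynomial.aeval_monomial,
    Finsupp.prod_fintype _ _ (by simp), Finsupp.prod_fintype _ _ (by simp),
    ← Polynomial.C_mul_X_pow_eq_monomial, Polynomial.C_mul, map_prod, Finset.mul_sum,
    ← Finset.prod_pow_eq_pow_sum, Polynomial.algebraMap_apply, mul_assoc]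
  congr 1
  rw [← Finset.prod_ite_mem_eq B, ← Finset.prod_mul_distrib]
  refine Finset.prod_congr rfl fun x _ => ?_
  split_ifs
  · rw [mul_pow, ← pow_mul, map_pow, mul_comm]
  · rw [map_pow, mul_one]

/-- The power of η records the degree in the variables of B, while the z_x stay independent; hence
monomials of p cannot cancel under the scaling. -/
theorem coeff_scaleZPoly (B : Finset (Var k)) (p : MvPolynomial (Var k) BaseField) (j : ℕ) :
    (scaleZPoly B p).coeff (2 * j) = MvPolynomial.aeval z
      (MvPolynomial.weightedHomogeneousComponent (fun x => if x ∈ B then 1 else 0) j p) := by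
  induction p using MvPolynomial.induction_on' with
  | monomial e c =>
    rw [scaleZPoly_monomial, Polynomial.coeff_monomial]
    have hw : Finsupp.weight (fun x => if x ∈ B then 1 else 0) e = ∑ x ∈ B, e x := by
      rw [Finsupp.weight_apply, Finsupp.sum_fintype _ _ (by simp)]
      simp
    have hm : MvPolynomial.IsWeightedHomogeneous (fun x => if x ∈ B then 1 else 0)
        (MvPolynomial.monomial e c) (∑ x ∈ B, e x) :=
      MvPolynomial.isWeightedHomogeneous_monomial _ _ _ hw
    by_cases h : ∑ x ∈ B, e x = j
    · rw [if_pos (by rw [h]), ← h, hm.weightedHomogeneousComponent_same]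
    · rw [if_neg (by omega), hm.weightedHomogeneousComponent_ne _ (Ne.symm h), map_zero]
  | add p p' hp hp' => rw [map_add, Polynomial.coeff_add, hp, hp', map_add, map_add]

theorem coeff_scaleZPoly_ne_zero (B : Finset (Var k)) {p : MvPolynomial (Var k) BaseField}
    {e : Var k →₀ ℕ} (he : p.coeff e ≠ 0) :
    (scaleZPoly B p).coeff (2 * ∑ x ∈ B, e x) ≠ 0 := by
  rw [coeff_scaleZPoly]
  intro h
  have h2 := aeval_z_injective (h.trans (map_zero _).symm)
  have h3 := congrArg (MvPolynomial.coeff e) h2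
  rw [MvPolynomial.coeff_weightedHomogeneousComponent, if_pos, MvPolynomial.coeff_zero] at h3
  · exact he h3
  · rw [Finsupp.weight_apply, Finsupp.sum_fintype _ _ (by simp)]
    simp

/-- The polynomial `(∏ x, z_x) ^ N * r`, for a Laurent polynomial `r` with exponents `≥ -N`. -/
noncomputable def shiftPoly (N : ℕ) : Laurent k →ₗ[BaseField] MvPolynomial (Var k) BaseField :=
  Finsupp.linearCombination BaseField fun e : Var k → ℤ =>
    MvPolynomial.monomial (Finsupp.equivFunOnFinite.symm fun x => (e x + N).toNat) 1

theorem aeval_shiftPoly {N : ℕ} {r : Laurent k} (hr : ∀ e ∈ r.support, ∀ x, 0 ≤ e x + N)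
    {L : Type} [Field L] [Algebra BaseField L] {v : Var k → L} (hv : ∀ x, v x ≠ 0) :
    MvPolynomial.aeval v (shiftPoly N r) =
      (Finsupp.linearCombination BaseField (fun e : Var k → ℤ => ∏ x, v x ^ e x) r) *
        (∏ x, v x) ^ N := by
  rw [shiftPoly, Finsupp.linearCombination_apply, Finsupp.linearCombination_apply, Finsupp.sum,
    Finsupp.sum, map_sum, Finset.sum_mul]
  refine Finset.sum_congr rfl fun e he => ?_
  rw [map_smul, MvPolynomial.aeval_monomial, map_one, one_mul, smul_mul_assoc,
    Finsupp.prod_fintype _ _ (by simp), ← Finset.prod_pow, ← Finset.prod_mul_distrib]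
  congr 1
  refine Finset.prod_congr rfl fun x _ => ?_
  rw [Finsupp.equivFunOnFinite_symm_apply_apply, ← zpow_natCast, Int.toNat_of_nonneg (hr e he x),
    zpow_add₀ (hv x), zpow_natCast]

theorem coeff_shiftPoly {N : ℕ} {r : Laurent k} (hr : ∀ e ∈ r.support, ∀ x, 0 ≤ e x + N)
    (e' : Var k →₀ ℕ) : (shiftPoly N r).coeff e' = r fun x => (e' x : ℤ) - N := by
  rw [shiftPoly, Finsupp.linearCombination_apply, Finsupp.sum, MvPolynomial.coeff_sum]
  simp only [MvPolynomial.coeff_smul, MvPolynomial.coeff_monomial, smul_eq_mul, mul_ite, mul_one,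
    mul_zero]
  have : ∀ e ∈ r.support,
      ((Finsupp.equivFunOnFinite.symm fun x => (e x + N).toNat) = e' ↔
        e = fun x => (e' x : ℤ) - N) := by
    intro e he
    rw [Equiv.symm_apply_eq]
    constructor
    · intro h
      funext x
      have := congrFun h x
      have h2 := hr e he x
      simp only [Finsupp.equivFunOnFinite_apply] at this
      omega
    · rintro rfl
      funext x
      simp
  rw [Finset.sum_congr rfl fun e he => if_congr (this e he) rfl rfl, Finset.sum_ite_eq']
  split_ifs with h
  · rfl
  · exact (Finsupp.notMem_support_iff.mp h).symm

theorem exists_forall_nonneg_add (r : Laurent k) :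
    ∃ N : ℕ, ∀ e ∈ r.support, ∀ x, 0 ≤ e x + N := by
  refine ⟨∑ e ∈ r.support, ∑ x, (e x).natAbs, fun e he x => ?_⟩
  have h1 : (e x).natAbs ≤ ∑ x, (e x).natAbs :=
    Finset.single_le_sum (f := fun x => (e x).natAbs) (fun _ _ => Nat.zero_le _)
      (Finset.mem_univ x)
  have h2 : ∑ x, (e x).natAbs ≤ ∑ e ∈ r.support, ∑ x, (e x).natAbs :=
    Finset.single_le_sum (f := fun e : Var k → ℤ => ∑ x, (e x).natAbs)
      (fun _ _ => Nat.zero_le _) he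
  omega

theorem scale_prod_z_pow (B : Finset (Var k)) (N : ℕ) :
    scale (B : Set (Var k)) ((∏ x, z x) ^ N) =
      RatFunc.X ^ (2 * (N * #B)) * RatFunc.C ((∏ x, z x) ^ N) := by
  rw [map_pow, map_prod]
  simp only [scale_z, Finset.mem_coe]
  have : ∀ x : Var k, (if x ∈ B then (RatFunc.X : RatFunc (RatField k)) ^ 2 * RatFunc.C (z x)
      else RatFunc.C (z x)) = (if x ∈ B then RatFunc.X ^ 2 else 1) * RatFunc.C (z x) := by
    intro x
    split_ifs <;> simp
  simp only [this]
  rw [Finset.prod_mul_distrib, Finset.prod_ite_mem_eq, Finset.prod_const, mul_pow, ← map_prod,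
    ← map_pow]
  ring

theorem exists_scale_evalAt (B : Finset (Var k)) {r : Laurent k} {N : ℕ}
    (hr : ∀ e ∈ r.support, ∀ x, 0 ≤ e x + N) :
    scale (B : Set (Var k)) (evalAt z r) *
      (RatFunc.X ^ (2 * (N * #B)) * RatFunc.C ((∏ x, z x) ^ N)) =
        algebraMap _ (RatFunc (RatField k)) (scaleZPoly B (shiftPoly N r)) := by
  rw [← scale_prod_z_pow, ← scale_aeval_z, aeval_shiftPoly hr z_ne_zero, map_mul]
  rfl

theorem coeff_scaleZPoly_shiftPoly_ne_zero (B : Finset (Var k)) {r : Laurent k} {N : ℕ}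
    (hr : ∀ e ∈ r.support, ∀ x, 0 ≤ e x + N) {e : Var k → ℤ} (he : r e ≠ 0) :
    ∃ j : ℕ, (j : ℤ) = 2 * (∑ x ∈ B, e x + N * #B) ∧
      (scaleZPoly B (shiftPoly N r)).coeff j ≠ 0 := by
  set e' : Var k →₀ ℕ := Finsupp.equivFunOnFinite.symm fun x => (e x + N).toNat
  have he' : ∀ x, (e' x : ℤ) = e x + N := fun x =>
    Int.toNat_of_nonneg (hr e (Finsupp.mem_support_iff.mpr he) x)
  refine ⟨2 * ∑ x ∈ B, e' x, ?_, coeff_scaleZPoly_ne_zero B ?_⟩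
  · push_cast
    simp only [he', Finset.sum_add_distrib, Finset.sum_const, nsmul_eq_mul]
    ring
  · rw [coeff_shiftPoly hr]
    convert he using 2
    funext x
    rw [he']
    ring

/-- In the absence of cancellation, every monomial of r bounds the degree from below. -/
theorem le_intDegree_scale_evalAt (B : Finset (Var k)) {r : Laurent k} {e : Var k → ℤ}
    (he : r e ≠ 0) :
    2 * ∑ x ∈ B, e x ≤ (scale (B : Set (Var k)) (evalAt z r)).intDegree := by
  obtain ⟨N, hr⟩ := exists_forall_nonneg_add r
  have h1 := exists_scale_evalAt B hr
  obtain ⟨j, hj, hj'⟩ := coeff_scaleZPoly_shiftPoly_ne_zero B hr he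
  have h2 := Polynomial.le_natDegree_of_ne_zero hj'
  have h0 : scaleZPoly B (shiftPoly N r) ≠ 0 := fun h => hj' (by rw [h, Polynomial.coeff_zero])
  have hP : (∏ x : Var k, z x) ^ N ≠ 0 :=
    pow_ne_zero _ (Finset.prod_ne_zero_iff.mpr fun x _ => z_ne_zero x)
  have hX : (RatFunc.X : RatFunc (RatField k)) ^ (2 * (N * #B)) ≠ 0 :=
    pow_ne_zero _ RatFunc.X_ne_zero
  have hC : RatFunc.C ((∏ x : Var k, z x) ^ N) ≠ 0 := by
    rwa [Ne, map_eq_zero]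
  have hG : scale (B : Set (Var k)) (evalAt z r) ≠ 0 := fun h => by
    rw [h, zero_mul] at h1
    exact h0 (IsFractionRing.injective _ (RatFunc (RatField k)) (h1.symm.trans (map_zero _).symm))
  have h3 := congrArg RatFunc.intDegree h1
  rw [RatFunc.intDegree_mul hG (mul_ne_zero hX hC), RatFunc.intDegree_mul hX hC,
    RatFunc.intDegree_C, RatFunc.intDegree_polynomial, ← RatFunc.algebraMap_X, ← map_pow,
    RatFunc.intDegree_polynomial, Polynomial.natDegree_X_pow] at h3
  push_cast at h3
  have : (j : ℤ) ≤ (scaleZPoly B (shiftPoly N r)).natDegree := by exact_mod_cast h2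
  linarith

theorem sum_eq_of_scale_univ_evalAt {r : Laurent k} {D : ℤ} {c : RatField k}
    (h : scale Set.univ (evalAt z r) = RatFunc.X ^ (2 * D) * RatFunc.C c) {e : Var k → ℤ}
    (he : r e ≠ 0) : ∑ x, e x = D := by
  obtain ⟨N, hr⟩ := exists_forall_nonneg_add r
  have h1 := exists_scale_evalAt Finset.univ hr
  obtain ⟨j, hj, hj'⟩ := coeff_scaleZPoly_shiftPoly_ne_zero Finset.univ hr he
  rw [Finset.coe_univ, h] at h1
  -- The exponent may be negative; writing it as a difference of natural numbers allows coefficients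
  -- to be compared between polynomials.
  obtain ⟨a, b, hab⟩ : ∃ a b : ℕ, (a : ℤ) - b = 2 * (D + N * #(univ : Finset (Var k))) :=
    ⟨_, _, Int.toNat_sub_toNat_neg _⟩
  have hX : (RatFunc.X : RatFunc (RatField k)) ≠ 0 := RatFunc.X_ne_zero
  have h2 : algebraMap _ (RatFunc (RatField k))
      (Polynomial.C (c * (∏ x, z x) ^ N) * Polynomial.X ^ a) =
      algebraMap _ (RatFunc (RatField k))
        (scaleZPoly Finset.univ (shiftPoly N r) * Polynomial.X ^ b) := by
    rw [map_mul, map_mul (algebraMap _ _) (scaleZPoly _ _), ← h1, map_pow _ Polynomial.X a,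
      map_pow _ Polynomial.X b,
      RatFunc.algebraMap_X, RatFunc.algebraMap_C,
      map_mul RatFunc.C, ← zpow_natCast _ a, ← zpow_natCast _ b,
      show (a : ℤ) = 2 * D + ((2 * (N * #(univ : Finset (Var k))) : ℕ) : ℤ) + b by
        push_cast; linarith, zpow_add₀ hX, zpow_add₀ hX, zpow_natCast]
    ring
  have h3 := congrArg (fun p => p.coeff (j + b)) (IsFractionRing.injective _ _ h2)
  simp only [Polynomial.coeff_mul_X_pow, Polynomial.coeff_C_mul_X_pow] at h3
  split_ifs at h3 with h4
  · have : (j : ℤ) + b = a := by exact_mod_cast h4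
    linarith
  · exact absurd h3.symm hj'

end Scaling

/-! ### Bounds on the exponents of r from the slope and from the homogeneous degree. -/

section SlopeBounds

variable {n : ℕ} {k : ZMod n → ℕ}

theorem denomFactor_ne_zero {i : ZMod n} {a b : Fin (k i)} (h : b ≠ a) :
    q • z (k := k) ⟨i, a⟩ - q⁻¹ • z (k := k) ⟨i, b⟩ ≠ 0 := by
  have h2 : q • z (k := k) ⟨i, a⟩ - q⁻¹ • z (k := k) ⟨i, b⟩ =
      MvPolynomial.aeval z (MvPolynomial.C q * MvPolynomial.X (⟨i, a⟩ : Var k) -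
        MvPolynomial.C q⁻¹ * MvPolynomial.X (⟨i, b⟩ : Var k)) := by
    simp [Algebra.smul_def]
  rw [h2]
  intro h0
  have h1 := aeval_z_injective (h0.trans (map_zero _).symm)
  have h3 := congrArg (MvPolynomial.eval fun x => if x = (⟨i, a⟩ : Var k) then 1 else 0) h1
  simp [h, q_ne_zero] at h3

theorem scale_ne_zero (B : Set (Var k)) {F : RatField k} (h : F ≠ 0) : scale B F ≠ 0 := by
  rwa [Ne, map_eq_zero]

theorem intDegree_X_pow {L : Type*} [Field L] (N : ℕ) :
    ((RatFunc.X : RatFunc L) ^ N).intDegree = N := by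
  rw [← RatFunc.algebraMap_X, ← map_pow, RatFunc.intDegree_polynomial, Polynomial.natDegree_X_pow]

theorem intDegree_scale_smul_z_le (B : Finset (Var k)) (c : BaseField) (hc : c ≠ 0) (x : Var k) :
    scale (B : Set (Var k)) (c • z x) ≠ 0 ∧
    (scale (B : Set (Var k)) (c • z x)).intDegree = if x ∈ B then 2 else 0 := by
  have h1 : RatFunc.C (algebraMap BaseField (RatField k) c) ≠ 0 := by
    rw [Ne, map_eq_zero, map_eq_zero]
    exact hc
  have h2 : RatFunc.C (z x) ≠ 0 := by
    rw [Ne, map_eq_zero]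
    exact z_ne_zero x
  refine ⟨scale_ne_zero _ (smul_ne_zero hc (z_ne_zero x)), ?_⟩
  rw [scale_smul, scale_z]
  simp only [Finset.mem_coe]
  split_ifs
  · rw [RatFunc.intDegree_mul h1 (mul_ne_zero (pow_ne_zero _ RatFunc.X_ne_zero) h2),
      RatFunc.intDegree_mul (pow_ne_zero _ RatFunc.X_ne_zero) h2, RatFunc.intDegree_C,
      RatFunc.intDegree_C, intDegree_X_pow]
    norm_num
  · rw [RatFunc.intDegree_mul h1 h2, RatFunc.intDegree_C, RatFunc.intDegree_C, add_zero]

variable [NeZero n]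

/-- The color vector of a set of variables. -/
def colors (B : Finset (Var k)) (i : ZMod n) : ℕ := #{a : Fin (k i) | (⟨i, a⟩ : Var k) ∈ B}

/-- The bound for the degree of a Laurent polynomial, with exponents shifted by `M`, in a set of
variables with color vector `b`. -/
def degBound (m : ZMod n → ℚ) (k : ZMod n → ℕ) (M : ℕ) (b : ZMod n → ℕ) : ℚ :=
  scalarProd m b + ∑ i, (b i : ℚ) * (k i - 1 + M) - ∑ i, (b i : ℚ) * b (i + 1)

/-- The total degree of a Laurent polynomial, with exponents shifted by `M`. -/
def totalBound (k : ZMod n → ℕ) (M : ℕ) (d : ℤ) : ℤ :=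
  d + ∑ i, (k i : ℤ) * (k i - 1 + M) - ∑ i, (k i : ℤ) * k (i + 1)

theorem sum_sigma_var {A : Type*} [AddCommMonoid A] (f : Var k → A) :
    ∑ x, f x = ∑ i, ∑ a, f ⟨i, a⟩ := Fintype.sum_sigma _

theorem sum_mem_color (B : Finset (Var k)) {R : Type*} [Semiring R] (f : ZMod n → R) :
    ∑ x ∈ B, f x.1 = ∑ i, (colors B i : R) * f i := by
  rw [← Finset.univ_inter B, ← Finset.sum_ite_mem, sum_sigma_var]
  refine Finset.sum_congr rfl fun i _ => ?_
  rw [← Finset.sum_filter]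
  simp [colors]

theorem denom_ne_zero : denom k ≠ 0 := by
  refine Finset.prod_ne_zero_iff.mpr fun i _ => Finset.prod_ne_zero_iff.mpr fun a _ =>
    Finset.prod_ne_zero_iff.mpr fun b hb => denomFactor_ne_zero (Finset.ne_of_mem_erase hb)

theorem halfMonomial_ne_zero : halfMonomial k ≠ 0 :=
  Finset.prod_ne_zero_iff.mpr fun x _ => pow_ne_zero _ (sqrtZ_ne_zero x)

theorem intDegree_prod {ι L : Type*} [Field L] (s : Finset ι) (f : ι → RatFunc L)
    (h : ∀ i ∈ s, f i ≠ 0) : (∏ i ∈ s, f i).intDegree = ∑ i ∈ s, (f i).intDegree := by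
  classical
  induction s using Finset.induction_on with
  | empty => simp
  | insert i s hi ih =>
    rw [Finset.prod_insert hi, Finset.sum_insert hi, RatFunc.intDegree_mul
      (h i (Finset.mem_insert_self i s)) (Finset.prod_ne_zero_iff.mpr fun j hj =>
        h j (Finset.mem_insert_of_mem hj)), ih fun j hj => h j (Finset.mem_insert_of_mem hj)]

theorem intDegree_scale_halfMonomial (B : Finset (Var k)) :
    (scale (B : Set (Var k)) (halfMonomial k)).intDegree =
      ∑ i, (colors B i : ℤ) * (k (i - 1) + k (i + 1)) := by
  rw [halfMonomial, map_prod, intDegree_prod _ _ fun x _ =>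
    scale_ne_zero _ (pow_ne_zero _ (sqrtZ_ne_zero x)),
    ← sum_mem_color B (fun i => ((k (i - 1) : ℤ) + k (i + 1))), ← Finset.univ_inter B,
    ← Finset.sum_ite_mem]
  refine Finset.sum_congr rfl fun x _ => ?_
  have hs : RatFunc.C (sqrtZ x) ≠ 0 := by
    rw [Ne, map_eq_zero]
    exact sqrtZ_ne_zero x
  rw [map_pow, scale_sqrtZ]
  simp only [Finset.mem_coe, Finset.univ_inter]
  split_ifs with h
  · rw [mul_pow, RatFunc.intDegree_mul (pow_ne_zero _ RatFunc.X_ne_zero) (pow_ne_zero _ hs),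
      intDegree_X_pow, ← map_pow, RatFunc.intDegree_C]
    push_cast
    ring
  · rw [← map_pow, RatFunc.intDegree_C]

/-- A factor has degree at most 2 in η, and degree at most 0 unless one of its two variables lies in
B. With b = `colors B`, there are b_i (k_i - 1) + (k_i - b_i) b_i ordered pairs of color i meeting
B. -/
theorem intDegree_scale_denom_le (B : Finset (Var k)) :
    (scale (B : Set (Var k)) (denom k)).intDegree ≤
      2 * ∑ i, (colors B i : ℤ) * ((k i - 1) + (k i - colors B i)) := by
  rw [denom, map_prod, intDegree_prod _ _ fun i _ => scale_ne_zero _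
    (Finset.prod_ne_zero_iff.mpr fun a _ => Finset.prod_ne_zero_iff.mpr fun b hb =>
      denomFactor_ne_zero (Finset.ne_of_mem_erase hb)), Finset.mul_sum]
  refine Finset.sum_le_sum fun i _ => ?_
  rw [map_prod, intDegree_prod _ _ fun a _ => scale_ne_zero _
    (Finset.prod_ne_zero_iff.mpr fun b hb => denomFactor_ne_zero (Finset.ne_of_mem_erase hb))]
  have h1 : ∀ a : Fin (k i), (scale (B : Set (Var k)) (∏ b ∈ univ.erase a,
      (q • z (k := k) ⟨i, a⟩ - q⁻¹ • z (k := k) ⟨i, b⟩))).intDegree ≤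
        if (⟨i, a⟩ : Var k) ∈ B then 2 * ((k i : ℤ) - 1) else 2 * (colors B i : ℤ) := by
    intro a
    rw [map_prod, intDegree_prod _ _ fun b hb =>
      scale_ne_zero _ (denomFactor_ne_zero (Finset.ne_of_mem_erase hb))]
    have h2 : ∀ b ∈ univ.erase a, (scale (B : Set (Var k))
        (q • z (k := k) ⟨i, a⟩ - q⁻¹ • z (k := k) ⟨i, b⟩)).intDegree ≤
          if (⟨i, a⟩ : Var k) ∈ B then 2 else if (⟨i, b⟩ : Var k) ∈ B then 2 else 0 := by
      intro b hb
      have h3 := scale_ne_zero (B : Set (Var k))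
        (denomFactor_ne_zero (k := k) (Finset.ne_of_mem_erase hb))
      obtain ⟨h4, h5⟩ := intDegree_scale_smul_z_le B q q_ne_zero (⟨i, a⟩ : Var k)
      obtain ⟨h6, h7⟩ := intDegree_scale_smul_z_le B q⁻¹ (inv_ne_zero q_ne_zero) (⟨i, b⟩ : Var k)
      rw [map_sub, sub_eq_add_neg] at h3 ⊢
      refine (RatFunc.intDegree_add_le (neg_ne_zero.mpr h6) h3).trans ?_
      rw [RatFunc.intDegree_neg, h5, h7]
      split_ifs <;> simp
    refine (Finset.sum_le_sum h2).trans ?_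
    split_ifs with ha
    · rw [Finset.sum_const, Finset.card_erase_of_mem (Finset.mem_univ a), Finset.card_univ,
        Fintype.card_fin, nsmul_eq_mul]
      have : 1 ≤ k i := a.pos
      push_cast [this]
      linarith
    · rw [← Finset.sum_filter, Finset.sum_const, nsmul_eq_mul, mul_comm]
      refine mul_le_mul_of_nonneg_left ?_ (by norm_num)
      exact_mod_cast Finset.card_le_card (Finset.filter_subset_filter _ (Finset.erase_subset _ _))
  refine (Finset.sum_le_sum fun a _ => h1 a).trans (le_of_eq ?_)
  have h3 : #{a : Fin (k i) | (⟨i, a⟩ : Var k) ∈ B} +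
      #{a : Fin (k i) | (⟨i, a⟩ : Var k) ∉ B} = k i := by
    rw [Finset.card_filter_add_card_filter_not, Finset.card_univ, Fintype.card_fin]
  have h4 : (#{a : Fin (k i) | (⟨i, a⟩ : Var k) ∉ B} : ℤ) = k i - colors B i := by
    rw [colors]
    omega
  rw [Finset.sum_ite, Finset.sum_const, Finset.sum_const, nsmul_eq_mul, nsmul_eq_mul, h4]
  change (colors B i : ℤ) * _ + _ = _
  ring

/-- Bookkeeping for k = a + b: the degree of the denominator, less the Killing form and the degree
of the half monomial, is what `degBound` contains besides m·b. Cyclic reindexing identifies sums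
over neighbors i - 1 with sums over neighbors i + 1. -/
theorem killingForm_add_self (a b : ZMod n → ℕ) :
    2 * (∑ i, (b i : ℚ) * ((a i + b i : ℕ) - 1 + ((a i + b i : ℕ) - b i))) - killingForm a b -
      ∑ i, (b i : ℚ) * ((a (i - 1) + b (i - 1) : ℕ) + (a (i + 1) + b (i + 1) : ℕ)) =
    2 * (∑ i, (b i : ℚ) * ((a i + b i : ℕ) - 1) - ∑ i, (b i : ℚ) * b (i + 1)) := by
  have h1 : ∑ i, (a i : ℚ) * b (i + 1) = ∑ i, (b i : ℚ) * a (i - 1) := by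
    rw [← Equiv.sum_comp (Equiv.subRight (1 : ZMod n))]
    refine Finset.sum_congr rfl fun i _ => ?_
    simp [mul_comm]
  have h2 : ∑ i, (a i : ℚ) * b (i - 1) = ∑ i, (b i : ℚ) * a (i + 1) := by
    rw [← Equiv.sum_comp (Equiv.addRight (1 : ZMod n))]
    refine Finset.sum_congr rfl fun i _ => ?_
    simp [mul_comm]
  have h3 : ∑ i, (b i : ℚ) * b (i - 1) = ∑ i, (b i : ℚ) * b (i + 1) := by
    rw [← Equiv.sum_comp (Equiv.addRight (1 : ZMod n))]
    refine Finset.sum_congr rfl fun i _ => ?_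
    simp [mul_comm]
  have h4 : killingForm a b = 2 * ∑ i, (b i : ℚ) * a i - ∑ i, (b i : ℚ) * a (i - 1) -
      ∑ i, (b i : ℚ) * a (i + 1) := by
    rw [killingForm, ← h1, ← h2, Finset.mul_sum, ← Finset.sum_sub_distrib,
      ← Finset.sum_sub_distrib]
    exact Finset.sum_congr rfl fun i _ => by ring
  have h5 : ∑ i, (b i : ℚ) * ((a (i - 1) + b (i - 1) : ℕ) + (a (i + 1) + b (i + 1) : ℕ)) =
      ∑ i, (b i : ℚ) * a (i - 1) + ∑ i, (b i : ℚ) * a (i + 1) +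
        2 * ∑ i, (b i : ℚ) * b (i + 1) := by
    rw [two_mul, ← add_assoc]
    nth_rewrite 1 [← h3]
    rw [← Finset.sum_add_distrib, ← Finset.sum_add_distrib, ← Finset.sum_add_distrib]
    exact Finset.sum_congr rfl fun i _ => by push_cast; ring
  have h6 : ∑ i, (b i : ℚ) * ((a i + b i : ℕ) - 1 + ((a i + b i : ℕ) - b i)) =
      ∑ i, (b i : ℚ) * ((a i + b i : ℕ) - 1) + ∑ i, (b i : ℚ) * a i := by
    rw [← Finset.sum_add_distrib]
    exact Finset.sum_congr rfl fun i _ => by push_cast; ring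
  rw [h4, h5, h6]
  ring

/-- The last `b i` variables of each color `i`, where `a + b = k`. -/
def finalVars (a : ZMod n → ℕ) : Finset (Var k) := univ.filter fun x => a x.1 ≤ (x.2 : ℕ)

theorem colors_finalVars {a b : ZMod n → ℕ} (h : a + b = k) :
    colors (finalVars a : Finset (Var k)) = b := by
  funext i
  subst h
  have h1 : #{x : Fin (a i + b i) | a i ≤ (x : ℕ)} = b i := by
    have h3 : #{x : Fin (a i + b i) | (x : ℕ) < a i} = min (a i + b i) (a i) :=
      Fin.card_filter_val_lt
    have h2 := Finset.card_filter_add_card_filter_not (s := (univ : Finset (Fin (a i + b i))))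
      (fun x => (x : ℕ) < a i)
    simp only [not_lt, Finset.card_univ, Fintype.card_fin] at h2
    omega
  simpa [colors, finalVars] using h1

/-- The slope condition bounds the degree of F from above; the degree of r exceeds it by that of the
denominator minus that of the half monomial, and is at least the one of each monomial. -/
theorem sum_finalVars_le {m : ZMod n → ℚ} {r : Laurent k}
    (h : halfMonomial k * (evalAt z r / denom k) ∈ slopeLE m k) {e : Var k → ℤ} (he : r e ≠ 0)
    {a b : ZMod n → ℕ} (hab : a + b = k) :
    ((∑ x ∈ finalVars a, e x : ℤ) : ℚ) ≤ degBound m k 0 b := by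
  have h1 := h a b hab
  have hset : {x : Var k | a x.1 ≤ (x.2 : ℕ)} = ((finalVars a : Finset (Var k)) : Set (Var k)) := by
    ext x
    simp [finalVars]
  rw [hset] at h1
  set B : Finset (Var k) := finalVars a
  have hr : evalAt z r ≠ 0 := by
    intro h0
    obtain ⟨N, hN⟩ := exists_forall_nonneg_add r
    obtain ⟨j, _, hj⟩ := coeff_scaleZPoly_shiftPoly_ne_zero ∅ hN he
    have := exists_scale_evalAt ∅ hN
    rw [h0, map_zero, zero_mul] at this
    exact hj (by rw [IsFractionRing.injective _ (RatFunc (RatField k))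
      (this.symm.trans (map_zero _).symm), Polynomial.coeff_zero])
  have h2 : (scale (B : Set (Var k)) (halfMonomial k * (evalAt z r / denom k))).intDegree =
      ∑ i, (colors B i : ℤ) * (k (i - 1) + k (i + 1)) +
        ((scale (B : Set (Var k)) (evalAt z r)).intDegree -
          (scale (B : Set (Var k)) (denom k)).intDegree) := by
    rw [map_mul, map_div₀, RatFunc.intDegree_mul (scale_ne_zero _ halfMonomial_ne_zero)
      (div_ne_zero (scale_ne_zero _ hr) (scale_ne_zero _ denom_ne_zero)),
      RatFunc.intDegree_div (scale_ne_zero _ hr) (scale_ne_zero _ denom_ne_zero),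
      intDegree_scale_halfMonomial]
  have h3 := h1.resolve_left (scale_ne_zero _ (mul_ne_zero halfMonomial_ne_zero
    (div_ne_zero hr denom_ne_zero)))
  have h4 := le_intDegree_scale_evalAt B he
  have h5 := intDegree_scale_denom_le B
  have h6 : 2 * ∑ x ∈ B, e x ≤
      (scale (B : Set (Var k)) (halfMonomial k * (evalAt z r / denom k))).intDegree -
      ∑ i, (colors B i : ℤ) * (k (i - 1) + k (i + 1)) +
        2 * ∑ i, (colors B i : ℤ) * ((k i - 1) + (k i - colors B i)) := by
    linarith
  rw [colors_finalVars hab] at h6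
  have h7 : (2 * (∑ x ∈ B, e x : ℤ) : ℚ) ≤
      (scale (B : Set (Var k)) (halfMonomial k * (evalAt z r / denom k))).intDegree -
      ∑ i, (b i : ℚ) * (k (i - 1) + k (i + 1)) +
        2 * ∑ i, (b i : ℚ) * ((k i - 1) + (k i - b i)) := by
    exact_mod_cast h6
  have h8 := killingForm_add_self a b
  have hk : ∀ i, a i + b i = k i := fun i => congrFun hab i
  simp only [hk] at h8
  rw [degBound]
  simp only [Nat.cast_zero, add_zero]
  linarith

theorem scale_univ_denom :
    scale Set.univ (denom k) = RatFunc.X ^ (2 * ∑ i, (k i : ℤ) * (k i - 1)) *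
      RatFunc.C (denom k) := by
  have hX : (RatFunc.X : RatFunc (RatField k)) ≠ 0 := RatFunc.X_ne_zero
  rw [denom, map_prod, map_prod, Finset.mul_sum]
  have : ∀ i, scale Set.univ (∏ a : Fin (k i), ∏ b ∈ Finset.univ.erase a,
      (q • z (k := k) ⟨i, a⟩ - q⁻¹ • z (k := k) ⟨i, b⟩)) =
      RatFunc.X ^ (2 * ((k i : ℤ) * (k i - 1))) *
      RatFunc.C (∏ a : Fin (k i), ∏ b ∈ Finset.univ.erase a,
      (q • z (k := k) ⟨i, a⟩ - q⁻¹ • z (k := k) ⟨i, b⟩)) := by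
    intro i
    have h1 : ∀ a b : Fin (k i),
        scale Set.univ (q • z (k := k) ⟨i, a⟩ - q⁻¹ • z (k := k) ⟨i, b⟩) =
        RatFunc.X ^ (2 : ℤ) * RatFunc.C (q • z (k := k) ⟨i, a⟩ - q⁻¹ • z (k := k) ⟨i, b⟩) := by
      intro a b
      rw [map_sub, scale_smul, scale_smul, scale_z, scale_z]
      simp only [Set.mem_univ, if_true, map_sub, Algebra.smul_def, map_mul]
      norm_cast
      ring
    simp only [map_prod, h1, Finset.prod_mul_distrib, Finset.prod_const, Finset.mem_univ,
      Finset.card_erase_of_mem, Finset.card_univ, Fintype.card_fin]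
    congr 1
    rcases Nat.eq_zero_or_pos (k i) with h | h
    · simp [h]
    · rw [← zpow_natCast, ← zpow_natCast, ← zpow_mul, ← zpow_mul]
      congr 1
      push_cast [Nat.one_le_iff_ne_zero.mpr h.ne']
      ring
  simp only [this, Finset.prod_mul_distrib]
  rw [← map_prod, map_prod]
  congr 1
  induction (univ : Finset (ZMod n)) using Finset.induction_on with
  | empty => simp
  | insert i s hi ih => rw [Finset.prod_insert hi, Finset.sum_insert hi, zpow_add₀ hX, ih]

theorem scale_univ_halfMonomial :
    scale Set.univ (halfMonomial k) = RatFunc.X ^ (2 * ∑ i, (k i : ℤ) * k (i + 1)) *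
      RatFunc.C (halfMonomial k) := by
  have h1 : ∑ x : Var k, (k (x.1 - 1) + k (x.1 + 1)) = 2 * ∑ i, k i * k (i + 1) := by
    have h3 : ∑ i, k i * k (i - 1) = ∑ i, k i * k (i + 1) := by
      rw [← Equiv.sum_comp (Equiv.addRight (1 : ZMod n))]
      refine Finset.sum_congr rfl fun i _ => ?_
      simp [mul_comm]
    rw [sum_sigma_var]
    simp only [Finset.sum_const, Finset.card_univ, Fintype.card_fin, smul_eq_mul, mul_add,
      Finset.sum_add_distrib, h3]
    ring
  rw [halfMonomial, map_prod, map_prod]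
  simp only [map_pow, scale_sqrtZ, Set.mem_univ, if_true, mul_pow, Finset.prod_mul_distrib]
  rw [Finset.prod_pow_eq_pow_sum, h1, ← zpow_natCast]
  push_cast
  rfl

theorem sum_eq_of_mem_homogeneous {d : ℤ} {r : Laurent k}
    (h : halfMonomial k * (evalAt z r / denom k) ∈ homogeneous k d) {e : Var k → ℤ}
    (he : r e ≠ 0) : ∑ x, e x = totalBound k 0 d := by
  have hX : (RatFunc.X : RatFunc (RatField k)) ≠ 0 := RatFunc.X_ne_zero
  have h1 : scale Set.univ (halfMonomial k * (evalAt z r / denom k)) =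
      RatFunc.X ^ (2 * d) * RatFunc.C (halfMonomial k * (evalAt z r / denom k)) := h
  refine sum_eq_of_scale_univ_evalAt (c := evalAt z r) ?_ he
  have hd : RatFunc.C (denom k) ≠ 0 := by
    rw [Ne, map_eq_zero]
    exact denom_ne_zero
  have hh : RatFunc.C (halfMonomial k) ≠ 0 := by
    rw [Ne, map_eq_zero]
    exact halfMonomial_ne_zero
  rw [map_mul, map_div₀, scale_univ_denom, scale_univ_halfMonomial, map_mul, map_div₀] at h1
  rw [totalBound]
  simp only [Nat.cast_zero, add_zero]
  rw [mul_sub, mul_add, zpow_sub₀ hX, zpow_add₀ hX]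
  have h2 := zpow_ne_zero (2 * ∑ i, (k i : ℤ) * k (i + 1)) hX
  have h3 := zpow_ne_zero (2 * ∑ i, (k i : ℤ) * (k i - 1)) hX
  field_simp at h1 ⊢
  linear_combination h1

end SlopeBounds

/-! ### Passage from the slope piece to a space of polynomials. -/

section PolyPiece

variable {n : ℕ} {k : ZMod n → ℕ}

theorem exists_colorPerm (e : Var k ≃ Var k) (he : ∀ x, (e x).1 = x.1) :
    ∃ σ : ∀ i : ZMod n, Equiv.Perm (Fin (k i)), ∀ x, e x = ⟨x.1, σ x.1 x.2⟩ := by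
  have h : ∀ i (a : Fin (k i)), ∃ b : Fin (k i), e ⟨i, a⟩ = ⟨i, b⟩ := by
    intro i a
    have := he ⟨i, a⟩
    rcases hx : e ⟨i, a⟩ with ⟨j, b⟩
    rw [hx] at this
    obtain rfl : j = i := this
    exact ⟨b, rfl⟩
  choose f hf using h
  have hinj : ∀ i, Function.Injective (f i) := by
    intro i a b hab
    have : e ⟨i, a⟩ = e ⟨i, b⟩ := by rw [hf, hf, hab]
    simpa using e.injective this
  exact ⟨fun i => Equiv.ofBijective (f i) (Finite.injective_iff_bijective.mp (hinj i)),
    fun x => hf x.1 x.2⟩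

theorem colors_le (B : Finset (Var k)) (i : ZMod n) : colors B i ≤ k i := by
  refine (Finset.card_le_univ _).trans ?_
  rw [Fintype.card_fin]

variable [NeZero n]

/-- The slope condition only concerns the last variables of each color; a color-preserving
permutation brings an arbitrary set B there. -/
theorem exists_colorPerm_finalVars (B : Finset (Var k)) :
    ∃ σ : ∀ i : ZMod n, Equiv.Perm (Fin (k i)), ∀ x : Var k,
      (⟨x.1, σ x.1 x.2⟩ : Var k) ∈ B ↔ x ∈ (finalVars (k - colors B) : Finset (Var k)) := by
  have h1 : ∀ i, ∃ σ : Equiv.Perm (Fin (k i)), ∀ a : Fin (k i),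
      (⟨i, σ a⟩ : Var k) ∈ B ↔ (⟨i, a⟩ : Var k) ∈ (finalVars (k - colors B) : Finset (Var k)) := by
    intro i
    have h2 : colors (finalVars (k - colors B) : Finset (Var k)) i = colors B i :=
      congrFun (colors_finalVars (by
        funext j
        exact Nat.sub_add_cancel (colors_le B j))) i
    have h3 : Fintype.card {a : Fin (k i) //
        (⟨i, a⟩ : Var k) ∈ (finalVars (k - colors B) : Finset (Var k))} =
        Fintype.card {a : Fin (k i) // (⟨i, a⟩ : Var k) ∈ B} := by
      rw [Fintype.card_subtype, Fintype.card_subtype]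
      exact h2
    obtain ⟨ψ⟩ := Fintype.card_eq.mp h3
    refine ⟨ψ.extendSubtype, fun a => ⟨fun h => ?_, fun h => ψ.extendSubtype_mem a h⟩⟩
    by_contra h4
    exact ψ.extendSubtype_not_mem a h4 h
  choose σ hσ using h1
  exact ⟨σ, fun x => hσ x.1 x.2⟩

theorem sum_le_degBound {m : ZMod n → ℚ} {r : Laurent k} (hs : IsColorSymmetric r)
    (h : halfMonomial k * (evalAt z r / denom k) ∈ slopeLE m k) {e : Var k → ℤ} (he : r e ≠ 0)
    (B : Finset (Var k)) :
    ((∑ x ∈ B, e x : ℤ) : ℚ) ≤ degBound m k 0 (colors B) := by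
  obtain ⟨σ, hσ⟩ := exists_colorPerm_finalVars B
  have h1 := sum_finalVars_le h (e := fun x => e ⟨x.1, σ x.1 x.2⟩) (by rwa [hs σ e])
    (a := k - colors B) (b := colors B) (by
      funext j
      exact Nat.sub_add_cancel (colors_le B j))
  convert h1 using 2
  symm
  refine Finset.sum_bijective (Equiv.sigmaCongrRight σ) (Equiv.bijective _) (fun x => ?_)
    fun x _ => rfl
  rw [← hσ x]
  rfl

theorem degBound_colors (m : ZMod n → ℚ) (M : ℕ) (B : Finset (Var k)) :
    degBound m k M (colors B) = degBound m k 0 (colors B) + #B * M := by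
  have : (#B : ℚ) = ∑ i, (colors B i : ℚ) := by
    have := sum_mem_color B (fun _ => (1 : ℚ))
    simp at this ⊢
    exact this
  rw [degBound, degBound, this, Finset.sum_mul]
  have : ∑ i, (colors B i : ℚ) * (k i - 1 + M) =
      ∑ i, (colors B i : ℚ) * (k i - 1 + (0 : ℕ)) + ∑ i, (colors B i : ℚ) * M := by
    rw [← Finset.sum_add_distrib]
    exact Finset.sum_congr rfl fun i _ => by push_cast; ring
  rw [this]
  ring

theorem totalBound_eq_add (M : ℕ) (d : ℤ) :
    totalBound k M d = totalBound k 0 d + #(univ : Finset (Var k)) * M := by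
  have h1 : (#(univ : Finset (Var k)) : ℤ) = ∑ i, (k i : ℤ) := by
    simp
  rw [totalBound, totalBound, h1, Finset.sum_mul]
  have : ∑ i, (k i : ℤ) * (k i - 1 + M) =
      ∑ i, (k i : ℤ) * (k i - 1 + (0 : ℕ)) + ∑ i, (k i : ℤ) * M := by
    rw [← Finset.sum_add_distrib]
    exact Finset.sum_congr rfl fun i _ => by push_cast; ring
  rw [this]
  ring

variable (k) in
/-- A uniform bound for the negative exponents. -/
theorem exists_uniform_shift (m : ZMod n → ℚ) (d : ℤ) : ∃ M : ℕ, ∀ r : Laurent k,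
    IsColorSymmetric r → halfMonomial k * (evalAt z r / denom k) ∈ slopeLE m k →
      halfMonomial k * (evalAt z r / denom k) ∈ homogeneous k d →
        ∀ e ∈ r.support, ∀ x, 0 ≤ e x + M := by
  -- The exponent of x is the total degree minus the sum over all other variables; the former is
  -- fixed and the latter bounded above, both in terms of m, k, d only.
  refine ⟨∑ x : Var k, ⌈|degBound m k 0 (colors (univ.erase x)) - totalBound k 0 d|⌉₊,
    fun r hs h1 h2 e he x => ?_⟩
  rw [Finsupp.mem_support_iff] at he
  have h3 := sum_le_degBound hs h1 he (univ.erase x)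
  have h4 := sum_eq_of_mem_homogeneous h2 he
  have h5 : ⌈|degBound m k 0 (colors (univ.erase x)) - totalBound k 0 d|⌉₊ ≤
      ∑ x : Var k, ⌈|degBound m k 0 (colors (univ.erase x)) - totalBound k 0 d|⌉₊ :=
    Finset.single_le_sum (f := fun x : Var k =>
      ⌈|degBound m k 0 (colors (univ.erase x)) - totalBound k 0 d|⌉₊)
      (fun _ _ => Nat.zero_le _) (Finset.mem_univ x)
  set M := ∑ x : Var k, ⌈|degBound m k 0 (colors (univ.erase x)) - totalBound k 0 d|⌉₊
  have h6 := Nat.le_ceil |degBound m k 0 (colors (univ.erase x)) - totalBound k 0 d|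
  have h7 := le_abs_self (degBound m k 0 (colors (univ.erase x)) - totalBound k 0 d)
  have h8 : (⌈|degBound m k 0 (colors (univ.erase x)) - totalBound k 0 d|⌉₊ : ℚ) ≤ M := by
    exact_mod_cast h5
  have h9 := Finset.add_sum_erase univ e (Finset.mem_univ x)
  have h10 : (e x : ℚ) + (∑ y ∈ univ.erase x, e y : ℤ) = totalBound k 0 d := by
    rw [← h4]
    exact_mod_cast h9
  have h11 : (0 : ℚ) ≤ (e x : ℚ) + M := by linarith
  exact_mod_cast h11

/-- The polynomials `(∏ x, z_x) ^ M * r`, where `r` runs over the Laurent polynomials that occur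
in the numerators of the elements of the slope piece. -/
def polyPiece (m : ZMod n → ℚ) (k : ZMod n → ℕ) (d : ℤ) (M : ℕ) :
    Submodule BaseField (MvPolynomial (Var k) BaseField) where
  carrier := {R |
    (∀ (L : Type) [Field L] [Algebra BaseField L] (v v' : Var k → L),
      (univ : Finset (Var k)).val.map (fun x => (x.1, v x)) =
        (univ : Finset (Var k)).val.map (fun x => (x.1, v' x)) →
      MvPolynomial.aeval v R = MvPolynomial.aeval v' R) ∧
    (∀ (L : Type) [Field L] [Algebra BaseField L] (v : Var k → L) (u : L) (x y w : Var k),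
      u ≠ 0 → x ≠ w → w.1 = x.1 → v x = q⁻¹ • u → v w = q • u →
      (y.1 = x.1 + 1 ∧ v y = t • u ∨ y.1 = x.1 - 1 ∧ v y = t⁻¹ • u) →
      MvPolynomial.aeval v R = 0) ∧
    ∀ e : Var k →₀ ℕ, R.coeff e ≠ 0 → (∑ x, (e x : ℤ) = totalBound k M d) ∧
      ∀ B : Finset (Var k), (∑ x ∈ B, (e x : ℚ)) ≤ degBound m k M (colors B)}
  zero_mem' := ⟨fun _ _ _ _ _ _ => by rw [map_zero, map_zero],
    fun _ _ _ _ _ _ _ _ _ _ _ _ _ _ => map_zero _, fun e he => absurd (by simp) he⟩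
  add_mem' := by
    rintro R R' ⟨h1, h2, h3⟩ ⟨h1', h2', h3'⟩
    refine ⟨fun L _ _ v v' h => by rw [map_add, map_add, h1 L v v' h, h1' L v v' h],
      fun L _ _ v u x y w a b c d e f => by
        rw [map_add, h2 L v u x y w a b c d e f, h2' L v u x y w a b c d e f, add_zero],
      fun e he => ?_⟩
    by_cases h : R.coeff e = 0
    · exact h3' e fun h' => he (by rw [MvPolynomial.coeff_add, h, h', add_zero])
    · exact h3 e h
  smul_mem' := by
    rintro a R ⟨h1, h2, h3⟩
    refine ⟨fun L _ _ v v' h => by rw [map_smul, map_smul, h1 L v v' h],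
      fun L _ _ v u x y w a b c d e f => by
        rw [map_smul, h2 L v u x y w a b c d e f, smul_zero],
      fun e he => h3 e fun h => he (by rw [MvPolynomial.coeff_smul, h, smul_zero])⟩

/-- The two families of values differ by a color-preserving permutation of the variables, which
fixes the polynomial. -/
theorem aeval_eq_of_symmetric {r : Laurent k} {M : ℕ} (hs : IsColorSymmetric r)
    (hr : ∀ e ∈ r.support, ∀ x, 0 ≤ e x + M) {L : Type} [Field L] [Algebra BaseField L]
    {v v' : Var k → L} (h : (univ : Finset (Var k)).val.map (fun x => (x.1, v x)) =
      (univ : Finset (Var k)).val.map (fun x => (x.1, v' x))) :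
    MvPolynomial.aeval v (shiftPoly M r) = MvPolynomial.aeval v' (shiftPoly M r) := by
  obtain ⟨e, he⟩ := exists_equiv_of_map_univ_eq h
  simp only [Prod.mk.injEq] at he
  have hv : v = v' ∘ e := funext fun x => (he x).2.symm
  have hren : MvPolynomial.rename e (shiftPoly M r) = shiftPoly M r := by
    ext u
    obtain ⟨u, rfl⟩ : ∃ u', u = Finsupp.mapDomain e u' :=
      ⟨Finsupp.mapDomain e.symm u, by rw [← Finsupp.mapDomain_comp]; simp⟩
    rw [MvPolynomial.coeff_rename_mapDomain _ e.injective, coeff_shiftPoly hr, coeff_shiftPoly hr]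
    obtain ⟨σ, hσ⟩ := exists_colorPerm e fun x => (he x).1
    rw [← hs σ fun x => (Finsupp.mapDomain e u x : ℤ) - M]
    congr 1
    funext x
    rw [← hσ, Finsupp.mapDomain_apply e.injective]
  rw [hv, ← MvPolynomial.aeval_rename, hren]

theorem aeval_smul_of_homogeneous {R : MvPolynomial (Var k) BaseField} {D : ℤ}
    (hR : ∀ e : Var k →₀ ℕ, R.coeff e ≠ 0 → ∑ x, (e x : ℤ) = D) {L : Type} [Field L]
    [Algebra BaseField L] (v : Var k → L) (u : L) :
    MvPolynomial.aeval (fun x => u * v x) R = u ^ D * MvPolynomial.aeval v R := by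
  rw [MvPolynomial.aeval_def, MvPolynomial.aeval_def, MvPolynomial.eval₂_eq',
    MvPolynomial.eval₂_eq', Finset.mul_sum]
  refine Finset.sum_congr rfl fun e he => ?_
  rw [← hR e (MvPolynomial.mem_support_iff.mp he)]
  simp only [mul_pow, Finset.prod_mul_distrib]
  rw [Finset.prod_pow_eq_pow_sum, ← zpow_natCast]
  push_cast
  ring

/-- Homogeneity allows the three constants to be rescaled by any u ≠ 0, and the other coordinates of
a wheel point, being indeterminates, specialize to arbitrary values. -/
theorem aeval_eq_zero_of_wheelPoint {r : Laurent k} {M : ℕ}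
    (hr : ∀ e ∈ r.support, ∀ x, 0 ≤ e x + M) {D : ℤ}
    (hR : ∀ e : Var k →₀ ℕ, (shiftPoly M r).coeff e ≠ 0 → ∑ x, (e x : ℤ) = D)
    {x y w : Var k} {α β γ : BaseField} (hα : α ≠ 0) (hβ : β ≠ 0) (hγ : γ ≠ 0)
    (h0 : evalAt (wheelPoint x y w α β γ) r = 0) {L : Type} [Field L] [Algebra BaseField L]
    (v : Var k → L) {u : L} (hu : u ≠ 0) (hx : v x = α • u) (hy : v y = β • u)
    (hw : v w = γ • u) : MvPolynomial.aeval v (shiftPoly M r) = 0 := by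
  set p : Var k → MvPolynomial (Var k) BaseField :=
    Function.update (Function.update (Function.update MvPolynomial.X x (MvPolynomial.C α))
      y (MvPolynomial.C β)) w (MvPolynomial.C γ) with hp
  have h1 : MvPolynomial.aeval p (shiftPoly M r) = 0 := by
    apply aeval_z_injective
    rw [map_zero, ← AlgHom.comp_apply, MvPolynomial.comp_aeval]
    have : (fun i => MvPolynomial.aeval z (p i)) = wheelPoint x y w α β γ := by
      funext i
      simp only [hp, wheelPoint, Function.update_apply]
      split_ifs <;> simp
    rw [this, aeval_shiftPoly hr]
    · change evalAt _ r * _ = 0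
      rw [h0, zero_mul]
    · intro i
      have hne : ∀ {a : BaseField}, a ≠ 0 → algebraMap BaseField (RatField k) a ≠ 0 :=
        fun ha => by rwa [Ne, map_eq_zero]
      simp only [wheelPoint, Function.update_apply]
      split_ifs
      exacts [hne hγ, hne hβ, hne hα, z_ne_zero i]
  have h2 : v = fun i => u * (u⁻¹ * v i) := funext fun i => by field_simp
  rw [h2, aeval_smul_of_homogeneous hR _ u]
  have h3 : (fun i => u⁻¹ * v i) =
      fun i => MvPolynomial.aeval (fun i => u⁻¹ * v i) (p i) := by
    funext i
    have hc : ∀ a : BaseField, u⁻¹ * a • u = algebraMap BaseField L a := fun a => by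
      rw [mul_smul_comm, inv_mul_cancel₀ hu, Algebra.smul_def, mul_one]
    simp only [hp, Function.update_apply]
    split_ifs with h4 h5 h6
    · rw [h4, hw, hc, MvPolynomial.aeval_C]
    · rw [h5, hy, hc, MvPolynomial.aeval_C]
    · rw [h6, hx, hc, MvPolynomial.aeval_C]
    · rw [MvPolynomial.aeval_X]
  rw [h3, ← MvPolynomial.comp_aeval, AlgHom.comp_apply, h1, map_zero, mul_zero]

theorem shiftPoly_mem_polyPiece {m : ZMod n → ℚ} {d : ℤ} {r : Laurent k} {M : ℕ}
    (hr : ∀ e ∈ r.support, ∀ x, 0 ≤ e x + M) (hs : IsColorSymmetric r) (hw : SatisfiesWheel r)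
    (h1 : halfMonomial k * (evalAt z r / denom k) ∈ slopeLE m k)
    (h2 : halfMonomial k * (evalAt z r / denom k) ∈ homogeneous k d) :
    shiftPoly M r ∈ polyPiece m k d M := by
  have hdeg : ∀ e : Var k →₀ ℕ, (shiftPoly M r).coeff e ≠ 0 →
      (∑ x, (e x : ℤ) = totalBound k M d) := by
    intro e he
    rw [coeff_shiftPoly hr] at he
    have h3 := sum_eq_of_mem_homogeneous h2 he
    rw [Finset.sum_sub_distrib, Finset.sum_const, nsmul_eq_mul] at h3
    rw [totalBound_eq_add]
    linarith
  refine ⟨fun L _ _ v v' h => aeval_eq_of_symmetric hs hr h,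
    fun L _ _ v u x y w hu hxw hc hx hw' hy => ?_, fun e he => ⟨hdeg e he, fun B => ?_⟩⟩
  · rcases hy with ⟨hy, hy'⟩ | ⟨hy, hy'⟩
    · exact aeval_eq_zero_of_wheelPoint hr hdeg (inv_ne_zero q_ne_zero) t_ne_zero q_ne_zero
        ((hw x y w hxw hc).1 hy) v hu hx hy' hw'
    · exact aeval_eq_zero_of_wheelPoint hr hdeg (inv_ne_zero q_ne_zero) (inv_ne_zero t_ne_zero)
        q_ne_zero ((hw x y w hxw hc).2 hy) v hu hx hy' hw'
  · rw [coeff_shiftPoly hr] at he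
    have h3 := sum_le_degBound hs h1 he B
    rw [Finset.sum_sub_distrib, Finset.sum_const, nsmul_eq_mul] at h3
    rw [degBound_colors]
    push_cast at h3
    linarith

variable (k) in
/-- The element of the shuffle algebra with numerator `(∏ x, z_x) ^ (-M) * R`. -/
noncomputable def ofNumerator (M : ℕ) : MvPolynomial (Var k) BaseField →ₗ[BaseField] RatField k :=
  (LinearMap.mulLeft BaseField (halfMonomial k * ((∏ x, z x) ^ M)⁻¹ * (denom k)⁻¹)).comp
    (MvPolynomial.aeval z : MvPolynomial (Var k) BaseField →ₐ[BaseField] RatField k).toLinearMap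

theorem exists_slopePiece_le_map (m : ZMod n → ℚ) (k : ZMod n → ℕ) (d : ℤ) :
    ∃ M : ℕ, slopePiece m k d ≤ (polyPiece m k d M).map (ofNumerator k M) := by
  obtain ⟨M, hM⟩ := exists_uniform_shift k m d
  refine ⟨M, ?_⟩
  rintro F ⟨⟨⟨r, hs, hw, rfl⟩, h1⟩, h2⟩
  have hr := hM r hs h1 h2
  refine ⟨shiftPoly M r, shiftPoly_mem_polyPiece hr hs hw h1 h2, ?_⟩
  have hP : (∏ x : Var k, z x) ^ M ≠ 0 :=
    pow_ne_zero _ (Finset.prod_ne_zero_iff.mpr fun x _ => z_ne_zero x)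
  change _ * MvPolynomial.aeval z (shiftPoly M r) = _
  rw [aeval_shiftPoly hr z_ne_zero, div_eq_mul_inv]
  change _ * (evalAt z r * _) = _
  field_simp

end PolyPiece

/-! ### Specialization to arcs, and crossing of two arcs on a common line. -/

section Specialization

set_option linter.unusedSectionVars false

theorem exists_enumeration {α : Type*} (S : Multiset α) :
    ∃ f : Fin (Multiset.card S) → α, (univ : Finset (Fin (Multiset.card S))).val.map f = S := by
  obtain ⟨l, rfl⟩ := Quot.exists_rep S
  change ∃ f : Fin l.length → α, (univ : Finset (Fin l.length)).val.map f = (l : Multiset α)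
  exact ⟨l.get, by rw [Fin.univ_val_map, List.ofFn_get]⟩

theorem map_univ_sigma {ι α : Type*} [Fintype ι] {κ : ι → Type*} [∀ s, Fintype (κ s)]
    (f : (Σ s, κ s) → α) :
    (univ : Finset (Σ s, κ s)).val.map f =
      ∑ s, (univ : Finset (κ s)).val.map fun a => f ⟨s, a⟩ := by
  change ((univ : Finset ι).val.bind fun s =>
    (univ : Finset (κ s)).val.map (Sigma.mk s)).map f = _
  rw [Multiset.map_bind]
  simp only [Multiset.map_map]
  rfl

theorem map_univ_fin {α : Type*} (N : ℕ) (f : ℕ → α) :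
    (univ : Finset (Fin N)).val.map (fun a : Fin N => f a) = (Multiset.range N).map f := by
  rw [Fin.univ_val_map, Multiset.range, Multiset.map_coe, List.ofFn_eq_map,
    ← List.map_coe_finRange_eq_range, List.map_map]
  rfl

variable {n : ℕ}

theorem Arc.degree_apply (A : Arc n) (i : ZMod n) :
    A.degree i = #{a ∈ range A.length | A.start + ((a : ℕ) : ZMod n) = i} := by
  rw [Arc.degree, Finset.sum_apply, Finset.card_filter]
  refine Finset.sum_congr rfl fun a _ => ?_
  rw [Pi.single_apply]
  simp only [eq_comm]

theorem Arc.sum_degree [NeZero n] (A : Arc n) : ∑ i, A.degree i = A.length := by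
  simp only [Arc.degree, Finset.sum_apply]
  rw [Finset.sum_comm]
  simp [Pi.single_apply]

/-- The sum of the squares of the lengths. -/
def weight (ρ : Multiset (Arc n)) : ℕ := (ρ.map fun A => (A.length : ℕ) ^ 2).sum

/-- The colored points of the arc `A` based at `y`. -/
noncomputable def arcPoints {L : Type} [Field L] [Algebra BaseField L] (A : Arc n) (y : L) :
    Multiset (ZMod n × L) :=
  (Multiset.range A.length).map fun a => (A.start + ((a : ℕ) : ZMod n), τ ^ a • y)

/-- The positions of a family of arcs. -/
abbrev Pos {ι : Type} (A : ι → Arc n) : Type := Σ s, Fin (A s).length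

/-- The color of a position. -/
def Pos.color {ι : Type} {A : ι → Arc n} (p : Pos A) : ZMod n :=
  (A p.1).start + (((p.2 : ℕ)) : ZMod n)

variable {k : ZMod n → ℕ}

theorem exists_posEquiv [NeZero n] {ι : Type} [Fintype ι] (A : ι → Arc n)
    (h : ∑ s, (A s).degree = k) : ∃ g : Var k ≃ Pos A, ∀ x, (g x).color = x.1 := by
  refine exists_equiv_of_map_univ_eq ?_
  rw [map_univ_sigma, map_univ_sigma]
  ext i
  rw [Multiset.count_sum', Multiset.count_sum']
  have h1 : ∀ j : ZMod n, Multiset.count i ((univ : Finset (Fin (k j))).val.map fun _ => j) =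
      if i = j then k j else 0 := by
    intro j
    rw [Multiset.map_const', Multiset.count_replicate]
    simp [eq_comm]
  simp only [h1, Finset.sum_ite_eq, Finset.mem_univ, if_true]
  rw [← h, Finset.sum_apply]
  refine Finset.sum_congr rfl fun s _ => ?_
  rw [Arc.degree_apply]
  change _ = Multiset.count i ((univ : Finset (Fin (A s).length)).val.map
    fun a : Fin (A s).length => (A s).start + ((a : ℕ) : ZMod n))
  rw [map_univ_fin _ (fun a : ℕ => (A s).start + (a : ZMod n)), Multiset.count_map,
    Finset.card_def, Finset.filter_val]
  simp only [eq_comm]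
  rfl

/-- The specialization of the variables to the positions of a family of arcs. -/
noncomputable def specialize {ι : Type} {A : ι → Arc n} (g : Var k ≃ Pos A) :
    MvPolynomial (Var k) BaseField →ₐ[BaseField] MvPolynomial ι BaseField :=
  MvPolynomial.aeval fun x =>
    MvPolynomial.C (τ ^ ((g x).2 : ℕ)) * MvPolynomial.X (g x).1

theorem aeval_specialize {ι : Type} {A : ι → Arc n} (g : Var k ≃ Pos A) {L : Type} [Field L]
    [Algebra BaseField L] (y : ι → L) (R : MvPolynomial (Var k) BaseField) :
    MvPolynomial.aeval y (specialize g R) =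
      MvPolynomial.aeval (fun x => τ ^ ((g x).2 : ℕ) • y (g x).1) R := by
  rw [specialize, ← AlgHom.comp_apply, MvPolynomial.comp_aeval]
  congr 2
  funext x
  simp [Algebra.smul_def]

variable [NeZero n]

theorem map_points_eq_sum_arcPoints {ι : Type} [Fintype ι] {A : ι → Arc n} (g : Var k ≃ Pos A)
    (hg : ∀ x, (g x).color = x.1) {L : Type} [Field L] [Algebra BaseField L] (y : ι → L) :
    (univ : Finset (Var k)).val.map (fun x => (x.1, τ ^ ((g x).2 : ℕ) • y (g x).1)) =
      ∑ s, arcPoints (A s) (y s) := by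
  have h1 : (fun x => (x.1, τ ^ ((g x).2 : ℕ) • y (g x).1)) =
      fun x : Var k => (fun p : Pos A => (p.color, τ ^ (p.2 : ℕ) • y p.1)) (g x) := by
    funext x
    simp only [hg]
  rw [h1, map_univ_comp_equiv g (fun p : Pos A => (p.color, τ ^ (p.2 : ℕ) • y p.1)),
    map_univ_sigma]
  refine Finset.sum_congr rfl fun s _ => ?_
  exact map_univ_fin _ (fun a : ℕ => ((A s).start + (a : ZMod n), τ ^ a • y s))

variable (k) in
/-- The partitions of `k` into arcs. -/
abbrev ArcPartition : Type := {ρ : Multiset (Arc n) // (ρ.map Arc.degree).sum = k}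

/-- An enumeration of the arcs of a partition. -/
noncomputable def ArcPartition.arcs (ρ : ArcPartition k) : Fin (Multiset.card ρ.1) → Arc n :=
  (exists_enumeration ρ.1).choose

theorem ArcPartition.map_arcs (ρ : ArcPartition k) :
    (univ : Finset (Fin (Multiset.card ρ.1))).val.map ρ.arcs = ρ.1 :=
  (exists_enumeration ρ.1).choose_spec

theorem ArcPartition.sum_degree (ρ : ArcPartition k) : ∑ s, (ρ.arcs s).degree = k := by
  have := ρ.2
  nth_rewrite 1 [← ρ.map_arcs] at this
  rwa [Multiset.map_map] at this

/-- The variables as positions of the arcs of a partition. -/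
noncomputable def ArcPartition.posEquiv (ρ : ArcPartition k) : Var k ≃ Pos ρ.arcs :=
  (exists_posEquiv ρ.arcs ρ.sum_degree).choose

theorem ArcPartition.color_posEquiv (ρ : ArcPartition k) (x : Var k) :
    (ρ.posEquiv x).color = x.1 :=
  (exists_posEquiv ρ.arcs ρ.sum_degree).choose_spec x

theorem ArcPartition.exists_base_points (ρ : ArcPartition k) {L : Type}
    (P : Multiset (Arc n × L)) (hP : P.map Prod.fst = ρ.1) :
    ∃ y : Fin (Multiset.card ρ.1) → L,
      (univ : Finset (Fin (Multiset.card ρ.1))).val.map (fun s => (ρ.arcs s, y s)) = P := by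
  obtain ⟨f, hf⟩ := exists_enumeration P
  have h1 : (univ : Finset (Fin (Multiset.card ρ.1))).val.map ρ.arcs =
      (univ : Finset (Fin (Multiset.card P))).val.map fun j => (f j).1 := by
    rw [ρ.map_arcs, ← hP]
    nth_rewrite 1 [← hf]
    rw [Multiset.map_map]
    rfl
  obtain ⟨e, he⟩ := exists_equiv_of_map_univ_eq h1
  refine ⟨fun s => (f (e s)).2, ?_⟩
  have h2 : (fun s => (ρ.arcs s, (f (e s)).2)) = fun s => f (e s) := by
    funext s
    rw [← he]
  rw [h2, map_univ_comp_equiv e, hf]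

variable {m : ZMod n → ℚ} {d : ℤ} {M : ℕ}

/-- By symmetry, vanishing at ρ does not depend on the chosen enumerations: R vanishes at any point
whose colored values can be grouped into arcs of the types in ρ. -/
theorem aeval_eq_zero_of_specialize_eq_zero {R : MvPolynomial (Var k) BaseField}
    (hR : R ∈ polyPiece m k d M) (ρ : ArcPartition k) (h0 : specialize ρ.posEquiv R = 0)
    {L : Type} [Field L] [Algebra BaseField L] (P : Multiset (Arc n × L))
    (hP : P.map Prod.fst = ρ.1) (v : Var k → L)
    (hv : (univ : Finset (Var k)).val.map (fun x => (x.1, v x)) =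
      (P.map fun p => arcPoints p.1 p.2).sum) :
    MvPolynomial.aeval v R = 0 := by
  obtain ⟨y, hy⟩ := ρ.exists_base_points P hP
  have h1 : (P.map fun p => arcPoints p.1 p.2).sum = ∑ s, arcPoints (ρ.arcs s) (y s) := by
    nth_rewrite 1 [← hy]
    rw [Multiset.map_map]
    rfl
  rw [hR.1 L v _ (hv.trans (h1.trans (map_points_eq_sum_arcPoints ρ.posEquiv ρ.color_posEquiv
    y).symm)), ← aeval_specialize, h0, map_zero]

/-- Any point is a union of arcs of length one; this is applied to the generic point z. -/
theorem eq_zero_of_forall_specialize_eq_zero {R : MvPolynomial (Var k) BaseField}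
    (hR : R ∈ polyPiece m k d M) (h0 : ∀ ρ : ArcPartition k, specialize ρ.posEquiv R = 0) :
    R = 0 := by
  apply aeval_z_injective
  rw [map_zero]
  set P : Multiset (Arc n × RatField k) :=
    (univ : Finset (Var k)).val.map fun x => ((⟨x.1, 1⟩ : Arc n), z x) with hP
  have hdeg : ∀ i : ZMod n, (⟨i, 1⟩ : Arc n).degree = Pi.single i 1 := by
    intro i
    simp [Arc.degree]
  have hk : ((P.map Prod.fst).map Arc.degree).sum = k := by
    rw [hP, Multiset.map_map, Multiset.map_map]
    change ∑ x : Var k, (⟨x.1, 1⟩ : Arc n).degree = k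
    simp only [hdeg]
    rw [sum_sigma_var]
    funext j
    simp [Finset.sum_apply, Pi.single_apply]
  refine aeval_eq_zero_of_specialize_eq_zero hR ⟨P.map Prod.fst, hk⟩ (h0 _) P rfl z ?_
  rw [hP, Multiset.map_map]
  have h1 : ∀ x : Var k, arcPoints (⟨x.1, 1⟩ : Arc n) (z x) = {(x.1, z x)} := by
    intro x
    simp [arcPoints]
  simp only [Function.comp_apply, h1]
  rw [← Multiset.bind_singleton]
  rfl

/-- The arcs obtained from `[0; l)` and `[c; c + l')` by exchanging their end points. -/
def crossedArcs (A A' : Arc n) (c : ℕ) : Multiset (Arc n) :=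
  {⟨A.start, ⟨c + A'.length, Nat.add_pos_right c A'.length.pos⟩⟩} +
    if h : c < A.length then {⟨A'.start, ⟨A.length - c, Nat.sub_pos_of_lt h⟩⟩} else 0

theorem range_add_map_range {c l l' : ℕ} (h1 : c ≤ l) :
    Multiset.range (c + l') + (Multiset.range (l - c)).map (c + ·) =
      Multiset.range l + (Multiset.range l').map (c + ·) := by
  have h3 := Multiset.range_add c (l - c)
  have h4 := Multiset.range_add c l'
  rw [Nat.add_sub_cancel' h1] at h3
  rw [h3, h4]
  ac_rfl

/-- On the line through y the arcs occupy the intervals [0, l) and [c, c + l'); exchanging right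
ends gives [0, c + l') and [c, l), with the same points and multiplicities. The second interval is
empty when c = l, which is plain concatenation. -/
theorem exists_arcPoints_crossed {L : Type} [Field L] [Algebra BaseField L] {A A' : Arc n} {c : ℕ}
    (hc : A'.start = A.start + c) (h1 : c ≤ A.length) (y : L) :
    ∃ P : Multiset (Arc n × L), P.map Prod.fst = crossedArcs A A' c ∧
      (P.map fun p => arcPoints p.1 p.2).sum = arcPoints A y + arcPoints A' (τ ^ c • y) := by
  refine ⟨{(⟨A.start, ⟨c + A'.length, Nat.add_pos_right c A'.length.pos⟩⟩, y)} +
    if h : c < A.length then {(⟨A'.start, ⟨A.length - c, Nat.sub_pos_of_lt h⟩⟩, τ ^ c • y)} else 0,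
    ?_, ?_⟩
  · rw [crossedArcs]
    split_ifs <;> simp
  · set F : ℕ → ZMod n × L := fun a => (A.start + (a : ZMod n), τ ^ a • y) with hF
    have h3 : ∀ l : ℕ, (Multiset.range l).map
        (fun a => (A'.start + ((a : ℕ) : ZMod n), τ ^ a • τ ^ c • y)) =
        ((Multiset.range l).map (c + ·)).map F := by
      intro l
      rw [Multiset.map_map]
      refine Multiset.map_congr rfl fun a _ => ?_
      simp only [hF, Function.comp_apply, hc, smul_smul, ← pow_add, Nat.cast_add]
      rw [add_assoc, Nat.add_comm a c]
    have h4 := congrArg (Multiset.map F) (range_add_map_range (l' := A'.length) h1)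
    rw [Multiset.map_add, Multiset.map_add] at h4
    have h5 : arcPoints A y + arcPoints A' (τ ^ c • y) = (Multiset.range A.length).map F +
        ((Multiset.range A'.length).map (c + ·)).map F := by
      rw [← h3]
      rfl
    rw [h5, ← h4, ← h3]
    split_ifs with h
    · simp [arcPoints, hF]
    · have : (A.length : ℕ) - c = 0 := by omega
      simp [arcPoints, hF, this]

/-- With l = c + x, the weight grows by 2c(l' - x), and x < l' by the last hypothesis. -/
theorem weight_crossedArcs_gt {A A' : Arc n} {c : ℕ} (h0 : 0 < c) (h1 : c ≤ A.length)
    (h2 : (A.length : ℕ) < c + A'.length) :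
    (A.length : ℕ) ^ 2 + (A'.length : ℕ) ^ 2 < weight (crossedArcs A A' c) := by
  have h3 : weight (crossedArcs A A' c) =
      (c + A'.length : ℕ) ^ 2 + ((A.length : ℕ) - c) ^ 2 := by
    rw [weight, crossedArcs]
    split_ifs with h
    · simp
    · have : (A.length : ℕ) - c = 0 := by omega
      simp [this]
  rw [h3]
  obtain ⟨x, hx⟩ := Nat.exists_eq_add_of_le h1
  rw [hx, Nat.add_sub_cancel_left]
  rw [hx] at h2
  nlinarith

theorem color_count_arcPoints {L : Type} [Field L] [Algebra BaseField L] (A : Arc n) (y : L)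
    (i : ZMod n) : ((arcPoints A y).map Prod.fst).count i = A.degree i := by
  rw [arcPoints, Multiset.map_map, Multiset.count_map, Arc.degree_apply, Finset.card_def,
    Finset.filter_val]
  simp only [Function.comp_apply, eq_comm]
  rfl

theorem sum_degree_eq_of_points {L : Type} [Field L] [Algebra BaseField L]
    {P : Multiset (Arc n × L)} {v : Var k → L}
    (hv : (univ : Finset (Var k)).val.map (fun x => (x.1, v x)) =
      (P.map fun p => arcPoints p.1 p.2).sum) :
    ((P.map Prod.fst).map Arc.degree).sum = k := by
  funext i
  have h1 := congrArg (fun S => (S.map Prod.fst).count i) hv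
  simp only [Multiset.map_map, Function.comp_apply] at h1
  have h2 : Multiset.count i ((univ : Finset (Var k)).val.map fun x => x.1) = k i := by
    rw [map_univ_sigma, Multiset.count_sum']
    have h1 : ∀ j : ZMod n, Multiset.count i ((univ : Finset (Fin (k j))).val.map fun _ => j) =
        if i = j then k j else 0 := by
      intro j
      rw [Multiset.map_const', Multiset.count_replicate]
      simp [eq_comm]
    simp only [h1, Finset.sum_ite_eq, Finset.mem_univ, if_true]
  rw [h2] at h1
  rw [h1]
  clear hv h1 h2
  induction P using Multiset.induction_on with
  | empty => simp
  | cons p P ih =>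
    simp only [Multiset.map_cons, Multiset.sum_cons, Pi.add_apply, Multiset.map_add,
      Multiset.count_add, color_count_arcPoints, ih]

/-- After crossing, the same point is seen to come from a partition of weight greater than w, where
R vanishes. -/
theorem aeval_eq_zero_of_crossing {R : MvPolynomial (Var k) BaseField}
    (hR : R ∈ polyPiece m k d M) {w : ℕ}
    (h0 : ∀ ρ : ArcPartition k, w < weight ρ.1 → specialize ρ.posEquiv R = 0)
    {L : Type} [Field L] [Algebra BaseField L] {A A' : Arc n} {S : Multiset (Arc n × L)}
    (hw : w = (A.length : ℕ) ^ 2 + (A'.length : ℕ) ^ 2 + weight (S.map Prod.fst))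
    {c : ℕ} (hc : A'.start = A.start + c) (h1 : 0 < c) (h2 : c ≤ A.length)
    (h3 : (A.length : ℕ) < c + A'.length) (y : L) {v : Var k → L}
    (hv : (univ : Finset (Var k)).val.map (fun x => (x.1, v x)) =
      arcPoints A y + arcPoints A' (τ ^ c • y) + (S.map fun p => arcPoints p.1 p.2).sum) :
    MvPolynomial.aeval v R = 0 := by
  obtain ⟨P, hP, hP'⟩ := exists_arcPoints_crossed hc h2 y
  have hv' : (univ : Finset (Var k)).val.map (fun x => (x.1, v x)) =
      ((P + S).map fun p => arcPoints p.1 p.2).sum := by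
    rw [hv, Multiset.map_add, Multiset.sum_add, hP']
  refine aeval_eq_zero_of_specialize_eq_zero hR
    ⟨(P + S).map Prod.fst, sum_degree_eq_of_points hv'⟩ (h0 _ ?_) (P + S) rfl v hv'
  change w < weight ((P + S).map Prod.fst)
  rw [Multiset.map_add, hP, weight, Multiset.map_add, Multiset.sum_add, hw]
  exact Nat.add_lt_add_right (weight_crossedArcs_gt h1 h2 h3) _

end Specialization

/-! ### Linear factors attached to adjacent pairs; those coming from the wheel conditions. -/

section Divisor

set_option linter.unusedSectionVars false

variable {n : ℕ}

/-- The pairs of points of adjacent colors of two arcs. An element `(ε, a, b)` stands for the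
`a`-th point of `A` and the `b`-th point of `A'`, the color of the first being the color of the
second one plus `1` if `ε` is true, and minus `1` if `ε` is false. -/
def adjacentPairs (A A' : Arc n) : Finset (Bool × ℕ × ℕ) :=
  (univ ×ˢ range A.length ×ˢ range A'.length).filter fun p =>
    if p.1 then A.start + (p.2.1 : ZMod n) = A'.start + (p.2.2 : ZMod n) + 1
    else A.start + (p.2.1 : ZMod n) + 1 = A'.start + (p.2.2 : ZMod n)

/-- The adjacent pairs that involve an end of the arc `A`. -/
def IsEndPair (A : Arc n) (p : Bool × ℕ × ℕ) : Prop :=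
  if p.1 then p.2.1 = 0 else p.2.1 + 1 = A.length

instance (A : Arc n) : DecidablePred (IsEndPair A) := fun p => by
  unfold IsEndPair
  infer_instance

/-- The exponent of `q` in the zero attached to an adjacent pair. -/
def qExp (A : Arc n) (p : Bool × ℕ × ℕ) : ℤ :=
  if IsEndPair A p then 0 else if p.1 then 2 else -2

/-- The position on the line of `A` of the zero attached to an adjacent pair. -/
def shiftExp (p : Bool × ℕ × ℕ) : ℤ := if p.1 then p.2.1 - 1 else p.2.1 + 1

/-- The zero attached to an adjacent pair. -/
noncomputable def ratio (A : Arc n) (p : Bool × ℕ × ℕ) : BaseField :=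
  q ^ qExp A p * τ ^ (shiftExp p - p.2.2)

theorem ratio_ne_zero (A : Arc n) (p : Bool × ℕ × ℕ) : ratio A p ≠ 0 :=
  mul_ne_zero (zpow_ne_zero _ q_ne_zero) (zpow_ne_zero _ τ_ne_zero)

variable {ι : Type}

/-- The product of the linear forms attached to the adjacent pairs of two arcs of a family. -/
noncomputable def pairPoly (A : ι → Arc n) (s s' : ι) : MvPolynomial ι BaseField :=
  ∏ p ∈ adjacentPairs (A s) (A s'), linForm s s' (ratio (A s) p)

theorem mem_adjacentPairs {A A' : Arc n} {p : Bool × ℕ × ℕ} :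
    p ∈ adjacentPairs A A' ↔ (p.2.1 < A.length ∧ p.2.2 < A'.length) ∧
      if p.1 then A.start + (p.2.1 : ZMod n) = A'.start + (p.2.2 : ZMod n) + 1
      else A.start + (p.2.1 : ZMod n) + 1 = A'.start + (p.2.2 : ZMod n) := by
  simp only [adjacentPairs, Finset.mem_filter, Finset.mem_product, Finset.mem_univ, true_and,
    Finset.mem_range]

variable [NeZero n] {k : ZMod n → ℕ} {m : ZMod n → ℚ} {d : ℤ} {M : ℕ}

section Wheel

variable {A : ι → Arc n} [DecidableEq ι]

/-- The specialization of the variables at the positions of all arcs but `s'`. -/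
noncomputable def partialSpecialize (g : Var k ≃ Pos A) (s' : ι) :
    MvPolynomial (Var k) BaseField →ₐ[BaseField] MvPolynomial (ι ⊕ ℕ) BaseField :=
  MvPolynomial.aeval fun x => if (g x).1 = s' then MvPolynomial.X (Sum.inr ((g x).2 : ℕ))
    else MvPolynomial.C (τ ^ ((g x).2 : ℕ)) * MvPolynomial.X (Sum.inl (g x).1)

/-- The specialization of the variables at the positions of the arc `s'`. -/
noncomputable def completeSpecialize (s' : ι) :
    MvPolynomial (ι ⊕ ℕ) BaseField →ₐ[BaseField] MvPolynomial ι BaseField :=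
  MvPolynomial.aeval (Sum.elim MvPolynomial.X
    fun b => MvPolynomial.C (τ ^ b) * MvPolynomial.X s')

theorem completeSpecialize_partialSpecialize (g : Var k ≃ Pos A) (s' : ι)
    (R : MvPolynomial (Var k) BaseField) :
    completeSpecialize s' (partialSpecialize g s' R) = specialize g R := by
  rw [partialSpecialize, ← AlgHom.comp_apply, MvPolynomial.comp_aeval, specialize]
  congr 2
  funext x
  split_ifs with h
  · simp [completeSpecialize, h]
  · simp [completeSpecialize]

/-- The a-th point of s has on s a neighbor of the same color as the b-th point of s': its
predecessor if ε is true, its successor if ε is false. The three points form a wheel when the point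
of s' is q² times the predecessor, respectively q⁻² times the successor; this explains `qExp` and
`shiftExp`. -/
theorem linForm_dvd_partialSpecialize {R : MvPolynomial (Var k) BaseField}
    (hR : R ∈ polyPiece m k d M) (g : Var k ≃ Pos A) (hg : ∀ x, (g x).color = x.1) {s s' : ι}
    (hs : s ≠ s') {p : Bool × ℕ × ℕ} (hp : p ∈ adjacentPairs (A s) (A s'))
    (hp' : ¬ IsEndPair (A s) p) :
    linForm (Sum.inl s) (Sum.inr p.2.2) (q ^ qExp (A s) p * τ ^ shiftExp p) ∣
      partialSpecialize g s' R := by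
  refine linForm_dvd (by simp) ?_
  set c : BaseField := q ^ qExp (A s) p * τ ^ shiftExp p with hc
  set φ : ι ⊕ ℕ → MvPolynomial (ι ⊕ ℕ) BaseField := Function.update MvPolynomial.X
    (Sum.inr p.2.2) (MvPolynomial.C c * MvPolynomial.X (Sum.inl s)) with hφ
  apply IsFractionRing.injective (MvPolynomial (ι ⊕ ℕ) BaseField)
    (FractionRing (MvPolynomial (ι ⊕ ℕ) BaseField))
  rw [map_zero]
  set L := FractionRing (MvPolynomial (ι ⊕ ℕ) BaseField)
  have h1 : algebraMap (MvPolynomial (ι ⊕ ℕ) BaseField) L (MvPolynomial.aeval φ (partialSpecialize g s' R)) =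
      (((IsScalarTower.toAlgHom BaseField (MvPolynomial (ι ⊕ ℕ) BaseField) L).comp
        (MvPolynomial.aeval φ)).comp (partialSpecialize g s')) R := rfl
  rw [h1, partialSpecialize, MvPolynomial.comp_aeval]
  set v : Var k → L := fun x => ((IsScalarTower.toAlgHom BaseField
    (MvPolynomial (ι ⊕ ℕ) BaseField) L).comp (MvPolynomial.aeval φ))
      (if (g x).1 = s' then MvPolynomial.X (Sum.inr ((g x).2 : ℕ))
    else MvPolynomial.C (τ ^ ((g x).2 : ℕ)) * MvPolynomial.X (Sum.inl (g x).1)) with hv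
  set Y : L := algebraMap (MvPolynomial (ι ⊕ ℕ) BaseField) L (MvPolynomial.X (Sum.inl s)) with hY
  have hY0 : Y ≠ 0 := by
    rw [hY, Ne, FaithfulSMul.algebraMap_eq_zero_iff]
    exact MvPolynomial.X_ne_zero _
  have hC : ∀ a : BaseField, algebraMap (MvPolynomial (ι ⊕ ℕ) BaseField) L (MvPolynomial.C a) =
      algebraMap BaseField L a := fun a => by
    rw [← MvPolynomial.algebraMap_eq, ← IsScalarTower.algebraMap_apply]
  have hvg : ∀ p : Pos A, v (g.symm p) = ((IsScalarTower.toAlgHom BaseField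
    (MvPolynomial (ι ⊕ ℕ) BaseField) L).comp (MvPolynomial.aeval φ))
      (if p.1 = s' then MvPolynomial.X (Sum.inr (p.2 : ℕ))
    else MvPolynomial.C (τ ^ (p.2 : ℕ)) * MvPolynomial.X (Sum.inl p.1)) := by
    intro p
    obtain ⟨x, rfl⟩ := g.surjective p
    rw [Equiv.symm_apply_apply]
  have hv1 : ∀ (a : ℕ) (ha : a < (A s).length), v (g.symm ⟨s, ⟨a, ha⟩⟩) = τ ^ a • Y := by
    intro a ha
    simp only [hvg, if_neg hs, hφ]
    simp [Algebra.smul_def, hY, hC]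
  have hv2 : ∀ hb : p.2.2 < (A s').length, v (g.symm ⟨s', ⟨p.2.2, hb⟩⟩) = c • Y := by
    intro hb
    simp only [hvg, if_true, hφ]
    simp [Algebra.smul_def, hY, hC]
  have hcol : ∀ (r : ι) (a : ℕ) (ha : a < (A r).length),
      (g.symm ⟨r, ⟨a, ha⟩⟩).1 = (A r).start + (a : ZMod n) := by
    intro r a ha
    rw [← hg, Equiv.apply_symm_apply]
    rfl
  have hneq : ∀ (a : ℕ) (ha : a < (A s).length) (b : ℕ) (hb : b < (A s').length),
      g.symm ⟨s, ⟨a, ha⟩⟩ ≠ g.symm ⟨s', ⟨b, hb⟩⟩ := by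
    intro a ha b hb h
    exact hs (congrArg Sigma.fst (g.symm.injective h))
  obtain ⟨⟨ha, hb⟩, hcond⟩ := mem_adjacentPairs.mp hp
  have hq := q_ne_zero
  have ht := t_ne_zero
  obtain ⟨ε, a, b⟩ := p
  simp only [IsEndPair] at hp'
  simp only at ha hb hcond hv2
  cases ε
  · simp only [Bool.false_eq_true, if_false] at hp' hcond
    have ha' : a + 1 < (A s).length := by omega
    have hc' : c = q⁻¹ * q⁻¹ * τ ^ (a + 1) := by
      have : ((a : ℤ) + 1) = ((a + 1 : ℕ) : ℤ) := by push_cast; ring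
      simp only [hc, qExp, IsEndPair, shiftExp, Bool.false_eq_true, if_false, hp', this,
        zpow_natCast]
      congr 1
      rw [zpow_neg, ← mul_inv, ← sq]
      norm_cast
    -- With this u, the successor is q u, the a-th point is τ^a Y = t⁻¹ u, and the point of s' is
    -- q⁻¹ u.
    refine hR.2.1 L v (q⁻¹ • τ ^ (a + 1) • Y) (g.symm ⟨s', ⟨b, hb⟩⟩) (g.symm ⟨s, ⟨a, ha⟩⟩)
      (g.symm ⟨s, ⟨a + 1, ha'⟩⟩) ?_ (hneq _ _ _ _).symm ?_ ?_ ?_ (Or.inr ⟨?_, ?_⟩)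
    · exact smul_ne_zero (inv_ne_zero hq) (smul_ne_zero (pow_ne_zero _ τ_ne_zero) hY0)
    · rw [hcol, hcol, ← hcond]
      push_cast
      ring
    · rw [hv2, hc', smul_smul, smul_smul, mul_assoc]
    · rw [hv1, smul_smul, mul_inv_cancel₀ hq, one_smul]
    · rw [hcol, hcol, ← hcond]
      ring
    · rw [hv1, smul_smul, smul_smul, pow_succ]
      congr 1
      rw [τ]
      field_simp
  · simp only [if_true] at hp' hcond
    obtain ⟨a, rfl⟩ := Nat.exists_eq_succ_of_ne_zero hp'
    have ha' : a < (A s).length := by omega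
    have hc' : c = q * q * τ ^ a := by
      have : ((a + 1 : ℕ) : ℤ) - 1 = (a : ℤ) := by push_cast; ring
      simp only [hc, qExp, IsEndPair, shiftExp, if_true, Nat.succ_eq_add_one, this,
        Nat.add_eq_zero_iff, one_ne_zero, and_false, if_false, zpow_natCast]
      congr 1
      rw [← sq]
      norm_cast
    have hcond' : (A s).start + (a : ZMod n) = (A s').start + (b : ZMod n) := by
      push_cast at hcond
      linear_combination hcond
    -- Here a is already the index of the predecessor, which is q⁻¹ u; its successor on s is t u and
    -- the point of s' is q u.
    refine hR.2.1 L v (q • τ ^ a • Y) (g.symm ⟨s, ⟨a, ha'⟩⟩) (g.symm ⟨s, ⟨a + 1, ha⟩⟩)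
      (g.symm ⟨s', ⟨b, hb⟩⟩) ?_ (hneq _ _ _ _) ?_ ?_ ?_ (Or.inl ⟨?_, ?_⟩)
    · exact smul_ne_zero hq (smul_ne_zero (pow_ne_zero _ τ_ne_zero) hY0)
    · rw [hcol, hcol, hcond']
    · rw [hv1, smul_smul, inv_mul_cancel₀ hq, one_smul]
    · rw [hv2, hc', smul_smul, smul_smul, mul_assoc]
    · rw [hcol, hcol]
      push_cast
      ring
    · rw [hv1, smul_smul, smul_smul, pow_succ]
      congr 1
      rw [τ]
      ring

/-- Pairs (ε, a, b) and (ε, a + 1, b + 1) can give the same linear form, so multiplicities matter.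
The points of s' are therefore kept as independent variables at first: forms with different b then
involve different variables, those with the same b have different constants, and the product
divides. The points of s' are put on one line only afterwards. -/
theorem prod_wheel_dvd_specialize {R : MvPolynomial (Var k) BaseField}
    (hR : R ∈ polyPiece m k d M) (g : Var k ≃ Pos A) (hg : ∀ x, (g x).color = x.1) {s s' : ι}
    (hs : s ≠ s') :
    ∏ p ∈ (adjacentPairs (A s) (A s')).filter (fun p => ¬ IsEndPair (A s) p),
      linForm s s' (ratio (A s) p) ∣ specialize g R := by
  have h1 : ∏ p ∈ (adjacentPairs (A s) (A s')).filter (fun p => ¬ IsEndPair (A s) p),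
      linForm (Sum.inl s) (Sum.inr p.2.2) (q ^ qExp (A s) p * τ ^ shiftExp p) ∣
        partialSpecialize g s' R := by
    refine Finset.prod_dvd_of_isRelPrime ?_ fun p hp => linForm_dvd_partialSpecialize hR g hg hs
      (Finset.mem_filter.mp hp).1 (Finset.mem_filter.mp hp).2
    intro p hp p' hp' hne
    have h2 := (Finset.mem_filter.mp hp).2
    have h2' := (Finset.mem_filter.mp hp').2
    by_cases hb : p.2.2 = p'.2.2
    · change IsRelPrime (linForm _ _ _) (linForm _ _ _)
      rw [← hb]
      refine linForm_isRelPrime_of_ne (by simp) fun h => hne ?_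
      obtain ⟨h3, h4⟩ := q_zpow_mul_τ_zpow_injective h
      simp only [qExp, h2, h2', if_false] at h3
      obtain ⟨ε, a, b⟩ := p
      obtain ⟨ε', a', b'⟩ := p'
      simp only [shiftExp] at *
      cases ε <;> cases ε' <;> simp_all
    · exact linForm_isRelPrime_of_pair_ne (by simp) (by simp) (by simp [Ne.symm hb]) (by simp) _
        (mul_ne_zero (zpow_ne_zero _ q_ne_zero) (zpow_ne_zero _ τ_ne_zero))
  have h2 := map_dvd (completeSpecialize s') h1
  rw [completeSpecialize_partialSpecialize, map_prod] at h2
  refine dvd_trans (Finset.prod_dvd_prod_of_dvd _ _ fun p _ => ?_) h2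
  -- The b-th variable becomes τ^b X_{s'}, which rescales the form by τ^b and divides its constant
  -- by τ^b.
  refine ⟨MvPolynomial.C (τ ^ p.2.2), ?_⟩
  rw [completeSpecialize, aeval_linForm, Sum.elim_inl, Sum.elim_inr, linForm, ratio, sub_mul,
    mul_comm (MvPolynomial.X s'), mul_right_comm, ← MvPolynomial.C_mul, MvPolynomial.algebraMap_eq]
  congr 3
  rw [zpow_sub₀ τ_ne_zero, zpow_natCast]
  have := pow_ne_zero p.2.2 τ_ne_zero
  field_simp

end Wheel

end Divisor

/-! ### Factors coming from the ends of arcs, and the product for a pair of arcs. -/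

section Divisibility

set_option linter.unusedSectionVars false

variable {n : ℕ} [NeZero n] {k : ZMod n → ℕ} {m : ZMod n → ℚ} {d : ℤ} {M : ℕ}
variable {ι : Type} [Fintype ι] [DecidableEq ι] {A : ι → Arc n}

/-- On the zero locus of the form, the b-th point of s' is one step beyond an end of s on the same
line and of the color that continues s. The two arcs can then be crossed, the assumption on the
lengths ensuring that the weight increases strictly. -/
theorem linForm_endPair_dvd_specialize {R : MvPolynomial (Var k) BaseField}
    (hR : R ∈ polyPiece m k d M)
    (h0 : ∀ ρ : ArcPartition k, weight ((univ : Finset ι).val.map A) < weight ρ.1 →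
      specialize ρ.posEquiv R = 0)
    (g : Var k ≃ Pos A) (hg : ∀ x, (g x).color = x.1) {s s' : ι} (hs : s ≠ s')
    (hlen : (A s').length ≤ (A s).length) {p : Bool × ℕ × ℕ}
    (hp : p ∈ adjacentPairs (A s) (A s')) (hp' : IsEndPair (A s) p) :
    linForm s s' (ratio (A s) p) ∣ specialize g R := by
  refine linForm_dvd hs ?_
  set c : BaseField := ratio (A s) p with hc
  set φ : ι → MvPolynomial ι BaseField := Function.update MvPolynomial.X
    s' (MvPolynomial.C c * MvPolynomial.X s) with hφ
  apply IsFractionRing.injective (MvPolynomial ι BaseField) (FractionRing (MvPolynomial ι BaseField))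
  rw [map_zero]
  set L := FractionRing (MvPolynomial ι BaseField)
  set y : ι → L := fun r => algebraMap (MvPolynomial ι BaseField) L (φ r) with hy
  have h1 : algebraMap (MvPolynomial ι BaseField) L (MvPolynomial.aeval φ (specialize g R)) =
      MvPolynomial.aeval y (specialize g R) := by
    have h2 : (MvPolynomial.aeval y : MvPolynomial ι BaseField →ₐ[BaseField] L) =
        (IsScalarTower.toAlgHom BaseField (MvPolynomial ι BaseField) L).comp
          (MvPolynomial.aeval φ) := by
      rw [MvPolynomial.comp_aeval]
      rfl
    rw [h2]
    rfl
  have hy' : y s' = c • y s := by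
    simp only [hy, hφ, Function.update_self, Function.update_of_ne hs, map_mul]
    rw [← MvPolynomial.algebraMap_eq, ← IsScalarTower.algebraMap_apply, Algebra.smul_def]
  rw [h1, aeval_specialize]
  set T : Finset ι := (univ.erase s).erase s' with hT
  have hs' : s' ∈ univ.erase s := Finset.mem_erase.mpr ⟨hs.symm, Finset.mem_univ _⟩
  have hsplit : ∀ {N : Type} [AddCommMonoid N] (f : ι → N),
      ∑ r, f r = f s + f s' + ∑ r ∈ T, f r := by
    intro N _ f
    rw [← Finset.add_sum_erase _ _ (Finset.mem_univ s), ← Finset.add_sum_erase _ _ hs', add_assoc]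
  set S : Multiset (Arc n × L) := T.val.map fun r => (A r, y r) with hS
  have hv := map_points_eq_sum_arcPoints g hg y
  rw [hsplit (fun r => arcPoints (A r) (y r))] at hv
  have hS1 : (S.map fun p => arcPoints p.1 p.2).sum = ∑ r ∈ T, arcPoints (A r) (y r) := by
    rw [hS, Multiset.map_map]
    rfl
  have hS2 : weight ((univ : Finset ι).val.map A) =
      ((A s).length : ℕ) ^ 2 + ((A s').length : ℕ) ^ 2 + weight (S.map Prod.fst) := by
    rw [weight, weight, hS, Multiset.map_map, Multiset.map_map, Multiset.map_map]
    exact hsplit fun r => ((A r).length : ℕ) ^ 2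
  rw [← hS1] at hv
  obtain ⟨⟨ha, hb⟩, hcond⟩ := mem_adjacentPairs.mp hp
  have hlen' : ((A s').length : ℕ) ≤ (A s).length := hlen
  obtain ⟨ε, a, b⟩ := p
  simp only [ratio, qExp, hp', if_true, zpow_zero, one_mul] at hc
  simp only [IsEndPair] at hp'
  simp only at ha hb hcond
  cases ε
  · simp only [Bool.false_eq_true, if_false] at hp' hcond
    have hc' : c = τ ^ ((A s).length - b : ℕ) := by
      rw [hc, ← zpow_natCast, shiftExp]
      congr 1
      simp only [Bool.false_eq_true, if_false]
      omega
    rw [hy', hc'] at hv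
    -- The b-th point of s' is at position l on the line of s, so s' starts at position l - b, which
    -- is positive because b < l' ≤ l.
    refine aeval_eq_zero_of_crossing hR h0 hS2 ?_ (c := (A s).length - b) (by omega) (by omega)
      (by omega) (y s) hv
    rw [Nat.cast_sub (by omega), ← hp']
    push_cast
    linear_combination -hcond
  · simp only [if_true] at hp' hcond
    subst hp'
    have hc' : y s = τ ^ (b + 1) • y s' := by
      rw [hy', smul_smul, hc, ← zpow_natCast, ← zpow_add₀ τ_ne_zero]
      simp only [shiftExp, if_true]
      rw [show ((b + 1 : ℕ) : ℤ) + (((0 : ℕ) : ℤ) - 1 - b) = 0 by push_cast; ring, zpow_zero,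
        one_smul]
    -- The b-th point of s' immediately precedes s, so the roles are exchanged: s starts at position
    -- b + 1 on the line of s'.
    rw [add_comm (arcPoints (A s) _), hc'] at hv
    refine aeval_eq_zero_of_crossing hR h0 (hS2.trans (by ring)) ?_ (c := b + 1) (by omega)
      (by omega) (by have := (A s).length.pos; omega) (y s') hv
    push_cast at hcond ⊢
    linear_combination hcond

/-- End factors carry q⁰ and the others q^{±2}, so the two products are coprime. End factors are
simple: their exponents of τ are l - b > 0 when ε is false and -1 - b < 0 when ε is true, hence
determine the pair. -/
theorem pairPoly_dvd_specialize {R : MvPolynomial (Var k) BaseField}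
    (hR : R ∈ polyPiece m k d M)
    (h0 : ∀ ρ : ArcPartition k, weight ((univ : Finset ι).val.map A) < weight ρ.1 →
      specialize ρ.posEquiv R = 0)
    (g : Var k ≃ Pos A) (hg : ∀ x, (g x).color = x.1) {s s' : ι} (hs : s ≠ s')
    (hlen : (A s').length ≤ (A s).length) : pairPoly A s s' ∣ specialize g R := by
  have hlen' : ((A s').length : ℕ) ≤ (A s).length := hlen
  rw [pairPoly, ← Finset.prod_filter_mul_prod_filter_not _ (IsEndPair (A s))]
  refine IsRelPrime.mul_dvd ?_ ?_ (prod_wheel_dvd_specialize hR g hg hs)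
  · refine IsRelPrime.prod_left fun p hp => IsRelPrime.prod_right fun p' hp' => ?_
    refine linForm_isRelPrime_of_ne hs fun h => ?_
    obtain ⟨h3, _⟩ := q_zpow_mul_τ_zpow_injective h
    simp only [qExp, (Finset.mem_filter.mp hp).2, (Finset.mem_filter.mp hp').2, if_true,
      if_false] at h3
    split_ifs at h3
    all_goals omega
  · refine Finset.prod_dvd_of_isRelPrime (fun p hp p' hp' hne => ?_) fun p hp =>
      linForm_endPair_dvd_specialize hR h0 g hg hs hlen (Finset.mem_filter.mp hp).1
        (Finset.mem_filter.mp hp).2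
    refine linForm_isRelPrime_of_ne hs fun h => hne ?_
    obtain ⟨_, h3⟩ := q_zpow_mul_τ_zpow_injective h
    obtain ⟨h4, h5⟩ := Finset.mem_filter.mp hp
    obtain ⟨h4', h5'⟩ := Finset.mem_filter.mp hp'
    obtain ⟨⟨h6, h7⟩, _⟩ := mem_adjacentPairs.mp h4
    obtain ⟨⟨h6', h7'⟩, _⟩ := mem_adjacentPairs.mp h4'
    obtain ⟨ε, a, b⟩ := p
    obtain ⟨ε', a', b'⟩ := p'
    simp only [IsEndPair, shiftExp] at *
    cases ε <;> cases ε' <;> simp only [if_true, if_false, Bool.false_eq_true] at *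
    · simp only [Prod.mk.injEq, true_and]; omega
    · omega
    · omega
    · simp only [Prod.mk.injEq, true_and]; omega

end Divisibility

/-! ### The divisor of a family of arcs and its symmetry. -/

section Total

variable {n : ℕ} {N : ℕ}

/-- The pairs of arcs of a family, the first one being at least as long as the second one. -/
def orderedPairs (A : Fin N → Arc n) : Finset (Fin N × Fin N) :=
  univ.filter fun p => (A p.2).length < (A p.1).length ∨
    (A p.1).length = (A p.2).length ∧ p.1 < p.2

/-- The common divisor of the specializations to a family of arcs. -/
noncomputable def divisor (A : Fin N → Arc n) : MvPolynomial (Fin N) BaseField :=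
  ∏ p ∈ orderedPairs A, pairPoly A p.1 p.2

theorem mem_orderedPairs {A : Fin N → Arc n} {p : Fin N × Fin N} :
    p ∈ orderedPairs A ↔ (A p.2).length < (A p.1).length ∨
      (A p.1).length = (A p.2).length ∧ p.1 < p.2 := by
  simp [orderedPairs]

theorem ne_of_mem_orderedPairs {A : Fin N → Arc n} {p : Fin N × Fin N}
    (h : p ∈ orderedPairs A) : p.1 ≠ p.2 := by
  intro h2
  rw [mem_orderedPairs, h2] at h
  simp at h

theorem swap_mem_orderedPairs_iff {A : Fin N → Arc n} {s s' : Fin N} (h : s ≠ s') :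
    (s', s) ∈ orderedPairs A ↔ (s, s') ∉ orderedPairs A := by
  simp only [mem_orderedPairs]
  rcases lt_trichotomy (A s).length (A s').length with h1 | h1 | h1
  · simp [h1, h1.ne, not_lt.mpr h1.le]
  · simp [h1]
    omega
  · simp [h1, h1.ne, h1.ne', not_lt.mpr h1.le]

/-- Factors from different unordered pairs of arcs involve different pairs of variables, hence are
coprime. -/
theorem divisor_dvd_specialize [NeZero n] {k : ZMod n → ℕ} {m : ZMod n → ℚ} {d : ℤ} {M : ℕ}
    {R : MvPolynomial (Var k) BaseField} (hR : R ∈ polyPiece m k d M) (ρ : ArcPartition k)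
    (h0 : ∀ ρ' : ArcPartition k, weight ρ.1 < weight ρ'.1 → specialize ρ'.posEquiv R = 0) :
    divisor ρ.arcs ∣ specialize ρ.posEquiv R := by
  refine Finset.prod_dvd_of_isRelPrime (fun p hp p' hp' hne => ?_) fun p hp =>
    pairPoly_dvd_specialize hR (by rwa [ρ.map_arcs]) _ ρ.color_posEquiv
      (ne_of_mem_orderedPairs hp) ?_
  · refine IsRelPrime.prod_left fun x _ => IsRelPrime.prod_right fun x' _ => ?_
    refine linForm_isRelPrime_of_pair_ne (ne_of_mem_orderedPairs hp) (ne_of_mem_orderedPairs hp')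
      (fun h => hne (Prod.ext h.1.symm h.2.symm)) (fun h => ?_) _ (ratio_ne_zero _ _)
    have h2 : p' = (p.2, p.1) := Prod.ext h.1 h.2
    rw [h2] at hp'
    exact (swap_mem_orderedPairs_iff (ne_of_mem_orderedPairs hp)).mp hp' hp
  · rcases mem_orderedPairs.mp hp with h | h
    · exact h.le
    · exact h.1.symm.le

theorem pairPoly_ne_zero {ι : Type} (A : ι → Arc n) {s s' : ι} (h : s ≠ s') :
    pairPoly A s s' ≠ 0 :=
  Finset.prod_ne_zero_iff.mpr fun _ _ => linForm_ne_zero h _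

theorem divisor_ne_zero (A : Fin N → Arc n) : divisor A ≠ 0 :=
  Finset.prod_ne_zero_iff.mpr fun _ hp => pairPoly_ne_zero A (ne_of_mem_orderedPairs hp)

/-- Exchanging the two arcs of an adjacent pair. -/
def swapPair (l : ℕ) (p : Bool × ℕ × ℕ) : Bool × ℕ × ℕ := (!p.1, l - 1 - p.2.1, l - 1 - p.2.2)

/-- The starting colors stay in place while both positions are reversed, which changes the sign of
the color difference between the positions. -/
theorem swapPair_mem {A A' : Arc n} (h : A.length = A'.length) {p : Bool × ℕ × ℕ}
    (hp : p ∈ adjacentPairs A A') : swapPair A.length p ∈ adjacentPairs A' A := by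
  rw [mem_adjacentPairs] at hp ⊢
  obtain ⟨⟨h1, h2⟩, h3⟩ := hp
  rw [← h] at h2 ⊢
  obtain ⟨ε, a, b⟩ := p
  simp only [swapPair] at *
  refine ⟨⟨by omega, by omega⟩, ?_⟩
  have e1 : ((((A.length : ℕ) - 1 - a : ℕ)) : ZMod n) = (A.length : ℕ) - 1 - a := by
    rw [Nat.cast_sub (by omega), Nat.cast_sub (by omega)]
    simp
  have e2 : ((((A.length : ℕ) - 1 - b : ℕ)) : ZMod n) = (A.length : ℕ) - 1 - b := by
    rw [Nat.cast_sub (by omega), Nat.cast_sub (by omega)]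
    simp
  rw [e1, e2]
  cases ε
  · simp only [Bool.not_false, if_true, Bool.false_eq_true, if_false] at *
    linear_combination -h3
  · simp only [Bool.not_true, if_true, Bool.false_eq_true, if_false] at *
    linear_combination -h3

/-- Reversing the positions carries the first point of one arc to the last point of the other, so
end pairs go to end pairs; merely exchanging a and b would not respect them. -/
theorem ratio_swapPair {A A' : Arc n} (h : A.length = A'.length) {p : Bool × ℕ × ℕ}
    (hp : p ∈ adjacentPairs A A') : ratio A' (swapPair A.length p) = (ratio A p)⁻¹ := by
  obtain ⟨⟨h1, h2⟩, _⟩ := mem_adjacentPairs.mp hp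
  rw [← h] at h2
  rw [ratio, ratio, mul_inv, ← zpow_neg, ← zpow_neg]
  congr 2
  · obtain ⟨ε, a, b⟩ := p
    simp only [qExp, IsEndPair, swapPair] at *
    have h' : (A.length : ℕ) = A'.length := by rw [h]
    cases ε <;> simp <;> split_ifs <;> omega
  · obtain ⟨ε, a, b⟩ := p
    simp only [shiftExp, swapPair] at *
    cases ε <;> simp <;> omega

theorem associated_pairPoly_swap {ι : Type} (A : ι → Arc n) {s s' : ι}
    (h : (A s).length = (A s').length) : Associated (pairPoly A s s') (pairPoly A s' s) := by
  have h1 : pairPoly A s' s =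
      ∏ p ∈ adjacentPairs (A s) (A s'), linForm s' s (ratio (A s) p)⁻¹ := by
    symm
    refine Finset.prod_bij' (fun p _ => swapPair (A s).length p)
      (fun p _ => swapPair (A s).length p) (fun p hp => swapPair_mem h hp)
      (fun p hp => by rw [h]; exact swapPair_mem h.symm hp) (fun p hp => ?_) (fun p hp => ?_)
      fun p hp => by rw [ratio_swapPair h hp]
    · obtain ⟨⟨h1, h2⟩, _⟩ := mem_adjacentPairs.mp hp
      rw [← h] at h2
      obtain ⟨ε, a, b⟩ := p
      simp only [swapPair, Bool.not_not, Prod.mk.injEq, true_and] at *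
      omega
    · obtain ⟨⟨h1, h2⟩, _⟩ := mem_adjacentPairs.mp hp
      rw [← h] at h1
      obtain ⟨ε, a, b⟩ := p
      simp only [swapPair, Bool.not_not, Prod.mk.injEq, true_and] at *
      omega
  rw [h1, pairPoly]
  exact Associated.prod _ _ _ fun p _ => associated_linForm_swap s s' (ratio_ne_zero _ _)

theorem rename_pairPoly {ι : Type} (A : ι → Arc n) (σ : Equiv.Perm ι) (hσ : ∀ s, A (σ s) = A s)
    (s s' : ι) : MvPolynomial.rename σ (pairPoly A s s') = pairPoly A (σ s) (σ s') := by
  rw [pairPoly, pairPoly, map_prod, hσ, hσ]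
  simp only [rename_linForm]

/-- A permutation preserving the arcs permutes the unordered pairs. It reverses the order of a pair
only if the two lengths agree, and then the factor changes by a unit. -/
theorem associated_rename_divisor (A : Fin N → Arc n) (σ : Equiv.Perm (Fin N))
    (hσ : ∀ s, A (σ s) = A s) : Associated (MvPolynomial.rename σ (divisor A)) (divisor A) := by
  rw [divisor, map_prod]
  simp only [rename_pairPoly A σ hσ]
  rw [← Associates.mk_eq_mk_iff_associated, ← Associates.finsetProd_mk, ← Associates.finsetProd_mk]
  have key : ∀ (σ : Equiv.Perm (Fin N)), (∀ s, A (σ s) = A s) → ∀ p ∈ orderedPairs A,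
      (σ p.1, σ p.2) ∉ orderedPairs A → (A p.1).length = (A p.2).length := by
    intro σ hσ p hp h
    rw [mem_orderedPairs] at hp h
    simp only [hσ] at h
    grind
  set Φ : Equiv.Perm (Fin N) → Fin N × Fin N → Fin N × Fin N := fun σ p =>
    if (σ p.1, σ p.2) ∈ orderedPairs A then (σ p.1, σ p.2) else (σ p.2, σ p.1) with hΦ
  have hmem : ∀ σ : Equiv.Perm (Fin N), ∀ p ∈ orderedPairs A, Φ σ p ∈ orderedPairs A := by
    intro σ p hp
    simp only [hΦ]
    split_ifs with h
    · exact h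
    · exact (swap_mem_orderedPairs_iff (σ.injective.ne (ne_of_mem_orderedPairs hp))).mpr h
  have hinv : ∀ σ : Equiv.Perm (Fin N), ∀ p ∈ orderedPairs A, Φ σ.symm (Φ σ p) = p := by
    intro σ p hp
    simp only [hΦ]
    split_ifs with h h2 h2
    · simp
    · simp only [Equiv.symm_apply_apply] at h2
      exact absurd hp h2
    · simp only [Equiv.symm_apply_apply] at h2
      exact absurd hp ((swap_mem_orderedPairs_iff (ne_of_mem_orderedPairs hp)).mp h2)
    · simp
  refine Finset.prod_bij' (fun p _ => Φ σ p) (fun p _ => Φ σ.symm p) (hmem σ) (hmem σ.symm)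
    (hinv σ) (fun p hp => hinv σ.symm p hp) fun p hp => ?_
  simp only [hΦ]
  split_ifs with h
  · rfl
  · rw [Associates.mk_eq_mk_iff_associated]
    refine associated_pairPoly_swap A ?_
    rw [hσ, hσ]
    exact key σ hσ p hp h

end Total

/-! ### Degrees of the divisor. -/

section Degrees

variable {n : ℕ} [NeZero n]

/-- The number of pairs of points of adjacent colors. -/
def adjForm (b b' : ZMod n → ℕ) : ℤ := ∑ i, (b i : ℤ) * (b' (i + 1) + b' (i - 1))

theorem sum_mul_shift_comm (f g : ZMod n → ℤ) :
    ∑ i, f i * g (i - 1) = ∑ i, g i * f (i + 1) := by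
  rw [← Equiv.sum_comp (Equiv.addRight (1 : ZMod n))]
  exact Finset.sum_congr rfl fun i _ => by simp [mul_comm]

theorem adjForm_comm (b b' : ZMod n → ℕ) : adjForm b b' = adjForm b' b := by
  simp only [adjForm, mul_add, Finset.sum_add_distrib]
  rw [sum_mul_shift_comm (fun i => (b i : ℤ)) fun i => (b' i : ℤ),
    sum_mul_shift_comm (fun i => (b' i : ℤ)) fun i => (b i : ℤ), add_comm]

theorem adjForm_self (b : ZMod n → ℕ) : adjForm b b = 2 * ∑ i, (b i : ℤ) * b (i + 1) := by
  simp only [adjForm, mul_add, Finset.sum_add_distrib]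
  rw [sum_mul_shift_comm (fun i => (b i : ℤ)) fun i => (b i : ℤ), two_mul]

theorem adjForm_sum_right {ι : Type*} (s : Finset ι) (b : ZMod n → ℕ) (b' : ι → ZMod n → ℕ) :
    adjForm b (∑ r ∈ s, b' r) = ∑ r ∈ s, adjForm b (b' r) := by
  simp only [adjForm]
  rw [Finset.sum_comm]
  refine Finset.sum_congr rfl fun i _ => ?_
  rw [← Finset.mul_sum, Finset.sum_add_distrib]
  simp

theorem Arc.sum_range_eq (A : Arc n) (f : ZMod n → ℤ) :
    ∑ a ∈ range A.length, f (A.start + (a : ZMod n)) = ∑ i, (A.degree i : ℤ) * f i := by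
  simp only [Arc.degree, Finset.sum_apply, Nat.cast_sum, Finset.sum_mul]
  rw [Finset.sum_comm]
  refine Finset.sum_congr rfl fun a _ => ?_
  simp [Pi.single_apply]

theorem card_adjacentPairs (A A' : Arc n) :
    (#(adjacentPairs A A') : ℤ) = adjForm A.degree A'.degree := by
  have h1 : ∀ c : ZMod n, ∑ b ∈ range A'.length, (if A'.start + (b : ZMod n) = c then (1 : ℤ) else 0)
      = A'.degree c := by
    intro c
    rw [Arc.sum_range_eq A' fun i => if i = c then (1 : ℤ) else 0]
    simp
  rw [adjForm, ← Arc.sum_range_eq A fun i => (A'.degree (i + 1) + A'.degree (i - 1) : ℤ),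
    adjacentPairs, Finset.card_filter]
  push_cast
  rw [Finset.sum_product, Fintype.sum_bool, Finset.sum_product, Finset.sum_product,
    ← Finset.sum_add_distrib]
  refine Finset.sum_congr rfl fun a _ => ?_
  rw [← h1, ← h1, add_comm]
  congr 1
  · refine Finset.sum_congr rfl fun b _ => if_congr ?_ rfl rfl
    simp only [Bool.false_eq_true, if_false]
    exact eq_comm
  · refine Finset.sum_congr rfl fun b _ => if_congr ?_ rfl rfl
    simp only [if_true]
    rw [eq_sub_iff_add_eq]
    exact eq_comm

variable {N : ℕ}

theorem degreeOf_pairPoly {ι : Type} [DecidableEq ι] (A : ι → Arc n) {r r' : ι} (h : r ≠ r')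
    (s : ι) : ((pairPoly A r r').degreeOf s : ℤ) =
      if s = r ∨ s = r' then adjForm (A r).degree (A r').degree else 0 := by
  rw [pairPoly, MvPolynomial.degreeOf_prod_eq _ _ fun _ _ => linForm_ne_zero h _,
    Finset.sum_congr rfl fun p _ => degreeOf_linForm h (ratio_ne_zero (A r) p) s,
    Finset.sum_const, ← card_adjacentPairs]
  split_ifs <;> simp

/-- Every arc other than s is paired with s exactly once, so only the term of s with itself is
missing from the pairing with the whole family. -/
theorem degreeOf_divisor (A : Fin N → Arc n) (s : Fin N) :
    ((divisor A).degreeOf s : ℤ) =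
      adjForm (A s).degree (∑ r, (A r).degree) - adjForm (A s).degree (A s).degree := by
  rw [divisor, MvPolynomial.degreeOf_prod_eq _ _ fun p hp =>
    pairPoly_ne_zero A (ne_of_mem_orderedPairs hp), Nat.cast_sum,
    Finset.sum_congr rfl fun p hp => degreeOf_pairPoly A (ne_of_mem_orderedPairs hp) s]
  have h1 : ∀ p ∈ orderedPairs A,
      (if s = p.1 ∨ s = p.2 then adjForm (A p.1).degree (A p.2).degree else 0) =
      (if s = p.1 then adjForm (A s).degree (A p.2).degree else 0) +
        if s = p.2 then adjForm (A s).degree (A p.1).degree else 0 := by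
    intro p hp
    have := ne_of_mem_orderedPairs hp
    by_cases h1 : s = p.1
    · have h2 : s ≠ p.2 := h1 ▸ this
      simp [h1, this]
    · by_cases h2 : s = p.2
      · rw [if_pos (Or.inr h2), if_neg h1, if_pos h2, zero_add, adjForm_comm, h2]
      · simp [h1, h2]
  rw [Finset.sum_congr rfl h1, Finset.sum_add_distrib, orderedPairs, Finset.sum_filter,
    Finset.sum_filter, Fintype.sum_prod_type, Fintype.sum_prod_type_right]
  have h2 : ∀ f : Fin N → Fin N → Prop, ∀ [∀ x y, Decidable (f x y)], ∀ c : Fin N → ℤ,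
      ∑ x, ∑ y, (if f x y then if s = x then c y else 0 else 0) =
        ∑ y, if f s y then c y else 0 := by
    intro f _ c
    rw [Finset.sum_eq_single s]
    · simp
    · intro x _ hx
      simp [hx.symm]
    · simp
  rw [h2 (fun x y => (A y).length < (A x).length ∨ (A x).length = (A y).length ∧ x < y)
    fun y => adjForm (A s).degree (A y).degree,
    h2 (fun y x => (A y).length < (A x).length ∨ (A x).length = (A y).length ∧ x < y)
    fun y => adjForm (A s).degree (A y).degree, ← Finset.sum_add_distrib, adjForm_sum_right,
    ← Finset.add_sum_erase _ _ (Finset.mem_univ s), ← Finset.add_sum_erase univ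
      (fun r => adjForm (A s).degree (A r).degree) (Finset.mem_univ s)]
  simp only [lt_irrefl, and_false, or_self, if_false, add_zero, zero_add, add_sub_cancel_left]
  refine Finset.sum_congr rfl fun r hr => ?_
  have hne : s ≠ r := (Finset.ne_of_mem_erase hr).symm
  have h3 := swap_mem_orderedPairs_iff (A := A) hne
  simp only [mem_orderedPairs] at h3
  by_cases h4 : (A r).length < (A s).length ∨ (A s).length = (A r).length ∧ s < r
  · rw [if_pos h4, if_neg (fun h => h3.mp h h4), add_zero]
  · rw [if_neg h4, if_pos (h3.mpr h4), zero_add]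

/-- Each linear form has total degree one but degree one in two variables, whence the factor 2. -/
theorem divisor_isHomogeneous (A : Fin N → Arc n) : ∃ D : ℕ, (divisor A).IsHomogeneous D ∧
    (2 * D : ℤ) = ∑ s, (adjForm (A s).degree (∑ r, (A r).degree) -
      adjForm (A s).degree (A s).degree) := by
  have h1 : ∀ p : Fin N × Fin N, (pairPoly A p.1 p.2).IsHomogeneous
      (#(adjacentPairs (A p.1) (A p.2))) := by
    intro p
    have := MvPolynomial.IsHomogeneous.prod (adjacentPairs (A p.1) (A p.2))
      (fun x => linForm p.1 p.2 (ratio (A p.1) x)) (fun _ => 1)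
      fun x _ => linForm_isHomogeneous _ _ _
    simpa [pairPoly] using this
  refine ⟨_, MvPolynomial.IsHomogeneous.prod (orderedPairs A) _ _ fun p _ => h1 p, ?_⟩
  simp only [← degreeOf_divisor]
  have h2 : ∀ s, ((divisor A).degreeOf s : ℤ) = ∑ p ∈ orderedPairs A,
      if s = p.1 ∨ s = p.2 then adjForm (A p.1).degree (A p.2).degree else 0 := by
    intro s
    rw [divisor, MvPolynomial.degreeOf_prod_eq _ _ fun p hp =>
      pairPoly_ne_zero A (ne_of_mem_orderedPairs hp), Nat.cast_sum,
      Finset.sum_congr rfl fun p hp => degreeOf_pairPoly A (ne_of_mem_orderedPairs hp) s]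
  simp only [h2]
  rw [Finset.sum_comm, Nat.cast_sum, Finset.mul_sum]
  refine Finset.sum_congr rfl fun p hp => ?_
  rw [card_adjacentPairs, ← Finset.sum_filter, Finset.sum_const]
  have h3 : (univ.filter fun s => s = p.1 ∨ s = p.2) = {p.1, p.2} := by
    ext s
    simp
  rw [h3, Finset.card_pair (ne_of_mem_orderedPairs hp)]
  simp

end Degrees

/-! ### The quotient by the divisor and its independent coefficients. -/

section Quotient

variable {n : ℕ} [NeZero n] {k : ZMod n → ℕ} {m : ZMod n → ℚ} {d : ℤ} {M : ℕ}

/-- Permuting base points among equal arcs does not change the multiset of colored points. -/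
theorem rename_specialize {ι : Type} [Fintype ι] {A : ι → Arc n}
    {R : MvPolynomial (Var k) BaseField} (hR : R ∈ polyPiece m k d M) (g : Var k ≃ Pos A)
    (hg : ∀ x, (g x).color = x.1) (σ : Equiv.Perm ι) (hσ : ∀ s, A (σ s) = A s) :
    MvPolynomial.rename σ (specialize g R) = specialize g R := by
  apply IsFractionRing.injective (MvPolynomial ι BaseField) (FractionRing (MvPolynomial ι BaseField))
  set L := FractionRing (MvPolynomial ι BaseField)
  set y : ι → L := fun r => algebraMap (MvPolynomial ι BaseField) L (MvPolynomial.X r) with hy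
  have h1 : ∀ p : MvPolynomial ι BaseField, algebraMap (MvPolynomial ι BaseField) L p =
      MvPolynomial.aeval y p := by
    intro p
    have : IsScalarTower.toAlgHom BaseField (MvPolynomial ι BaseField) L =
        MvPolynomial.aeval y := MvPolynomial.algHom_ext fun r => by simp [hy]
    rw [← this]
    rfl
  rw [h1, h1, MvPolynomial.aeval_rename, aeval_specialize, aeval_specialize]
  refine hR.1 L _ _ ?_
  rw [map_points_eq_sum_arcPoints g hg, map_points_eq_sum_arcPoints g hg,
    ← Equiv.sum_comp σ fun s => arcPoints (A s) (y s)]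
  simp only [hσ, Function.comp_apply]

theorem colors_fiber {ι : Type} [DecidableEq ι] {A : ι → Arc n} (g : Var k ≃ Pos A)
    (hg : ∀ x, (g x).color = x.1) (s : ι) :
    colors (univ.filter fun x => (g x).1 = s) = (A s).degree := by
  funext i
  have h1 : colors (univ.filter fun x => (g x).1 = s) i =
      ∑ x ∈ univ.filter (fun x : Var k => (g x).1 = s), if x.1 = i then 1 else 0 := by
    rw [sum_mem_color (univ.filter fun x : Var k => (g x).1 = s) (fun j => if j = i then 1 else 0)]
    simp
  rw [h1, Arc.degree_apply, Finset.card_filter]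
  symm
  refine Finset.sum_bij' (fun a ha => g.symm ⟨s, ⟨a, Finset.mem_range.mp ha⟩⟩)
    (fun x _ => ((g x).2 : ℕ)) (fun a ha => by simp) (fun x hx => ?_) (fun a ha => ?_)
    (fun x hx => ?_) fun a ha => ?_
  · rw [Finset.mem_range, ← (Finset.mem_filter.mp hx).2]
    exact (g x).2.2
  · exact congrArg (fun p : Pos A => (p.2 : ℕ)) (g.apply_symm_apply _)
  · obtain ⟨_, rfl⟩ := Finset.mem_filter.mp hx
    simp
  · rw [← hg, Equiv.apply_symm_apply]
    rfl

theorem degreeOf_specialize_le {ι : Type} [DecidableEq ι] {A : ι → Arc n} (g : Var k ≃ Pos A)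
    (s : ι) {R : MvPolynomial (Var k) BaseField} {D : ℕ}
    (h : ∀ e ∈ R.support, ∑ x ∈ univ.filter (fun x => (g x).1 = s), e x ≤ D) :
    (specialize g R).degreeOf s ≤ D := by
  rw [specialize, MvPolynomial.aeval_def, MvPolynomial.eval₂_eq']
  refine (MvPolynomial.degreeOf_sum_le _ _ _).trans (Finset.sup_le fun e he => ?_)
  rw [MvPolynomial.algebraMap_eq]
  refine (MvPolynomial.degreeOf_C_mul_le _ _ _).trans ((MvPolynomial.degreeOf_prod_le _ _ _).trans
    (le_trans ?_ (h e he)))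
  rw [Finset.sum_filter]
  refine Finset.sum_le_sum fun x _ => (MvPolynomial.degreeOf_pow_le _ _ _).trans ?_
  refine (Nat.mul_le_mul_left _ (MvPolynomial.degreeOf_C_mul_le _ _ _)).trans ?_
  rw [MvPolynomial.degreeOf_X]
  simp only [eq_comm]
  split_ifs <;> simp

theorem specialize_isHomogeneous {ι : Type} {A : ι → Arc n} (g : Var k ≃ Pos A)
    {R : MvPolynomial (Var k) BaseField} {D : ℕ} (h : ∀ e ∈ R.support, ∑ x, e x = D) :
    (specialize g R).IsHomogeneous D := by
  have h1 : R.IsHomogeneous D := by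
    intro e he
    rw [← h e (MvPolynomial.mem_support_iff.mpr he), Finsupp.weight_apply,
      Finsupp.sum_fintype _ _ (by simp)]
    simp
  have h2 := h1.aeval (fun x => MvPolynomial.C (τ ^ ((g x).2 : ℕ)) * MvPolynomial.X (g x).1)
    (n := 1) fun x => MvPolynomial.isHomogeneous_C_mul_X _ _
  rwa [one_mul] at h2

/-- The shift between the exponents of the quotient of a specialization by the divisor, and the
integers of the indexed partitions. -/
def offset (k : ZMod n → ℕ) (M : ℕ) (b : ZMod n → ℕ) : ℤ :=
  ∑ i, (b i : ℤ) * (k i - 1 + M) + ∑ i, (b i : ℤ) * b (i + 1) - adjForm b k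

/-- The second sum is twice the degree of the divisor; thus ∑ e_s plus that degree equals
`totalBound` exactly when ∑ (e_s - offset) = d. -/
theorem sum_offset {ι : Type} [Fintype ι] {b : ι → ZMod n → ℕ} (hb : ∑ s, b s = k) :
    2 * (d + ∑ s, offset k M (b s)) + ∑ s, (adjForm (b s) k - adjForm (b s) (b s)) =
      2 * totalBound k M d := by
  have h1 : ∑ s, adjForm (b s) k = 2 * ∑ i, (k i : ℤ) * k (i + 1) := by
    rw [← adjForm_self]
    have h3 : adjForm k k = ∑ s, adjForm k (b s) := by rw [← adjForm_sum_right, hb]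
    rw [h3]
    exact Finset.sum_congr rfl fun s _ => adjForm_comm _ _
  have h2 : ∑ s, ∑ i, (b s i : ℤ) * (k i - 1 + M) = ∑ i, (k i : ℤ) * (k i - 1 + M) := by
    rw [Finset.sum_comm]
    refine Finset.sum_congr rfl fun i _ => ?_
    rw [← Finset.sum_mul]
    congr 1
    rw [← congrFun hb i, Finset.sum_apply]
    push_cast
    rfl
  simp only [offset, totalBound, adjForm_self (b _), Finset.sum_sub_distrib,
    Finset.sum_add_distrib, h1, h2, ← Finset.mul_sum]
  ring

/-- The exponents that may occur in the quotient of a specialization by the divisor. -/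
def exponentPartition {N : ℕ} (k : ZMod n → ℕ) (M : ℕ) (A : Fin N → Arc n) (e : Fin N →₀ ℕ) :
    Multiset (Arc n × ℤ) :=
  (univ : Finset (Fin N)).val.map fun s => (A s, (e s : ℤ) - offset k M (A s).degree)

/-- Each e_s is at most the slope bound for the variables on the arc s minus the degree of the
divisor in y_s, and this difference is m·[i_s; j_s) plus the offset. The integers add up to d
because the quotient is homogeneous. -/
theorem exponentPartition_mem (ρ : ArcPartition k) {R : MvPolynomial (Var k) BaseField}
    (hR : R ∈ polyPiece m k d M) {p : MvPolynomial (Fin (Multiset.card ρ.1)) BaseField}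
    (hp : divisor ρ.arcs * p = specialize ρ.posEquiv R) {e : Fin (Multiset.card ρ.1) →₀ ℕ}
    (he : e ∈ p.support) :
    exponentPartition k M ρ.arcs e ∈ indexedPartitions m k d ∧
      (exponentPartition k M ρ.arcs e).map Prod.fst = ρ.1 := by
  have hp0 : p ≠ 0 := by
    rintro rfl
    simp at he
  have hR0 : R ≠ 0 := by
    rintro rfl
    rw [map_zero] at hp
    exact mul_ne_zero (divisor_ne_zero _) hp0 hp
  obtain ⟨e₀, he₀⟩ : ∃ e₀, R.coeff e₀ ≠ 0 := by
    by_contra! h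
    exact hR0 (MvPolynomial.ext _ _ (by simpa using h))
  have h1 : (exponentPartition k M ρ.arcs e).map Prod.fst = ρ.1 := by
    rw [exponentPartition, Multiset.map_map]
    exact ρ.map_arcs
  refine ⟨⟨?_, ?_, ?_⟩, h1⟩
  · have := ρ.2
    rw [← h1, Multiset.map_map] at this
    exact this
  · rw [exponentPartition, Multiset.map_map]
    change ∑ s, ((e s : ℤ) - offset k M (ρ.arcs s).degree) = d
    obtain ⟨D, hD, hD'⟩ := divisor_isHomogeneous ρ.arcs
    have h2 : (specialize ρ.posEquiv R).IsHomogeneous (totalBound k M d).toNat :=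
      specialize_isHomogeneous _ fun e' he' => by
        have := (hR.2.2 e' (MvPolynomial.mem_support_iff.mp he')).1
        rw [← this]
        norm_cast
    rw [← hp] at h2
    have h3 := IsHomogeneous.of_mul_left hD (divisor_ne_zero _) h2 he
    have h4 : ((totalBound k M d).toNat : ℤ) = totalBound k M d := by
      refine Int.toNat_of_nonneg ?_
      rw [← (hR.2.2 e₀ he₀).1]
      exact Finset.sum_nonneg fun _ _ => Int.natCast_nonneg _
    have h5 := sum_offset (d := d) (M := M) ρ.sum_degree
    rw [ρ.sum_degree] at hD'
    rw [Finsupp.degree_eq_sum] at h3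
    have h6 : (∑ s, (e s : ℤ)) + D = totalBound k M d := by
      rw [← h4, ← h3]
      push_cast
      rfl
    rw [Finset.sum_sub_distrib]
    linarith
  · intro x hx
    rw [exponentPartition, Multiset.mem_map] at hx
    obtain ⟨s, _, rfl⟩ := hx
    have h2 := MvPolynomial.monomial_le_degreeOf s he
    have h3 := MvPolynomial.degreeOf_mul_eq (n := s) (divisor_ne_zero ρ.arcs) hp0
    rw [hp] at h3
    have hcol := colors_fiber ρ.posEquiv ρ.color_posEquiv s
    have h4 : (specialize ρ.posEquiv R).degreeOf s ≤
        ⌊degBound m k M (ρ.arcs s).degree⌋₊ := by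
      refine degreeOf_specialize_le _ s fun e' he' => Nat.le_floor ?_
      have := (hR.2.2 e' (MvPolynomial.mem_support_iff.mp he')).2
        (univ.filter fun x => (ρ.posEquiv x).1 = s)
      rw [hcol] at this
      exact_mod_cast this
    -- The floor in ℕ truncates negative numbers to 0, so it is bounded by its argument only if the
    -- latter is nonnegative; a monomial of R shows this.
    have h5 : 0 ≤ degBound m k M (ρ.arcs s).degree := by
      have := (hR.2.2 e₀ he₀).2 (univ.filter fun x => (ρ.posEquiv x).1 = s)
      rw [hcol] at this
      exact le_trans (Finset.sum_nonneg fun _ _ => Nat.cast_nonneg _) this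
    have h6 : (((e s : ℤ) + ((divisor ρ.arcs).degreeOf s : ℤ) : ℤ) : ℚ) ≤
        degBound m k M (ρ.arcs s).degree := by
      refine le_trans ?_ (Nat.floor_le h5)
      exact_mod_cast (by omega : e s + (divisor ρ.arcs).degreeOf s ≤ _)
    rw [degreeOf_divisor, ρ.sum_degree, adjForm_self, degBound] at h6
    simp only [offset]
    push_cast at h6 ⊢
    linarith

/-- The specialization is invariant and the divisor invariant up to a unit, hence so is the
quotient. The unit is a nonzero constant, so the support is invariant, which is enough: the sign
need not be computed. -/
theorem coeff_mapDomain_ne_zero (ρ : ArcPartition k) {R : MvPolynomial (Var k) BaseField}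
    (hR : R ∈ polyPiece m k d M) {p : MvPolynomial (Fin (Multiset.card ρ.1)) BaseField}
    (hp : divisor ρ.arcs * p = specialize ρ.posEquiv R)
    (σ : Equiv.Perm (Fin (Multiset.card ρ.1))) (hσ : ∀ s, ρ.arcs (σ s) = ρ.arcs s)
    {e : Fin (Multiset.card ρ.1) →₀ ℕ} (he : p.coeff e ≠ 0) :
    p.coeff (e.mapDomain σ) ≠ 0 := by
  have h1 := rename_specialize hR ρ.posEquiv ρ.color_posEquiv σ hσ
  obtain ⟨u, hu⟩ := associated_rename_divisor ρ.arcs σ hσ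
  rw [← hp, map_mul] at h1
  have h2 : MvPolynomial.rename σ p = u * p := by
    have h3 : MvPolynomial.rename σ (divisor ρ.arcs) ≠ 0 := by
      intro h
      rw [h, zero_mul] at hu
      exact divisor_ne_zero _ hu.symm
    apply mul_left_cancel₀ h3
    linear_combination h1 - p * hu
  obtain ⟨c, hc, hc'⟩ := MvPolynomial.isUnit_iff_eq_C_of_isReduced.mp u.isUnit
  have h4 := MvPolynomial.coeff_rename_mapDomain σ σ.injective p e
  rw [h2, hc', MvPolynomial.coeff_C_mul] at h4
  intro h
  rw [h, mul_zero] at h4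
  exact he h4.symm

theorem exists_perm_of_exponentPartition_eq {N : ℕ} {A : Fin N → Arc n} {e e' : Fin N →₀ ℕ}
    (h : exponentPartition k M A e = exponentPartition k M A e') :
    ∃ σ : Equiv.Perm (Fin N), (∀ s, A (σ s) = A s) ∧ e.mapDomain σ = e' := by
  obtain ⟨σ, hσ⟩ := exists_equiv_of_map_univ_eq h
  simp only [Prod.mk.injEq] at hσ
  refine ⟨σ, fun s => (hσ s).1, ?_⟩
  ext s
  obtain ⟨s, rfl⟩ := σ.surjective s
  rw [Finsupp.mapDomain_apply σ.injective]
  have h1 := (hσ s).2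
  rw [(hσ s).1] at h1
  have : (e s : ℤ) = e' (σ s) := by linarith
  exact_mod_cast this

open Classical in
-- Two exponents give the same multiset exactly when a permutation of equal arcs relates them. The
-- support of a quotient is a union of such orbits, so a quotient whose coefficients vanish at one
-- representative of each orbit is zero.
theorem finrank_map_specialize_le (ρ : ArcPartition k)
    (hfin : {P | P ∈ indexedPartitions m k d ∧ P.map Prod.fst = ρ.1}.Finite)
    (U : Submodule BaseField (MvPolynomial (Var k) BaseField)) (hU : U ≤ polyPiece m k d M)
    (h0 : ∀ R ∈ U, ∀ ρ' : ArcPartition k, weight ρ.1 < weight ρ'.1 →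
      specialize ρ'.posEquiv R = 0) :
    Module.Finite BaseField (U.map (specialize ρ.posEquiv).toLinearMap) ∧
    Module.finrank BaseField (U.map (specialize ρ.posEquiv).toLinearMap) ≤
      {P | P ∈ indexedPartitions m k d ∧ P.map Prod.fst = ρ.1}.ncard := by
  set D := {P | P ∈ indexedPartitions m k d ∧ P.map Prod.fst = ρ.1}
  have : Fintype D := hfin.fintype
  set I := U.map (specialize ρ.posEquiv).toLinearMap
  set μ : MvPolynomial (Fin (Multiset.card ρ.1)) BaseField →ₗ[BaseField]
    MvPolynomial (Fin (Multiset.card ρ.1)) BaseField :=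
      LinearMap.mulLeft BaseField (divisor ρ.arcs)
  set W := I.comap μ
  have hWI : W.map μ = I := by
    refine le_antisymm (Submodule.map_comap_le _ _) ?_
    rintro _ ⟨R, hR, rfl⟩
    obtain ⟨p, hp⟩ := divisor_dvd_specialize (hU hR) ρ (h0 R hR)
    exact ⟨p, ⟨R, hR, hp⟩, hp.symm⟩
  -- One exponent is chosen over each indexed partition; partitions that come from no exponent get
  -- the zero functional.
  set Λ : W →ₗ[BaseField] (D → BaseField) := LinearMap.pi fun P =>
    if h : ∃ e, exponentPartition k M ρ.arcs e = P.1 then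
      (MvPolynomial.lcoeff BaseField h.choose).comp W.subtype else 0
  have hΛ : Function.Injective Λ := by
    rw [injective_iff_map_eq_zero]
    rintro ⟨p, R, hR, hp⟩ hzero
    have hp' : divisor ρ.arcs * p = specialize ρ.posEquiv R := hp.symm
    by_contra hne
    obtain ⟨e, he⟩ : ∃ e, p.coeff e ≠ 0 := by
      by_contra! h
      exact hne (Subtype.ext (MvPolynomial.ext _ _ (by simpa using h)))
    have hmem := exponentPartition_mem ρ (hU hR) hp' (MvPolynomial.mem_support_iff.mpr he)
    have h1 := congrFun hzero ⟨_, hmem⟩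
    have h2 : ∃ e', exponentPartition k M ρ.arcs e' = exponentPartition k M ρ.arcs e := ⟨e, rfl⟩
    obtain ⟨σ, hσ, hσ'⟩ := exists_perm_of_exponentPartition_eq h2.choose_spec.symm
    have h3 := coeff_mapDomain_ne_zero ρ (hU hR) hp' σ hσ he
    rw [hσ'] at h3
    refine h3 ?_
    simp only [Λ, LinearMap.pi_apply, dif_pos h2] at h1
    exact h1
  have hWf : Module.Finite BaseField W := Module.Finite.of_injective Λ hΛ
  have hW : Module.finrank BaseField W ≤ D.ncard := by
    refine (LinearMap.finrank_le_finrank_of_injective hΛ).trans ?_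
    rw [Module.finrank_fintype_fun_eq_card, ← Nat.card_eq_fintype_card]
    rfl
  rw [← hWI]
  exact ⟨inferInstance, (Submodule.finrank_map_le μ W).trans hW⟩

end Quotient

/-! ### Finiteness of the sets of partitions and the final count. -/

section Counting

theorem finite_setOf_multiset {α : Type*} (S : Finset α) (N : ℕ) :
    {P : Multiset α | Multiset.card P ≤ N ∧ ∀ a ∈ P, a ∈ S}.Finite := by
  classical
  refine (Set.finite_Iic (N • S.val)).subset ?_
  rintro P ⟨h1, h2⟩
  rw [Set.mem_Iic, Multiset.le_iff_count]
  intro a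
  by_cases ha : a ∈ P
  · rw [Multiset.count_nsmul, Multiset.count_eq_one_of_mem S.nodup (h2 a ha), mul_one]
    exact (Multiset.count_le_card a P).trans h1
  · rw [Multiset.count_eq_zero_of_notMem ha]
    exact Nat.zero_le _

variable {n : ℕ} [NeZero n]

/-- The arcs of length at most `N`. -/
noncomputable def shortArcs (n : ℕ) [NeZero n] (N : ℕ) : Finset (Arc n) :=
  open Classical in
  (univ : Finset (ZMod n × Fin N)).image fun p => ⟨p.1, ⟨(p.2 : ℕ) + 1, Nat.succ_pos _⟩⟩

theorem mem_shortArcs {N : ℕ} {A : Arc n} (h : (A.length : ℕ) ≤ N) : A ∈ shortArcs n N := by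
  classical
  have h1 := A.length.pos
  refine Finset.mem_image.mpr ⟨(A.start, ⟨(A.length : ℕ) - 1, by omega⟩), Finset.mem_univ _, ?_⟩
  obtain ⟨i, l⟩ := A
  refine congrArg (Arc.mk i) (PNat.coe_injective ?_)
  simp only [PNat.mk_coe] at h1 ⊢
  omega

theorem sum_length_eq {k : ZMod n → ℕ} {ρ : Multiset (Arc n)}
    (h : (ρ.map Arc.degree).sum = k) : (ρ.map fun A => (A.length : ℕ)).sum = ∑ i, k i := by
  subst h
  induction ρ using Multiset.induction_on with
  | empty => simp
  | cons A ρ ih =>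
    simp only [Multiset.map_cons, Multiset.sum_cons, Pi.add_apply, Finset.sum_add_distrib, ih,
      Arc.sum_degree]

theorem card_le_and_mem_shortArcs {k : ZMod n → ℕ} {ρ : Multiset (Arc n)}
    (h : (ρ.map Arc.degree).sum = k) :
    Multiset.card ρ ≤ ∑ i, k i ∧ ∀ A ∈ ρ, A ∈ shortArcs n (∑ i, k i) := by
  have h1 := sum_length_eq h
  constructor
  · rw [← h1]
    have := Multiset.card_nsmul_le_sum (s := ρ.map fun A => (A.length : ℕ)) (a := 1) (by
      intro x hx
      obtain ⟨A, _, rfl⟩ := Multiset.mem_map.mp hx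
      exact A.length.pos)
    simpa using this
  · intro A hA
    refine mem_shortArcs ?_
    rw [← h1]
    exact Multiset.single_le_sum (fun _ _ => Nat.zero_le _) _
      (Multiset.mem_map_of_mem (fun A : Arc n => (A.length : ℕ)) hA)

theorem finite_arcPartitions (k : ZMod n → ℕ) :
    {ρ : Multiset (Arc n) | (ρ.map Arc.degree).sum = k}.Finite :=
  (finite_setOf_multiset (shortArcs n (∑ i, k i)) (∑ i, k i)).subset fun _ h =>
    card_le_and_mem_shortArcs h

theorem finite_indexedPartitions (m : ZMod n → ℚ) (k : ZMod n → ℕ) (d : ℤ) :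
    (indexedPartitions m k d).Finite := by
  set N := ∑ i, k i
  set S := shortArcs n N
  set u : ℕ := ∑ A ∈ S, ⌈|scalarProd m A.degree|⌉₊ with hu
  have hle : ∀ A ∈ S, ∀ δ : ℤ, (δ : ℚ) ≤ scalarProd m A.degree → δ ≤ u := by
    intro A hA δ hδ
    have h1 : ⌈|scalarProd m A.degree|⌉₊ ≤ u :=
      Finset.single_le_sum (f := fun A : Arc n => ⌈|scalarProd m A.degree|⌉₊)
        (fun _ _ => Nat.zero_le _) hA
    have h2 : (δ : ℚ) ≤ (u : ℚ) := by
      refine hδ.trans ((le_abs_self _).trans ((Nat.le_ceil _).trans ?_))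
      exact_mod_cast h1
    exact_mod_cast h2
  -- Every integer is at most u, there are at most N of them, and their sum is d; hence each is at
  -- least d - N u.
  refine (finite_setOf_multiset (S ×ˢ Finset.Icc (d - N * u) u) N).subset ?_
  rintro P ⟨h1, h2, h3⟩
  have h1' : ((P.map Prod.fst).map Arc.degree).sum = k := by
    rw [Multiset.map_map]
    exact h1
  obtain ⟨h4, h5⟩ := card_le_and_mem_shortArcs h1'
  rw [Multiset.card_map] at h4
  have h6 : ∀ p ∈ P, p.1 ∈ S ∧ p.2 ≤ u := fun p hp =>
    have := h5 p.1 (Multiset.mem_map_of_mem Prod.fst hp)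
    ⟨this, hle p.1 this p.2 (h3 p hp)⟩
  refine ⟨h4, fun p hp => ?_⟩
  rw [Finset.mem_product, Finset.mem_Icc]
  refine ⟨(h6 p hp).1, ?_, (h6 p hp).2⟩
  obtain ⟨P', rfl⟩ := Multiset.exists_cons_of_mem hp
  rw [Multiset.map_cons, Multiset.sum_cons] at h2
  have h7 : (P'.map fun p => p.2).sum ≤ Multiset.card (P'.map fun p => p.2) • (u : ℤ) := by
    refine Multiset.sum_le_card_nsmul _ _ fun x hx => ?_
    obtain ⟨p', hp', rfl⟩ := Multiset.mem_map.mp hx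
    exact (h6 p' (Multiset.mem_cons_of_mem hp')).2
  rw [Multiset.card_map, nsmul_eq_mul] at h7
  rw [Multiset.card_cons] at h4
  have h8 : (Multiset.card P' : ℤ) * u ≤ N * u := by
    refine mul_le_mul_of_nonneg_right ?_ (Int.natCast_nonneg u)
    exact_mod_cast (Nat.le_succ _).trans h4
  linarith

theorem scalarProd_sum_degree (m : ZMod n → ℚ) (ρ : Multiset (Arc n)) :
    scalarProd m (ρ.map Arc.degree).sum = (ρ.map fun A => scalarProd m A.degree).sum := by
  induction ρ using Multiset.induction_on with
  | empty => simp [scalarProd]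
  | cons A ρ ih =>
    rw [Multiset.map_cons, Multiset.sum_cons, Multiset.map_cons, Multiset.sum_cons, ← ih]
    simp [scalarProd, mul_add, Finset.sum_add_distrib]

theorem eq_of_sum_eq_of_le {α : Type*} {P : Multiset α} {f g : α → ℚ} (h : ∀ a ∈ P, f a ≤ g a)
    (hs : (P.map g).sum ≤ (P.map f).sum) : ∀ a ∈ P, f a = g a := by
  intro a ha
  obtain ⟨P', rfl⟩ := Multiset.exists_cons_of_mem ha
  simp only [Multiset.map_cons, Multiset.sum_cons] at hs
  have h1 : (P'.map f).sum ≤ (P'.map g).sum :=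
    Multiset.sum_map_le_sum_map _ _ fun b hb => h b (Multiset.mem_cons_of_mem hb)
  exact le_antisymm (h a ha) (by linarith)

/-- Summing d_s ≤ m·[i_s; j_s) gives d ≤ m·k, an equality here, so every term is an equality. The
integers are then recovered from the arcs, and forgetting them is injective. -/
theorem ncard_indexedPartitions_le {m : ZMod n → ℚ} {k : ZMod n → ℕ} {d : ℤ}
    (hd : (d : ℚ) = scalarProd m k) :
    (indexedPartitions m k d).ncard ≤ (integralPartitions m k).ncard := by
  have key : ∀ P ∈ indexedPartitions m k d, ∀ p ∈ P, (p.2 : ℚ) = scalarProd m p.1.degree := by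
    rintro P ⟨h1, h2, h3⟩
    refine eq_of_sum_eq_of_le h3 (le_of_eq ?_)
    have h4 := scalarProd_sum_degree m (P.map Prod.fst)
    rw [Multiset.map_map, Multiset.map_map] at h4
    have h5 := congrArg (fun x : ℤ => (x : ℚ)) h2
    simp only [← Int.coe_castRingHom] at h5
    rw [map_multiset_sum, Multiset.map_map] at h5
    refine h4.symm.trans ((congrArg _ h1).trans (hd.symm.trans h5.symm))
  refine Set.ncard_le_ncard_of_injOn (fun P => P.map Prod.fst) (fun P hP => ?_) ?_
    ((finite_arcPartitions k).subset fun _ h => h.1)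
  · refine ⟨?_, fun A hA => ?_⟩
    · rw [Multiset.map_map]
      exact hP.1
    · obtain ⟨p, hp, rfl⟩ := Multiset.mem_map.mp hA
      exact ⟨p.2, key P hP p hp⟩
  · have hrec : ∀ P ∈ indexedPartitions m k d,
        P = (P.map Prod.fst).map fun A => (A, ⌊scalarProd m A.degree⌋) := by
      intro P hP
      rw [Multiset.map_map]
      nth_rewrite 1 [← Multiset.map_id P]
      refine Multiset.map_congr rfl fun p hp => ?_
      refine Prod.ext rfl ?_
      simp only [Function.comp_apply, ← key P hP p hp, Int.floor_intCast, id]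
    intro P hP P' hP' h
    rw [hrec P hP, hrec P' hP']
    exact congrArg _ h

theorem finite_and_finrank_le_of_specializations {K S P : Type*} [Field K] {σ : P → Type*}
    (V : Submodule K (MvPolynomial S K)) (T : Finset P) (w : P → ℕ)
    (f : ∀ p, MvPolynomial S K →ₐ[K] MvPolynomial (σ p) K) (c : P → ℕ)
    (hinj : ∀ R ∈ V, (∀ p ∈ T, f p R = 0) → R = 0)
    (hf : ∀ p ∈ T, ∀ U : Submodule K (MvPolynomial S K), U ≤ V →
      (∀ R ∈ U, ∀ p' ∈ T, w p < w p' → f p' R = 0) →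
      Module.Finite K (U.map (f p).toLinearMap) ∧
        Module.finrank K (U.map (f p).toLinearMap) ≤ c p) :
    Module.Finite K V ∧ Module.finrank K V ≤ ∑ p ∈ T, c p := by
  refine finite_and_finrank_le_of_filtration T w
    (fun p => (f p).toLinearMap.comp V.subtype) c
    (fun R hR => Subtype.ext (hinj R.1 R.2 hR)) fun p hp U hU => ?_
  rw [Submodule.map_comp]
  refine hf p hp (U.map V.subtype) (Submodule.map_subtype_le _ _) ?_
  rintro _ ⟨R, hR, rfl⟩ p' hp' hlt
  exact hU R hR p' hp' hlt

/-- The bounds at the various ρ count the disjoint fibres of the map that forgets the integers of an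
indexed partition. -/
theorem finrank_polyPiece_le (m : ZMod n → ℚ) (k : ZMod n → ℕ) (d : ℤ) (M : ℕ) :
    Module.Finite BaseField (polyPiece m k d M) ∧
      Module.finrank BaseField (polyPiece m k d M) ≤ (indexedPartitions m k d).ncard := by
  classical
  have : Fintype (ArcPartition k) := (finite_arcPartitions k).fintype
  have hfin := finite_indexedPartitions m k d
  have hfib : ∀ ρ : ArcPartition k,
      {P | P ∈ indexedPartitions m k d ∧ P.map Prod.fst = ρ.1}.Finite := fun ρ =>
    hfin.subset fun P h => h.1
  obtain ⟨h1, h2⟩ := finite_and_finrank_le_of_specializations (polyPiece m k d M)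
    (univ : Finset (ArcPartition k)) (fun ρ => weight ρ.1) (fun ρ => specialize ρ.posEquiv)
    (fun ρ => {P | P ∈ indexedPartitions m k d ∧ P.map Prod.fst = ρ.1}.ncard)
    (fun R hR h => eq_zero_of_forall_specialize_eq_zero hR fun ρ => h ρ (Finset.mem_univ ρ))
    fun ρ _ U hU h => finrank_map_specialize_le ρ (hfib ρ) U hU
      fun R hR ρ' hρ' => h R hR ρ' (Finset.mem_univ ρ') hρ'
  refine ⟨h1, h2.trans ?_⟩
  rw [Set.ncard_eq_toFinset_card _ hfin]
  have h3 : ∀ ρ : ArcPartition k,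
      {P | P ∈ indexedPartitions m k d ∧ P.map Prod.fst = ρ.1}.ncard =
        #(hfin.toFinset.filter fun P => P.map Prod.fst = ρ.1) := by
    intro ρ
    rw [← Set.ncard_coe_finset]
    congr 1
    ext P
    simp
  simp only [h3]
  rw [← Finset.card_biUnion]
  · exact Finset.card_le_card (Finset.biUnion_subset.mpr fun ρ _ => Finset.filter_subset _ _)
  · intro ρ _ ρ' _ hne
    rw [Function.onFun, Finset.disjoint_left]
    intro P hP hP'
    exact hne (Subtype.ext ((Finset.mem_filter.mp hP).2.symm.trans (Finset.mem_filter.mp hP').2))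

theorem finrank_slopePiece_le (m : ZMod n → ℚ) (k : ZMod n → ℕ) (d : ℤ) :
    Module.Finite BaseField (slopePiece m k d) ∧
      Module.finrank BaseField (slopePiece m k d) ≤ (indexedPartitions m k d).ncard := by
  obtain ⟨M, hM⟩ := exists_slopePiece_le_map m k d
  obtain ⟨h1, h2⟩ := finrank_polyPiece_le m k d M
  have h3 : Module.Finite BaseField ((polyPiece m k d M).map (ofNumerator k M)) := inferInstance
  exact ⟨Submodule.finiteDimensional_of_le hM,
    (Submodule.finrank_mono hM).trans ((Submodule.finrank_map_le _ _).trans h2)⟩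

/-- At most one integer d equals m·k, so the supremum has at most one term. -/
theorem finrank_slopeSubalgebraPiece_le (m : ZMod n → ℚ) (k : ZMod n → ℕ) :
    Module.Finite BaseField (slopeSubalgebraPiece m k) ∧
      Module.finrank BaseField (slopeSubalgebraPiece m k) ≤ (integralPartitions m k).ncard := by
  by_cases h : ∃ d : ℤ, (d : ℚ) = scalarProd m k
  · obtain ⟨d, hd⟩ := h
    have h1 : slopeSubalgebraPiece m k = slopePiece m k d := by
      refine le_antisymm (iSup₂_le fun d' hd' => ?_)
        (le_iSup₂_of_le (f := fun (d : ℤ) (_ : (d : ℚ) = scalarProd m k) => slopePiece m k d)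
          d hd le_rfl)
      have : d' = d := by exact_mod_cast hd'.trans hd.symm
      rw [this]
    rw [h1]
    obtain ⟨h2, h3⟩ := finrank_slopePiece_le m k d
    exact ⟨h2, h3.trans (ncard_indexedPartitions_le hd)⟩
  · have h1 : slopeSubalgebraPiece m k = ⊥ :=
      eq_bot_iff.mpr (iSup₂_le fun d hd => absurd ⟨d, hd⟩ h)
    rw [h1]
    exact ⟨inferInstance, by simp⟩

end Counting

end CyclicShuffle

theorem mainTheorem8 (n : ℕ) [NeZero n] (hn : 1 < n) (m : ZMod n → ℚ) (k : ZMod n → ℕ) :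
    (∀ d : ℤ,
      (CyclicShuffle.indexedPartitions m k d).Finite ∧
      Module.Finite CyclicShuffle.BaseField (CyclicShuffle.slopePiece m k d) ∧
      Module.finrank CyclicShuffle.BaseField (CyclicShuffle.slopePiece m k d) ≤
        (CyclicShuffle.indexedPartitions m k d).ncard) ∧
    ((CyclicShuffle.integralPartitions m k).Finite ∧
      Module.Finite CyclicShuffle.BaseField (CyclicShuffle.slopeSubalgebraPiece m k) ∧
      Module.finrank CyclicShuffle.BaseField (CyclicShuffle.slopeSubalgebraPiece m k) ≤
        (CyclicShuffle.integralPartitions m k).ncard) :=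
  ⟨fun d => ⟨CyclicShuffle.finite_indexedPartitions m k d,
    CyclicShuffle.finrank_slopePiece_le m k d⟩,
    (CyclicShuffle.finite_arcPartitions k).subset fun _ h => h.1,
    CyclicShuffle.finrank_slopeSubalgebraPiece_le m k⟩
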